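/- Let $M^m$ be a smooth $m$-manifold and let $(N^{m+1}(c),g)$ be a smooth Riemannian $(m+1)$-manifold of constant sectional curvature $c$ (for instance a space form, i.e. a complete one), with Levi-Civita connection $\nabla$; its pull-back along a map into $N^{m+1}(c)$ is also denoted by $\nabla$. Let $f\colon M^m\to N^{m+1}(c)$ be a co-orientable frontal with unit normal vector field $\nu$; that is, $f$ is a $C^\infty$-map and $\nu$ is a $C^\infty$ vector field along $f$, defined on all of $M^m$, with $g(\nu,\nu)=1$ and $g(df(X),\nu)=0$ for all tangent vectors $X$ of $M^m$. Put $$(\mathcal E_f)_p=\{w\in T_{f(p)}N : g(w,\nu_p)=0\},\qquad \phi_f(X)=df(X),\qquad \psi_f(X)=\nabla_X\nu ,$$ let $\langle\ ,\ \rangle$ be the restriction of $g$ to $\mathcal E_f$, and for a section $\xi$ of $\mathcal E_f$ let $D_X\xi$ be the orthogonal projection of $\nabla_X\xi$ to $\mathcal E_f$. Then $\mathcal E_f$ is a smooth subbundle of rank $m$ of $f^*TN$, $\psi_f$ takes values in $\mathcal E_f$, and $(M^m,\mathcal E_f,\langle\ ,\ \rangle,D,\phi_f,\psi_f)$ is a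 frontal bundle; that is, $D$ is a (smooth) metric connection on $(\mathcal E_f,\langle\ ,\ \rangle)$, the maps $\phi=\phi_f$ and $\psi=\psi_f$ are smooth bundle homomorphisms $TM^m\to\mathcal E_f$, and for all smooth vector fields $X,Y$ on $M^m$ $$D_X\phi(Y)-D_Y\phi(X)-\phi([X,Y])=0,\qquad D_X\psi(Y)-D_Y\psi(X)-\psi([X,Y])=0,$$ $$\langle\phi(X),\psi(Y)\rangle=\langle\phi(Y),\psi(X)\rangle .$$ If $N^{m+1}(c)$ is orientable, then the bundle $\mathcal E_f$ is orientable. Moreover the Gauss equation $$\langle R^D(X,Y)\xi,\zeta\rangle= c\det\begin{pmatrix}\langle\phi(Y),\xi\rangle&\langle\phi(Y),\zeta\rangle\\ \langle\phi(X),\xi\rangle&\langle\phi(X),\zeta\rangle\end{pmatrix} +\det\begin{pmatrix}\langle\psi(Y),\xi\rangle&\langle\psi(Y),\zeta\rangle\\ \langle\psi(X),\xi\rangle&\langle\psi(X),\zeta\rangle\end{pmatrix}$$ holds for all smooth vector fields $X,Y$ on $M^m$ and all smooth sections $\xi,\zeta$ of $\mathcal E_f$, where $R^D(X,Y)\xi=D_XD_Y\xi-D_YD_X\xi-D_{[X,Y]}\xi$.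 Furthermore, this frontal bundle is a front bundle, i.e. $\operatorname{Ker}\phi_p\cap\operatorname{Ker}\psi_p=\{0\}$ for every $p\in M^m$, if and only if $f$ is a front with respect to $\nu$, i.e. the map $\nu\colon M^m\to T_1N^{m+1}(c)$ into the unit tangent bundle is an immersion. If the set of points at which $df$ is injective is dense in $M^m$, this is also equivalent to $f$ being a front in the sense that every point of $M^m$ has a neighbourhood on which some smooth unit normal vector field of $f$ is an immersion into $T_1N^{m+1}(c)$. -/

import Mathlib

open Bundle Manifold
open scoped ContDiff

noncomputable section

/-! ### Vector bundles with an inner product and a connection -/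

section General

variable {m k : ℕ}
  {M : Type*} [TopologicalSpace M] [ChartedSpace (EuclideanSpace ℝ (Fin m)) M]
  [IsManifold (𝓡 m) ∞ M]
  {E : M → Type*} [TopologicalSpace (TotalSpace (EuclideanSpace ℝ (Fin k)) E)]
  [∀ x, NormedAddCommGroup (E x)] [∀ x, InnerProductSpace ℝ (E x)]
  [FiberBundle (EuclideanSpace ℝ (Fin k)) E] [VectorBundle ℝ (EuclideanSpace ℝ (Fin k)) E]

/-- A smooth vector field on the manifold `M`. -/
def IsSmoothVectorField (X : Π x : M, TangentSpace (𝓡 m) x) : Prop :=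
  ContMDiff (𝓡 m) (𝓡 m).tangent ∞ (fun x ↦ (⟨x, X x⟩ : TangentBundle (𝓡 m) M))

/-- `ξ` is a smooth section over the set `U` of the vector bundle `E` of rank `k`. -/
def IsSmoothSectionOn (m k : ℕ) {M : Type*} [TopologicalSpace M]
    [ChartedSpace (EuclideanSpace ℝ (Fin m)) M] {E : M → Type*}
    [TopologicalSpace (TotalSpace (EuclideanSpace ℝ (Fin k)) E)]
    [∀ x, NormedAddCommGroup (E x)] [∀ x, InnerProductSpace ℝ (E x)]
    [FiberBundle (EuclideanSpace ℝ (Fin k)) E] (ξ : Π x : M, E x) (U : Set M) : Prop :=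
  ContMDiffOn (𝓡 m) ((𝓡 m).prod 𝓘(ℝ, EuclideanSpace ℝ (Fin k))) ∞
    (fun x ↦ TotalSpace.mk' (EuclideanSpace ℝ (Fin k)) x (ξ x)) U

/-- A smooth bundle homomorphism `TM → E`. -/
def IsSmoothBundleHom (m k : ℕ) {M : Type*} [TopologicalSpace M]
    [ChartedSpace (EuclideanSpace ℝ (Fin m)) M] [IsManifold (𝓡 m) ∞ M]
    {E : M → Type*} [TopologicalSpace (TotalSpace (EuclideanSpace ℝ (Fin k)) E)]
    [∀ x, NormedAddCommGroup (E x)] [∀ x, InnerProductSpace ℝ (E x)]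
    [FiberBundle (EuclideanSpace ℝ (Fin k)) E] [VectorBundle ℝ (EuclideanSpace ℝ (Fin k)) E]
    (φ : Π x : M, TangentSpace (𝓡 m) x →L[ℝ] E x) : Prop :=
  ContMDiff (𝓡 m)
    ((𝓡 m).prod 𝓘(ℝ, EuclideanSpace ℝ (Fin m) →L[ℝ] EuclideanSpace ℝ (Fin k))) ∞
    (fun x ↦ TotalSpace.mk' (EuclideanSpace ℝ (Fin m) →L[ℝ] EuclideanSpace ℝ (Fin k)) x (φ x))

/-- The curvature
`R^D(X,Y)ξ = D_X D_Y ξ - D_Y D_X ξ - D_{[X,Y]} ξ` of a connection `D` on `E`.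
(Mathlib writes `D ξ x (X x)` for `(D_X ξ)(x)`.) -/
def connectionCurvature (D : CovariantDerivative (𝓡 m) (EuclideanSpace ℝ (Fin k)) E)
    (X Y : Π x : M, TangentSpace (𝓡 m) x) (ξ : Π x : M, E x) (x : M) : E x :=
  D (fun y ↦ D ξ y (Y y)) x (X x) - D (fun y ↦ D ξ y (X y)) x (Y x)
    - D ξ x (VectorField.mlieBracket (𝓡 m) X Y x)

/-- Orientability of a rank `k` vector bundle with inner product: there is a smooth section `μ` of
the determinant bundle of the dual bundle (an alternating `k`-form on each fibre, whose values on
smooth local sections are smooth) with `μ(e₁, …, e_k) = ±1` on every orthonormal frame. -/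
def IsOrientableBundle (m k : ℕ) {M : Type*} [TopologicalSpace M]
    [ChartedSpace (EuclideanSpace ℝ (Fin m)) M] (E : M → Type*)
    [TopologicalSpace (TotalSpace (EuclideanSpace ℝ (Fin k)) E)]
    [∀ x, NormedAddCommGroup (E x)] [∀ x, InnerProductSpace ℝ (E x)]
    [FiberBundle (EuclideanSpace ℝ (Fin k)) E] : Prop :=
  ∃ μ : Π x : M, (E x) [⋀^Fin k]→ₗ[ℝ] ℝ,
    (∀ (U : Set M) (s : Fin k → Π x : M, E x), IsOpen U →
      (∀ i, IsSmoothSectionOn m k (s i) U) →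
      ContMDiffOn (𝓡 m) 𝓘(ℝ, ℝ) ∞ (fun x ↦ μ x (fun i ↦ s i x)) U) ∧
    ∀ (x : M) (e : Fin k → E x), Orthonormal ℝ e → μ x e = 1 ∨ μ x e = -1

set_option synthInstance.maxHeartbeats 200000 in
/-- `∇` is the Levi-Civita connection of the Riemannian manifold `M`: the smooth, metric and
torsion-free connection on the tangent bundle. -/
structure IsLeviCivita [RiemannianBundle (fun x : M ↦ TangentSpace (𝓡 m) x)]
    [IsContMDiffRiemannianBundle (𝓡 m) ∞ (EuclideanSpace ℝ (Fin m))
      (fun x : M ↦ TangentSpace (𝓡 m) x)]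
    (nabla : CovariantDerivative (𝓡 m) (EuclideanSpace ℝ (Fin m))
      (fun x : M ↦ TangentSpace (𝓡 m) x)) : Prop where
  smooth : nabla.ContMDiffCovariantDerivative ∞
  metric : nabla.IsMetricCompatible
  torsionFree : nabla.torsion = 0

/-- The connection `∇` (meant to be the Levi-Civita connection) has constant sectional curvature
`c`: `⟨R(X,Y)Y, X⟩ = c (|X|²|Y|² - ⟨X,Y⟩²)`. -/
def HasConstantCurvature [RiemannianBundle (fun x : M ↦ TangentSpace (𝓡 m) x)]
    (nabla : CovariantDerivative (𝓡 m) (EuclideanSpace ℝ (Fin m))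
      (fun x : M ↦ TangentSpace (𝓡 m) x)) (c : ℝ) : Prop :=
  ∀ X Y : Π x : M, TangentSpace (𝓡 m) x, IsSmoothVectorField X → IsSmoothVectorField Y →
    ∀ x, inner ℝ (connectionCurvature nabla X Y Y x) (X x) =
      c * (inner ℝ (X x) (X x) * inner ℝ (Y x) (Y x) - inner ℝ (X x) (Y x) ^ 2)

end General

/-! ### Coherent tangent bundles, frontal bundles and front bundles -/

section FrontalBundles

variable {m : ℕ}
  {M : Type*} [TopologicalSpace M] [ChartedSpace (EuclideanSpace ℝ (Fin m)) M]
  [IsManifold (𝓡 m) ∞ M]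
  {E : M → Type*} [TopologicalSpace (TotalSpace (EuclideanSpace ℝ (Fin m)) E)]
  [∀ x, NormedAddCommGroup (E x)] [∀ x, InnerProductSpace ℝ (E x)]
  [FiberBundle (EuclideanSpace ℝ (Fin m)) E] [VectorBundle ℝ (EuclideanSpace ℝ (Fin m)) E]
  [ContMDiffVectorBundle ∞ (EuclideanSpace ℝ (Fin m)) E (𝓡 m)]
  [IsContMDiffRiemannianBundle (𝓡 m) ∞ (EuclideanSpace ℝ (Fin m)) E]

/-- The smooth vector bundle `E` over `M^m`, of rank `m` and with smooth inner product, is with `D`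
and `φ` a coherent tangent bundle: `D` is a smooth metric connection, `φ : TM → E` is a smooth
bundle homomorphism, and `D_X φ(Y) - D_Y φ(X) - φ([X,Y]) = 0`. -/
structure IsCoherentTangentBundle
    (D : CovariantDerivative (𝓡 m) (EuclideanSpace ℝ (Fin m)) E)
    (φ : Π x : M, TangentSpace (𝓡 m) x →L[ℝ] E x) : Prop where
  smooth_connection : D.ContMDiffCovariantDerivative ∞
  metric : D.IsMetricCompatible
  smooth_hom : IsSmoothBundleHom m m φ
  codazzi : ∀ X Y : Π x : M, TangentSpace (𝓡 m) x,
    IsSmoothVectorField X → IsSmoothVectorField Y → ∀ x,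
      D (fun y ↦ φ y (Y y)) x (X x) - D (fun y ↦ φ y (X y)) x (Y x)
        - φ x (VectorField.mlieBracket (𝓡 m) X Y x) = 0

/-- A frontal bundle with first homomorphism `φ` and second homomorphism `ψ`. (Orientability of
`E` is the separate predicate `IsOrientableBundle`.) -/
structure IsFrontalBundle
    (D : CovariantDerivative (𝓡 m) (EuclideanSpace ℝ (Fin m)) E)
    (φ ψ : Π x : M, TangentSpace (𝓡 m) x →L[ℝ] E x) : Prop where
  coherent_fst : IsCoherentTangentBundle D φ
  coherent_snd : IsCoherentTangentBundle D ψ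
  compatible : ∀ (x : M) (v w : TangentSpace (𝓡 m) x),
    inner ℝ (φ x v) (ψ x w) = inner ℝ (φ x w) (ψ x v)

/-- A front bundle: a frontal bundle with `Ker φ_p ∩ Ker ψ_p = {0}` at every point. -/
structure IsFrontBundle
    (D : CovariantDerivative (𝓡 m) (EuclideanSpace ℝ (Fin m)) E)
    (φ ψ : Π x : M, TangentSpace (𝓡 m) x →L[ℝ] E x) : Prop extends
    IsFrontalBundle D φ ψ where
  ker_inter : ∀ x : M, LinearMap.ker (φ x).toLinearMap ⊓ LinearMap.ker (ψ x).toLinearMap = ⊥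

/-- The Gauss equation with constant `c`. -/
def GaussEquation (c : ℝ)
    (D : CovariantDerivative (𝓡 m) (EuclideanSpace ℝ (Fin m)) E)
    (φ ψ : Π x : M, TangentSpace (𝓡 m) x →L[ℝ] E x) : Prop :=
  ∀ (X Y : Π x : M, TangentSpace (𝓡 m) x) (ξ ζ : Π x : M, E x),
    IsSmoothVectorField X → IsSmoothVectorField Y →
    IsSmoothSectionOn m m ξ Set.univ → IsSmoothSectionOn m m ζ Set.univ → ∀ x,
      inner ℝ (connectionCurvature D X Y ξ x) (ζ x) =
        c * Matrix.det !![inner ℝ (φ x (Y x)) (ξ x), inner ℝ (φ x (Y x)) (ζ x);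
                          inner ℝ (φ x (X x)) (ξ x), inner ℝ (φ x (X x)) (ζ x)]
          + Matrix.det !![inner ℝ (ψ x (Y x)) (ξ x), inner ℝ (ψ x (Y x)) (ζ x);
                          inner ℝ (ψ x (X x)) (ξ x), inner ℝ (ψ x (X x)) (ζ x)]

end FrontalBundles

/-! ### Frontals and the data they induce -/

section Frontals

variable {m : ℕ}
  {M : Type*} [TopologicalSpace M] [ChartedSpace (EuclideanSpace ℝ (Fin m)) M]
  [IsManifold (𝓡 m) ∞ M]
  {N : Type*} [TopologicalSpace N] [ChartedSpace (EuclideanSpace ℝ (Fin (m + 1))) N]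
  [IsManifold (𝓡 (m + 1)) ∞ N]
  [RiemannianBundle (fun x : N ↦ TangentSpace (𝓡 (m + 1)) x)]

/-- A vector field `ξ` along `f`, as a map `M → TN`. -/
def alongMap (f : M → N) (ξ : Π p : M, TangentSpace (𝓡 (m + 1)) (f p)) (p : M) :
    TangentBundle (𝓡 (m + 1)) N :=
  ⟨f p, ξ p⟩

/-- `ν` is a smooth unit normal vector field along `f` on the set `U`. -/
structure IsUnitNormalOn (f : M → N) (ν : Π p : M, TangentSpace (𝓡 (m + 1)) (f p))
    (U : Set M) : Prop where
  smooth : ContMDiffOn (𝓡 m) (𝓡 (m + 1)).tangent ∞ (alongMap f ν) U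
  unit : ∀ p ∈ U, inner ℝ (ν p) (ν p) = (1 : ℝ)
  normal : ∀ p ∈ U, ∀ v : TangentSpace (𝓡 m) p,
    inner ℝ (mfderiv (𝓡 m) (𝓡 (m + 1)) f p v : TangentSpace (𝓡 (m + 1)) (f p)) (ν p) = (0 : ℝ)

/-- The unit vector field `ν` along `f` is an immersion on `U`. As the unit tangent bundle is an
embedded submanifold of `TN`, a map into it is an immersion if and only if it is one as a map into
`TN`. -/
def IsImmersiveOn (f : M → N) (ν : Π p : M, TangentSpace (𝓡 (m + 1)) (f p)) (U : Set M) : Prop :=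
  ∀ p ∈ U, Function.Injective (mfderiv (𝓡 m) (𝓡 (m + 1)).tangent (alongMap f ν) p)

/-- `f` is a front: near each point some smooth unit normal vector field of `f` is an immersion
into the unit tangent bundle. -/
def IsFront (m : ℕ) {M : Type*} [TopologicalSpace M]
    [ChartedSpace (EuclideanSpace ℝ (Fin m)) M]
    {N : Type*} [TopologicalSpace N] [ChartedSpace (EuclideanSpace ℝ (Fin (m + 1))) N]
    [IsManifold (𝓡 (m + 1)) ∞ N] [RiemannianBundle (fun x : N ↦ TangentSpace (𝓡 (m + 1)) x)]
    (f : M → N) : Prop :=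
  ContMDiff (𝓡 m) (𝓡 (m + 1)) ∞ f ∧
    ∀ p : M, ∃ U : Set M, IsOpen U ∧ p ∈ U ∧
      ∃ ν : Π p : M, TangentSpace (𝓡 (m + 1)) (f p), IsUnitNormalOn f ν U ∧ IsImmersiveOn f ν U

/-- The fibre at `p` of `E_f`: the vectors of `T_{f(p)}N` perpendicular to `ν(p)`, with the inner
product induced from `N`. -/
abbrev NormalPerp (f : M → N) (ν : Π p : M, TangentSpace (𝓡 (m + 1)) (f p)) (p : M) : Type :=
  ↥((Submodule.span ℝ {ν p})ᗮ)

/-- Orthogonal projection (the tangential part) `T_{f(p)}N → (E_f)_p`. -/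
def tangentialPart (f : M → N) (ν : Π p : M, TangentSpace (𝓡 (m + 1)) (f p)) (p : M) :
    TangentSpace (𝓡 (m + 1)) (f p) →L[ℝ] NormalPerp f ν p :=
  ((Submodule.span ℝ {ν p})ᗮ).orthogonalProjectionOnto

/-- The pull-back along `f` of a connection `∇` on `TN`: the covariant derivative `v ↦ ∇_v ξ` at
`p` of a vector field `ξ` along `f`. In the local trivialization `t` of `TN` around `f p`, with
frame `e_i` and `ξ = ∑ ξⁱ e_i`, it is `∑ dξⁱ(v) e_i + ∑ ξⁱ(p) ∇_{df(v)} e_i`; the first sum is the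
first term below, and `FiberBundle.extend` is the section of `TN` with the constant coefficients
`ξⁱ(p)` in the frame `e_i`. -/
def pullbackDerivative
    (nabla : CovariantDerivative (𝓡 (m + 1)) (EuclideanSpace ℝ (Fin (m + 1)))
      (fun x : N ↦ TangentSpace (𝓡 (m + 1)) x))
    (f : M → N) (ξ : Π p : M, TangentSpace (𝓡 (m + 1)) (f p)) (p : M) :
    TangentSpace (𝓡 m) p →L[ℝ] TangentSpace (𝓡 (m + 1)) (f p) :=
  letI t := trivializationAt (EuclideanSpace ℝ (Fin (m + 1)))
    (fun x : N ↦ TangentSpace (𝓡 (m + 1)) x) (f p)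
  letI dξ : TangentSpace (𝓡 m) p →L[ℝ] EuclideanSpace ℝ (Fin (m + 1)) :=
    mfderiv (𝓡 m) 𝓘(ℝ, EuclideanSpace ℝ (Fin (m + 1))) (fun q ↦ (t (alongMap f ξ q)).2) p
  (t.symmL ℝ (f p)).comp dξ
    + (nabla (FiberBundle.extend (EuclideanSpace ℝ (Fin (m + 1))) (ξ p)) (f p)).comp
        (mfderiv (𝓡 m) (𝓡 (m + 1)) f p)

/-- The connection on `E_f`: the tangential part of `∇`. -/
def inducedDerivative
    (nabla : CovariantDerivative (𝓡 (m + 1)) (EuclideanSpace ℝ (Fin (m + 1)))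
      (fun x : N ↦ TangentSpace (𝓡 (m + 1)) x))
    (f : M → N) (ν : Π p : M, TangentSpace (𝓡 (m + 1)) (f p))
    (ξ : Π p : M, NormalPerp f ν p) (p : M) :
    TangentSpace (𝓡 m) p →L[ℝ] NormalPerp f ν p :=
  (tangentialPart f ν p).comp (pullbackDerivative nabla f (fun q ↦ (ξ q : TangentSpace (𝓡 (m + 1)) (f q))) p)

/-- A vector bundle structure on `E_f` is that of a subbundle of `f^*TN`: its smooth
local sections are the smooth vector fields along `f` that are perpendicular to `ν`. This determines
the smooth structure of `E_f`. -/
def IsSubbundleStructure (f : M → N) (ν : Π p : M, TangentSpace (𝓡 (m + 1)) (f p))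
    [TopologicalSpace (TotalSpace (EuclideanSpace ℝ (Fin m)) (NormalPerp f ν))]
    [FiberBundle (EuclideanSpace ℝ (Fin m)) (NormalPerp f ν)] : Prop :=
  ∀ (U : Set M) (ξ : Π p : M, NormalPerp f ν p), IsOpen U →
    (IsSmoothSectionOn m m ξ U ↔
      ContMDiffOn (𝓡 m) (𝓡 (m + 1)).tangent ∞ 
        (alongMap f (fun p ↦ (ξ p : TangentSpace (𝓡 (m + 1)) (f p)))) U)

end Frontals

end

/-! Since `f` need not be an immersion, `df(X)` and `ν` are in general not restrictions of vector
fields of `N`, so the classical hypersurface computation has to be carried out with vector fields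
along `f`. Near a point every such field is a sum of terms `g • (Z ∘ f)`, with `g` a function on `M`
and `Z` a global smooth field on `N`. An identity that is additive and compatible with the Leibniz
rule therefore only has to be checked on fields `Z ∘ f`, where it is the chain rule; this is the
content of the two `along_induction` principles.

They give three facts about the pulled-back connection. It is metric (`mvfderiv_inner_along`); it
satisfies `∇_X df(Y) - ∇_Y df(X) = df([X,Y])` (`along_mfderiv_sub`); and its curvature is `R(df(X),
df(Y))ξ` (`curvature_along`). Constant sectional curvature determines the whole tensor, `R(X,Y)Z =
c(⟨Y,Z⟩X - ⟨X,Z⟩Y)` (`connectionCurvature_eq`).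

The structure equations are components of these facts. The tangential part of the torsion identity
is the Codazzi equation for `φ`; its normal part, combined with `⟨df(X), ν⟩ = 0`, is the symmetry of
`⟨φ(X), ψ(Y)⟩`. As `ν` is normal, `R(df(X), df(Y))ν = 0`, which is the Codazzi equation for `ψ`. For
sections `ξ` of `E_f` one has `∇_X ξ = D_X ξ - ⟨ψ(X), ξ⟩ν`, and differentiating once more yields the
Gauss equation.

The bundle `E_f` is glued from local orthonormal frames produced by Gram-Schmidt; their transition
matrices have inner products as entries and are smooth. Contracting a volume form of `N` with `ν`
orients `E_f`.

For the front criterion, the kernel of the differential of `ν : M → TN` is `Ker df ∩ Ker ∇ν`, since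
on `Ker df` the covariant derivative is the derivative of the fibre coordinates. If `df` is
injective on a dense set, any other local unit normal is `aν` with `a² = 1` by continuity. Hence `da
= 0`, the covariant derivatives are proportional, and the choice of normal field does not matter. -/

noncomputable section

/-! ### Lie brackets as commutators of derivations; globalizing local sections -/

section Generic

open VectorField Filter
open scoped Topology

variable {E : Type*} [NormedAddCommGroup E] [NormedSpace ℝ E] [FiniteDimensional ℝ E]
  {H : Type*} [TopologicalSpace H] {I : ModelWithCorners ℝ E H}
  {M : Type*} [TopologicalSpace M] [ChartedSpace H M]

/-- A vector field acts on functions as a derivation, and the Lie bracket is the commutator. -/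
theorem mvfderiv_mlieBracket [IsManifold I ∞ M] {h : M → ℝ} {X Y : Π x : M, TangentSpace I x}
    {p : M} (hh : CMDiffAt ∞ h p) (hX : CMDiffAt ∞ (T% X) p) (hY : CMDiffAt ∞ (T% Y) p)
    (hXh : MDiffAt (fun x ↦ d% h x (X x)) p) (hYh : MDiffAt (fun x ↦ d% h x (Y x)) p) :
    d% h p (mlieBracket I X Y p) =
      d% (fun x ↦ d% h x (Y x)) p (X p) - d% (fun x ↦ d% h x (X x)) p (Y p) := by
  rcases subsingleton_or_nontrivial E with hE | hE
  · have : Subsingleton (TangentSpace I p) := hE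
    rw [Subsingleton.elim (mlieBracket I X Y p) 0, Subsingleton.elim (X p) 0,
      Subsingleton.elim (Y p) 0]
    -- In the trivial model space all tangent vectors vanish. Otherwise a field `Z` with `Z p ≠ 0`
    -- is available, and the scalar identity can be read off as a coefficient of `Z p`.
    simp
  obtain ⟨z, hz⟩ : ∃ z : TangentSpace I p, z ≠ 0 := exists_ne (0 : E)
  set Z : Π x : M, TangentSpace I x := FiberBundle.extend E z with hZdef
  have hZ : CMDiffAt ∞ (T% Z) p := FiberBundle.contMDiffAt_extend I E z
  have hZp : Z p = z := FiberBundle.extend_apply_self E z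
  have : IsManifold I (minSmoothness ℝ 3) M :=
    IsManifold.of_le (n := ∞) (by simp; norm_cast)
  have : IsManifold I (minSmoothness ℝ 2) M :=
    IsManifold.of_le (n := ∞) (by simp; norm_cast)
  have : IsManifold I (∞ + 1) M := ‹IsManifold I ∞ M›
  have md {W : Π x : M, TangentSpace I x} (hW : CMDiffAt ∞ (T% W) p) : MDiffAt (T% W) p :=
    hW.mdifferentiableAt (by simp)
  have hhp : MDiffAt h p := hh.mdifferentiableAt (by simp)
  have br {V W : Π x : M, TangentSpace I x} (hV : CMDiffAt ∞ (T% V) p)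
      (hW : CMDiffAt ∞ (T% W) p) : CMDiffAt ∞ (T% (mlieBracket I V W)) p :=
    ContMDiffAt.mlieBracket_vectorField (n := ⊤) (m := ⊤) hV hW (by simp)
  have le2 {W : Π x : M, TangentSpace I x} (hW : CMDiffAt ∞ (T% W) p) :
      CMDiffAt (minSmoothness ℝ 2) (T% W) p := hW.of_le (by simp; norm_cast)
  have evh : ∀ᶠ x in 𝓝 p, MDiffAt h x := by
    filter_upwards [(contMDiffAt_iff_contMDiffAt_nhds (n := 1) (by simp)).1
      (hh.of_le (by norm_cast))] with x hx
    exact hx.mdifferentiableAt (by simp)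
  have evZ : ∀ᶠ x in 𝓝 p, MDiffAt (T% Z) x := by
    filter_upwards [(contMDiffAt_iff_contMDiffAt_nhds (n := 1) (by simp)).1
      (hZ.of_le (by norm_cast))] with x hx
    exact hx.mdifferentiableAt (by simp)
  have inner_expand (W : Π x : M, TangentSpace I x) :
      mlieBracket I W (h • Z) =ᶠ[𝓝 p]
        (fun x ↦ d% h x (W x)) • Z + h • mlieBracket I W Z := by
    filter_upwards [evh, evZ] with x h1 h2
    exact mlieBracket_smul_right (V := W) h1 h2
  have expand {V W : Π x : M, TangentSpace I x} (hV : CMDiffAt ∞ (T% V) p)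
      (hW : CMDiffAt ∞ (T% W) p) (hWh : MDiffAt (fun x ↦ d% h x (W x)) p) :
      mlieBracket I V (mlieBracket I W (h • Z)) p =
        d% (fun x ↦ d% h x (W x)) p (V p) • z + d% h p (W p) • mlieBracket I V Z p
          + (d% h p (V p) • mlieBracket I W Z p + h p • mlieBracket I V (mlieBracket I W Z) p) := by
    rw [EventuallyEq.rfl.mlieBracket_vectorField_eq (inner_expand W),
      mlieBracket_add_right (MDifferentiableAt.smul_section hWh (md hZ))
        (MDifferentiableAt.smul_section hhp (md (br hW hZ))),
      mlieBracket_smul_right hWh (md hZ), mlieBracket_smul_right hhp (md (br hW hZ)), hZp]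
  -- Compare the Jacobi identities for `(X, Y, h • Z)` and `(X, Y, Z)`. All terms containing a
  -- bracket with `Z` cancel, leaving `([X,Y]h - X(Yh) + Y(Xh)) • Z p = 0`.
  have J1 := leibniz_identity_mlieBracket_apply (le2 hX) (le2 hY)
    (le2 (ContMDiffAt.smul_section hh hZ))
  have J2 := leibniz_identity_mlieBracket_apply (le2 hX) (le2 hY) (le2 hZ)
  rw [expand hX hY hYh, expand hY hX hXh, mlieBracket_smul_right hhp (md hZ), hZp, J2] at J1
  have : (d% h p (mlieBracket I X Y p) -
      (d% (fun x ↦ d% h x (Y x)) p (X p) - d% (fun x ↦ d% h x (X x)) p (Y p))) • z = 0 := by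
    rw [sub_smul, sub_smul]
    have J3 := sub_eq_zero.2 J1
    rw [← neg_eq_zero, ← J3]
    module
  exact sub_eq_zero.1 ((smul_eq_zero.1 this).resolve_right hz)

/-- A section of a vector bundle which is smooth near a point agrees near this point with a global
smooth section. -/
theorem exists_contMDiff_section_eventuallyEq [T2Space M] [IsManifold I ∞ M]
    {F : Type*} [NormedAddCommGroup F] [NormedSpace ℝ F] {V : M → Type*}
    [TopologicalSpace (TotalSpace F V)] [∀ x, AddCommGroup (V x)] [∀ x, Module ℝ (V x)]
    [∀ x, TopologicalSpace (V x)] [FiberBundle F V] [VectorBundle ℝ F V]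
    {σ : Π x, V x} {u : Set M} {p : M} (hu : u ∈ 𝓝 p)
    (hσ : ContMDiffOn I (I.prod 𝓘(ℝ, F)) ∞ (fun x ↦ TotalSpace.mk' F x (σ x)) u) :
    ∃ τ : Π x, V x, ContMDiff I (I.prod 𝓘(ℝ, F)) ∞ (fun x ↦ TotalSpace.mk' F x (τ x)) ∧
      ∀ᶠ x in 𝓝 p, τ x = σ x := by
  obtain ⟨χ, -, hχ⟩ := (SmoothBumpFunction.nhds_basis_tsupport (I := I) p).mem_iff.1
    (interior_mem_nhds.2 hu)
  refine ⟨(χ : M → ℝ) • σ, ContMDiffOn.smul_section_of_tsupport (u := interior u)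
    χ.contMDiff.contMDiffOn isOpen_interior hχ (hσ.mono interior_subset), ?_⟩
  filter_upwards [χ.eventuallyEq_one] with x hx
  simp [hx]

end Generic

/-! ### Algebra of smooth and differentiable sections along a map -/

section Along

set_option linter.unusedSectionVars false

open Filter
open scoped Topology

variable {E : Type*} [NormedAddCommGroup E] [NormedSpace ℝ E]
  {H : Type*} [TopologicalSpace H] {I : ModelWithCorners ℝ E H}
  {M : Type*} [TopologicalSpace M] [ChartedSpace H M]
  {E' : Type*} [NormedAddCommGroup E'] [NormedSpace ℝ E']
  {H' : Type*} [TopologicalSpace H'] {J : ModelWithCorners ℝ E' H'}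
  {N : Type*} [TopologicalSpace N] [ChartedSpace H' N]
  {F : Type*} [NormedAddCommGroup F] [NormedSpace ℝ F] {V : N → Type*}
  [TopologicalSpace (TotalSpace F V)] [∀ x, AddCommGroup (V x)] [∀ x, Module ℝ (V x)]
  [∀ x, TopologicalSpace (V x)] [FiberBundle F V] [VectorBundle ℝ F V]
  {f : M → N} {ξ η : Π p, V (f p)} {g : M → ℝ} {p : M} {k : ℕ∞ω}

theorem eventually_mem_baseSet (hf : ContinuousAt f p) :
    ∀ᶠ q in 𝓝 p, f q ∈ (trivializationAt F V (f p)).baseSet :=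
  hf.eventually ((trivializationAt F V (f p)).open_baseSet.mem_nhds
    (FiberBundle.mem_baseSet_trivializationAt' (f p)))

theorem trivializationAt_add {x y : N} (hy : y ∈ (trivializationAt F V x).baseSet) (v w : V y) :
    (trivializationAt F V x ⟨y, v + w⟩).2 =
      (trivializationAt F V x ⟨y, v⟩).2 + (trivializationAt F V x ⟨y, w⟩).2 :=
  ((trivializationAt F V x).linear ℝ hy).map_add v w

theorem trivializationAt_smul {x y : N} (hy : y ∈ (trivializationAt F V x).baseSet) (a : ℝ)
    (v : V y) : (trivializationAt F V x ⟨y, a • v⟩).2 = a • (trivializationAt F V x ⟨y, v⟩).2 :=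
  ((trivializationAt F V x).linear ℝ hy).map_smul a v

theorem symm_trivializationAt_snd {x y : N} (hy : y ∈ (trivializationAt F V x).baseSet) (v : V y) :
    (trivializationAt F V x).symmL ℝ y (trivializationAt F V x ⟨y, v⟩).2 = v := by
  rw [Trivialization.symmL_apply _ hy]
  exact Trivialization.symm_apply_apply_mk _ hy v

/-- `FiberBundle.extend` freezes the coordinates in the trivialization at `x`, so on its base set it
is linear in the vector. -/
theorem eventually_extend_add {x : N} (v w : V x) : ∀ᶠ y in 𝓝 x,
    FiberBundle.extend F (v + w) y = (FiberBundle.extend F v + FiberBundle.extend F w : Π y, V y) y := by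
  filter_upwards [(trivializationAt F V x).open_baseSet.mem_nhds
    (FiberBundle.mem_baseSet_trivializationAt' x)] with y hy
  simp only [FiberBundle.extend, Pi.add_apply]
  rw [trivializationAt_add (FiberBundle.mem_baseSet_trivializationAt' x)]
  simp only [← Trivialization.symmL_apply (R := ℝ) _ hy, map_add]

theorem eventually_extend_smul {x : N} (a : ℝ) (v : V x) : ∀ᶠ y in 𝓝 x,
    FiberBundle.extend F (a • v) y = (a • FiberBundle.extend F v : Π y, V y) y := by
  filter_upwards [(trivializationAt F V x).open_baseSet.mem_nhds
    (FiberBundle.mem_baseSet_trivializationAt' x)] with y hy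
  simp only [FiberBundle.extend, Pi.smul_apply]
  rw [trivializationAt_smul (FiberBundle.mem_baseSet_trivializationAt' x)]
  simp only [← Trivialization.symmL_apply (R := ℝ) _ hy, map_smul]

namespace ContMDiffAt

theorem add_along (hξ : ContMDiffAt I (J.prod 𝓘(ℝ, F)) k (fun q ↦ TotalSpace.mk' F (f q) (ξ q)) p)
    (hη : ContMDiffAt I (J.prod 𝓘(ℝ, F)) k (fun q ↦ TotalSpace.mk' F (f q) (η q)) p) :
    ContMDiffAt I (J.prod 𝓘(ℝ, F)) k (fun q ↦ TotalSpace.mk' F (f q) (ξ q + η q)) p := by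
  rw [contMDiffAt_totalSpace] at *
  refine ⟨hξ.1, (hξ.2.add hη.2).congr_of_eventuallyEq ?_⟩
  filter_upwards [eventually_mem_baseSet (F := F) (V := V) hξ.1.continuousAt] with q hq
  exact trivializationAt_add hq _ _

theorem smul_along (hg : ContMDiffAt I 𝓘(ℝ, ℝ) k g p)
    (hξ : ContMDiffAt I (J.prod 𝓘(ℝ, F)) k (fun q ↦ TotalSpace.mk' F (f q) (ξ q)) p) :
    ContMDiffAt I (J.prod 𝓘(ℝ, F)) k (fun q ↦ TotalSpace.mk' F (f q) (g q • ξ q)) p := by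
  rw [contMDiffAt_totalSpace] at *
  refine ⟨hξ.1, (hg.smul hξ.2).congr_of_eventuallyEq ?_⟩
  filter_upwards [eventually_mem_baseSet (F := F) (V := V) hξ.1.continuousAt] with q hq
  exact trivializationAt_smul hq _ _

theorem zero_along (hf : ContMDiffAt I J k f p) :
    ContMDiffAt I (J.prod 𝓘(ℝ, F)) k (fun q ↦ TotalSpace.mk' F (f q) (0 : V (f q))) p := by
  rw [contMDiffAt_totalSpace] at *
  refine ⟨hf, (contMDiffAt_const (c := (0 : F))).congr_of_eventuallyEq ?_⟩
  filter_upwards [eventually_mem_baseSet (F := F) (V := V) hf.continuousAt] with q hq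
  exact ((trivializationAt F V (f p)).linear ℝ hq).map_zero

theorem sum_along {ι : Type*} {s : Finset ι} {ζ : ι → Π p, V (f p)} (hf : ContMDiffAt I J k f p)
    (hζ : ∀ i ∈ s, ContMDiffAt I (J.prod 𝓘(ℝ, F)) k (fun q ↦ TotalSpace.mk' F (f q) (ζ i q)) p) :
    ContMDiffAt I (J.prod 𝓘(ℝ, F)) k (fun q ↦ TotalSpace.mk' F (f q) (∑ i ∈ s, ζ i q)) p := by
  classical
  induction s using Finset.induction_on with
  | empty => simpa using zero_along hf
  | insert i s hi ih =>
    simp only [Finset.sum_insert hi]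
    exact add_along (hζ i (by simp)) (ih fun j hj ↦ hζ j (by simp [hj]))

theorem sub_along (hξ : ContMDiffAt I (J.prod 𝓘(ℝ, F)) k (fun q ↦ TotalSpace.mk' F (f q) (ξ q)) p)
    (hη : ContMDiffAt I (J.prod 𝓘(ℝ, F)) k (fun q ↦ TotalSpace.mk' F (f q) (η q)) p) :
    ContMDiffAt I (J.prod 𝓘(ℝ, F)) k (fun q ↦ TotalSpace.mk' F (f q) (ξ q - η q)) p := by
  simpa [sub_eq_add_neg] using add_along hξ (smul_along (g := fun _ ↦ -1) contMDiffAt_const hη)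

end ContMDiffAt

namespace MDifferentiableAt

theorem add_along
    (hξ : MDifferentiableAt I (J.prod 𝓘(ℝ, F)) (fun q ↦ TotalSpace.mk' F (f q) (ξ q)) p)
    (hη : MDifferentiableAt I (J.prod 𝓘(ℝ, F)) (fun q ↦ TotalSpace.mk' F (f q) (η q)) p) :
    MDifferentiableAt I (J.prod 𝓘(ℝ, F)) (fun q ↦ TotalSpace.mk' F (f q) (ξ q + η q)) p := by
  rw [mdifferentiableAt_totalSpace] at *
  refine ⟨hξ.1, (hξ.2.add hη.2).congr_of_eventuallyEq ?_⟩
  filter_upwards [eventually_mem_baseSet (F := F) (V := V) hξ.1.continuousAt] with q hq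
  exact trivializationAt_add hq _ _

theorem smul_along (hg : MDifferentiableAt I 𝓘(ℝ, ℝ) g p)
    (hξ : MDifferentiableAt I (J.prod 𝓘(ℝ, F)) (fun q ↦ TotalSpace.mk' F (f q) (ξ q)) p) :
    MDifferentiableAt I (J.prod 𝓘(ℝ, F)) (fun q ↦ TotalSpace.mk' F (f q) (g q • ξ q)) p := by
  rw [mdifferentiableAt_totalSpace] at *
  refine ⟨hξ.1, (hg.smul hξ.2).congr_of_eventuallyEq ?_⟩
  filter_upwards [eventually_mem_baseSet (F := F) (V := V) hξ.1.continuousAt] with q hq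
  exact trivializationAt_smul hq _ _

theorem zero_along (hf : MDifferentiableAt I J f p) :
    MDifferentiableAt I (J.prod 𝓘(ℝ, F)) (fun q ↦ TotalSpace.mk' F (f q) (0 : V (f q))) p := by
  rw [mdifferentiableAt_totalSpace] at *
  refine ⟨hf, (mdifferentiableAt_const (c := (0 : F))).congr_of_eventuallyEq ?_⟩
  filter_upwards [eventually_mem_baseSet (F := F) (V := V) hf.continuousAt] with q hq
  exact ((trivializationAt F V (f p)).linear ℝ hq).map_zero

theorem sum_along {ι : Type*} {s : Finset ι} {ζ : ι → Π p, V (f p)} (hf : MDifferentiableAt I J f p)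
    (hζ : ∀ i ∈ s,
      MDifferentiableAt I (J.prod 𝓘(ℝ, F)) (fun q ↦ TotalSpace.mk' F (f q) (ζ i q)) p) :
    MDifferentiableAt I (J.prod 𝓘(ℝ, F)) (fun q ↦ TotalSpace.mk' F (f q) (∑ i ∈ s, ζ i q)) p := by
  classical
  induction s using Finset.induction_on with
  | empty => simpa using zero_along hf
  | insert i s hi ih =>
    simp only [Finset.sum_insert hi]
    exact add_along (hζ i (by simp)) (ih fun j hj ↦ hζ j (by simp [hj]))

end MDifferentiableAt

end Along

/-! ### The pull-back of a covariant derivative along a map -/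

section CovariantDerivativeAlong

set_option linter.unusedSectionVars false

open Filter
open scoped Topology

variable {E : Type*} [NormedAddCommGroup E] [NormedSpace ℝ E]
  {H : Type*} [TopologicalSpace H] {I : ModelWithCorners ℝ E H}
  {M : Type*} [TopologicalSpace M] [ChartedSpace H M]
  {E' : Type*} [NormedAddCommGroup E'] [NormedSpace ℝ E']
  {H' : Type*} [TopologicalSpace H'] {J : ModelWithCorners ℝ E' H'}
  {N : Type*} [TopologicalSpace N] [ChartedSpace H' N]
  {F : Type*} [NormedAddCommGroup F] [NormedSpace ℝ F] {V : N → Type*}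
  [TopologicalSpace (TotalSpace F V)] [∀ x, AddCommGroup (V x)] [∀ x, Module ℝ (V x)]
  [∀ x, TopologicalSpace (V x)] [∀ x, IsTopologicalAddGroup (V x)] [∀ x, ContinuousSMul ℝ (V x)]
  [FiberBundle F V] [VectorBundle ℝ F V]
  (cov : CovariantDerivative J F V)
  {f : M → N} {ξ η : Π p, V (f p)} {g : M → ℝ} {p : M}

theorem Filter.EventuallyEq.mvfderiv_eq {G : Type*} [NormedAddCommGroup G] [NormedSpace ℝ G]
    {a b : M → G} (h : a =ᶠ[𝓝 p] b) : mvfderiv I a p = mvfderiv I b p := by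
  ext v
  change mfderiv I 𝓘(ℝ, G) a p v = mfderiv I 𝓘(ℝ, G) b p v
  rw [h.mfderiv_eq]
  rfl

namespace CovariantDerivative

/-- A covariant derivative depends only on the germ of the section. This makes the connection term
in `along` linear in the value of the section. -/
theorem extend_add {x : N} (v w : V x) : cov (FiberBundle.extend F (v + w)) x =
    cov (FiberBundle.extend F v) x + cov (FiberBundle.extend F w) x := by
  have hv := FiberBundle.mdifferentiableAt_extend J F v
  have hw := FiberBundle.mdifferentiableAt_extend J F w
  rw [← cov.isCovariantDerivativeOnUniv.add hv hw]
  exact cov.isCovariantDerivativeOnUniv.congr_of_eventuallyEq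
    (FiberBundle.mdifferentiableAt_extend J F _) (MDifferentiableAt.add_along (f := fun y ↦ y) hv hw) univ_mem
    (eventually_extend_add v w)

theorem extend_smul {x : N} (a : ℝ) (v : V x) : cov (FiberBundle.extend F (a • v)) x =
    a • cov (FiberBundle.extend F v) x := by
  have hv := FiberBundle.mdifferentiableAt_extend J F v
  rw [← cov.isCovariantDerivativeOnUniv.smul_const a hv]
  exact cov.isCovariantDerivativeOnUniv.congr_of_eventuallyEq
    (FiberBundle.mdifferentiableAt_extend J F _) 
    (MDifferentiableAt.smul_along (f := fun y ↦ y) mdifferentiableAt_const hv) univ_mem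
    (eventually_extend_smul a v)

/-- The pull-back of a covariant derivative along a map `f`, acting on sections along `f`. -/
def along (f : M → N) (ξ : Π p, V (f p)) (p : M) : TangentSpace I p →L[ℝ] V (f p) :=
  ((trivializationAt F V (f p)).symmL ℝ (f p)).comp
      (mvfderiv I (fun q ↦ (trivializationAt F V (f p) ⟨f q, ξ q⟩).2) p)
    + (cov (FiberBundle.extend F (ξ p)) (f p)).comp (mfderiv I J f p)

theorem along_congr (h : ∀ᶠ q in 𝓝 p, ξ q = η q) :
    cov.along (I := I) f ξ p = cov.along f η p := by
  have h' : (fun q ↦ (trivializationAt F V (f p) ⟨f q, ξ q⟩).2) =ᶠ[𝓝 p]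
      fun q ↦ (trivializationAt F V (f p) ⟨f q, η q⟩).2 := by
    filter_upwards [h] with q hq
    rw [hq]
  rw [along, along, h'.mvfderiv_eq, h.self_of_nhds]

theorem along_add
    (hξ : MDifferentiableAt I (J.prod 𝓘(ℝ, F)) (fun q ↦ TotalSpace.mk' F (f q) (ξ q)) p)
    (hη : MDifferentiableAt I (J.prod 𝓘(ℝ, F)) (fun q ↦ TotalSpace.mk' F (f q) (η q)) p) :
    cov.along (I := I) f (fun q ↦ ξ q + η q) p = cov.along f ξ p + cov.along f η p := by
  rw [mdifferentiableAt_totalSpace] at hξ hη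
  have h' : (fun q ↦ (trivializationAt F V (f p) ⟨f q, ξ q + η q⟩).2) =ᶠ[𝓝 p]
      (fun q ↦ (trivializationAt F V (f p) ⟨f q, ξ q⟩).2) +
        fun q ↦ (trivializationAt F V (f p) ⟨f q, η q⟩).2 := by
    filter_upwards [eventually_mem_baseSet (F := F) (V := V) hξ.1.continuousAt] with q hq
    exact trivializationAt_add hq _ _
  rw [along, along, along, h'.mvfderiv_eq, mvfderiv_add hξ.2 hη.2, extend_add]
  ext v
  simp only [_root_.add_apply, ContinuousLinearMap.comp_apply, map_add]
  abel

theorem along_smul (hg : MDifferentiableAt I 𝓘(ℝ, ℝ) g p)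
    (hξ : MDifferentiableAt I (J.prod 𝓘(ℝ, F)) (fun q ↦ TotalSpace.mk' F (f q) (ξ q)) p) :
    cov.along (I := I) f (fun q ↦ g q • ξ q) p =
      g p • cov.along f ξ p + (mvfderiv I g p).smulRight (ξ p) := by
  rw [mdifferentiableAt_totalSpace] at hξ
  have h' : (fun q ↦ (trivializationAt F V (f p) ⟨f q, g q • ξ q⟩).2) =ᶠ[𝓝 p]
      g • (fun q ↦ (trivializationAt F V (f p) ⟨f q, ξ q⟩).2) := by
    filter_upwards [eventually_mem_baseSet (F := F) (V := V) hξ.1.continuousAt] with q hq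
    exact trivializationAt_smul hq _ _
  rw [along, along, h'.mvfderiv_eq, mvfderiv_smul hg hξ.2, extend_smul]
  ext v
  simp only [_root_.add_apply, ContinuousLinearMap.comp_apply, map_add,
    _root_.smul_apply, map_smul, ContinuousLinearMap.smulRight_apply,
    symm_trivializationAt_snd (FiberBundle.mem_baseSet_trivializationAt' (f p))]
  module

/-- Along the identity, the pulled-back covariant derivative is the original one. -/
theorem along_id [FiniteDimensional ℝ F] [ContMDiffVectorBundle 1 F V J] {Z : Π y, V y} {y : N}
    (hZ : MDifferentiableAt J (J.prod 𝓘(ℝ, F)) (fun y ↦ TotalSpace.mk' F y (Z y)) y) :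
    cov.along (I := J) (fun y ↦ y) Z y = cov Z y := by
  -- Both operators obey the same Leibniz rule, so their difference depends only on the value `Z y`.
  -- It may thus be evaluated on the extension of `Z y` with constant coordinates, where the
  -- derivative term of `along` vanishes and only `cov` remains.
  have T : TensorialAt J F (fun Z : Π y, V y ↦ cov.along (I := J) (fun y ↦ y) Z y - cov Z y) y :=
    { smul := fun {g σ} hg hσ ↦ by
        have := cov.along_smul (f := fun y ↦ y) hg hσ
        change cov.along (I := J) (fun y ↦ y) (fun q ↦ g q • σ q) y - _ = _
        rw [this, cov.isCovariantDerivativeOnUniv.leibniz hσ hg, smul_sub]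
        abel
      add := fun {σ τ} hσ hτ ↦ by
        have := cov.along_add (f := fun y ↦ y) hσ hτ
        change cov.along (I := J) (fun y ↦ y) (fun q ↦ σ q + τ q) y - _ = _
        rw [this, cov.isCovariantDerivativeOnUniv.add hσ hτ]
        abel }
  have := T.pointwise hZ (FiberBundle.mdifferentiableAt_extend J F (Z y))
    (FiberBundle.extend_apply_self F (Z y)).symm
  rw [← sub_eq_zero, this, sub_eq_zero]
  have h' : (fun q ↦ (trivializationAt F V y ⟨q, FiberBundle.extend F (Z y) q⟩).2) =ᶠ[𝓝 y]
      fun _ ↦ (trivializationAt F V y ⟨y, Z y⟩).2 := by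
    filter_upwards [(trivializationAt F V y).open_baseSet.mem_nhds
      (FiberBundle.mem_baseSet_trivializationAt' y)] with q hq
    rw [FiberBundle.extend, Trivialization.apply_mk_symm _ hq]
  have hid : mfderiv J J (fun y : N ↦ y) y = .id ℝ (TangentSpace J y) := mfderiv_id
  rw [along, h'.mvfderiv_eq, mvfderiv_const, hid, FiberBundle.extend_apply_self]
  ext v
  simp

/-- Once `cov Z` is rewritten as a derivative along the identity, both sides use the same
trivialization at `f p`, and the claim is the chain rule for the coordinates of `Z`. -/
theorem along_comp [FiniteDimensional ℝ F] [ContMDiffVectorBundle 1 F V J] {Z : Π y, V y}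
    (hf : MDifferentiableAt I J f p)
    (hZ : MDifferentiableAt J (J.prod 𝓘(ℝ, F)) (fun y ↦ TotalSpace.mk' F y (Z y)) (f p)) :
    cov.along (I := I) f (fun q ↦ Z (f q)) p = (cov Z (f p)).comp (mfderiv I J f p) := by
  rw [← cov.along_id hZ]
  rw [mdifferentiableAt_totalSpace] at hZ
  ext v
  have := mfderiv_comp_apply p hZ.2 hf v
  have hid : mfderiv J J (fun y : N ↦ y) (f p) = .id ℝ (TangentSpace J (f p)) := mfderiv_id
  simp only [along, _root_.add_apply, ContinuousLinearMap.comp_apply, hid,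
    ContinuousLinearMap.id_apply]
  congr 1
  exact congrArg _ this

end CovariantDerivative

end CovariantDerivativeAlong

/-! ### Local frames by global sections and induction over sections along a map -/

section FrameAlong

open Filter
open scoped Topology

set_option linter.unusedSectionVars false

variable {E : Type*} [NormedAddCommGroup E] [NormedSpace ℝ E]
  {H : Type*} [TopologicalSpace H] {I : ModelWithCorners ℝ E H}
  {M : Type*} [TopologicalSpace M] [ChartedSpace H M]
  {E' : Type*} [NormedAddCommGroup E'] [NormedSpace ℝ E'] [FiniteDimensional ℝ E']
  {H' : Type*} [TopologicalSpace H'] {J : ModelWithCorners ℝ E' H'}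
  {N : Type*} [TopologicalSpace N] [T2Space N] [ChartedSpace H' N] [IsManifold J ∞ N]
  {n : ℕ} {V : N → Type*}
  [TopologicalSpace (TotalSpace (EuclideanSpace ℝ (Fin n)) V)] [∀ x, AddCommGroup (V x)]
  [∀ x, Module ℝ (V x)] [∀ x, TopologicalSpace (V x)]
  [FiberBundle (EuclideanSpace ℝ (Fin n)) V] [VectorBundle ℝ (EuclideanSpace ℝ (Fin n)) V]
  [ContMDiffVectorBundle ∞ (EuclideanSpace ℝ (Fin n)) V J]
  {f : M → N} {ξ : Π p, V (f p)} {p : M} {k : ℕ∞ω}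

/-- The coordinates of a vector with respect to the frame given by the trivialization at `y₀`. -/
def frameCoord (n : ℕ) {N : Type*} [TopologicalSpace N] {V : N → Type*}
    [TopologicalSpace (TotalSpace (EuclideanSpace ℝ (Fin n)) V)] [∀ x, TopologicalSpace (V x)]
    [FiberBundle (EuclideanSpace ℝ (Fin n)) V] (y₀ : N) {y : N} (w : V y) (i : Fin n) : ℝ :=
  (trivializationAt (EuclideanSpace ℝ (Fin n)) V y₀ ⟨y, w⟩).2 i

theorem ContMDiffAt.frameCoord
    (hξ : ContMDiffAt I (J.prod 𝓘(ℝ, EuclideanSpace ℝ (Fin n))) k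
      (fun q ↦ TotalSpace.mk' (EuclideanSpace ℝ (Fin n)) (f q) (ξ q)) p) (i : Fin n) :
    ContMDiffAt I 𝓘(ℝ, ℝ) k (fun q ↦ frameCoord n (f p) (ξ q) i) p := by
  rw [contMDiffAt_totalSpace] at hξ
  exact (EuclideanSpace.proj (𝕜 := ℝ) i).contMDiff.contMDiffAt.comp p hξ.2

theorem MDifferentiableAt.frameCoord
    (hξ : MDifferentiableAt I (J.prod 𝓘(ℝ, EuclideanSpace ℝ (Fin n)))
      (fun q ↦ TotalSpace.mk' (EuclideanSpace ℝ (Fin n)) (f q) (ξ q)) p) (i : Fin n) :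
    MDifferentiableAt I 𝓘(ℝ, ℝ) (fun q ↦ frameCoord n (f p) (ξ q) i) p := by
  rw [mdifferentiableAt_totalSpace] at hξ
  exact (EuclideanSpace.proj (𝕜 := ℝ) i).mdifferentiableAt.comp p hξ.2

/-- Near every point there is a frame consisting of global smooth sections. -/
theorem exists_global_frame (J : ModelWithCorners ℝ E' H') [IsManifold J ∞ N]
    [ContMDiffVectorBundle ∞ (EuclideanSpace ℝ (Fin n)) V J] (y₀ : N) :
    ∃ Z : Fin n → Π y, V y,
      (∀ i, ContMDiff J (J.prod 𝓘(ℝ, EuclideanSpace ℝ (Fin n))) ∞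
        (fun y ↦ TotalSpace.mk' (EuclideanSpace ℝ (Fin n)) y (Z i y))) ∧
      ∀ᶠ y in 𝓝 y₀, ∀ w : V y, w = ∑ i, frameCoord n y₀ w i • Z i y := by
  have hy₀ := FiberBundle.mem_baseSet_trivializationAt' (F := EuclideanSpace ℝ (Fin n)) (E := V) y₀
  -- The members of the frame are the sections with constant coordinates `eᵢ` in the trivialization
  -- at `y₀`, cut off away from `y₀` to become global.
  have (i : Fin n) := FiberBundle.exists_contMDiffOn_extend (k := ∞) J (EuclideanSpace ℝ (Fin n))
    ((trivializationAt (EuclideanSpace ℝ (Fin n)) V y₀).symmL ℝ y₀ (EuclideanSpace.single i 1))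
  choose u hu hu' using this
  choose Z hZ hZ' using fun i ↦ exists_contMDiff_section_eventuallyEq (hu i) (hu' i)
  refine ⟨Z, hZ, ?_⟩
  filter_upwards [eventually_all.2 hZ', (trivializationAt (EuclideanSpace ℝ (Fin n)) V
    y₀).open_baseSet.mem_nhds hy₀] with y hy hyb w
  have key (i : Fin n) : Z i y = (trivializationAt (EuclideanSpace ℝ (Fin n)) V y₀).symmL ℝ y
      (EuclideanSpace.single i 1) := by
    rw [hy, FiberBundle.extend, Trivialization.symmL_apply _ hy₀, Trivialization.apply_mk_symm _ hy₀,
      Trivialization.symmL_apply _ hyb]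
  conv_lhs => rw [← symm_trivializationAt_snd hyb w]
  simp only [key, ← map_smul, ← map_sum, frameCoord]
  congr 1
  ext j
  simp [Finset.sum_apply, Pi.single_apply]

/-- Induction principle for differentiable sections along a map. -/
theorem MDifferentiableAt.along_induction {P : (Π p, V (f p)) → Prop}
    (hf : MDifferentiableAt I J f p)
    (hξ : MDifferentiableAt I (J.prod 𝓘(ℝ, EuclideanSpace ℝ (Fin n)))
      (fun q ↦ TotalSpace.mk' (EuclideanSpace ℝ (Fin n)) (f q) (ξ q)) p)
    (congr : ∀ ξ η : Π p, V (f p), (∀ᶠ q in 𝓝 p, ξ q = η q) → P η → P ξ)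
    (add : ∀ ξ η : Π p, V (f p),
      MDifferentiableAt I (J.prod 𝓘(ℝ, EuclideanSpace ℝ (Fin n)))
        (fun q ↦ TotalSpace.mk' (EuclideanSpace ℝ (Fin n)) (f q) (ξ q)) p →
      MDifferentiableAt I (J.prod 𝓘(ℝ, EuclideanSpace ℝ (Fin n)))
        (fun q ↦ TotalSpace.mk' (EuclideanSpace ℝ (Fin n)) (f q) (η q)) p →
      P ξ → P η → P (fun q ↦ ξ q + η q))
    (smul : ∀ (g : M → ℝ) (ξ : Π p, V (f p)), MDifferentiableAt I 𝓘(ℝ, ℝ) g p →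
      MDifferentiableAt I (J.prod 𝓘(ℝ, EuclideanSpace ℝ (Fin n)))
        (fun q ↦ TotalSpace.mk' (EuclideanSpace ℝ (Fin n)) (f q) (ξ q)) p →
      P ξ → P (fun q ↦ g q • ξ q))
    (comp : ∀ Z : Π y, V y, ContMDiff J (J.prod 𝓘(ℝ, EuclideanSpace ℝ (Fin n))) ∞
      (fun y ↦ TotalSpace.mk' (EuclideanSpace ℝ (Fin n)) y (Z y)) → P (fun q ↦ Z (f q))) :
    P ξ := by
  classical
  obtain ⟨Z, hZ, hZ'⟩ := exists_global_frame (n := n) (V := V) J (f p)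
  refine congr _ _ (hf.continuousAt.eventually hZ' |>.mono fun q hq ↦ hq (ξ q)) ?_
  have md (i : Fin n) : MDifferentiableAt I (J.prod 𝓘(ℝ, EuclideanSpace ℝ (Fin n)))
        (fun q ↦ TotalSpace.mk' (EuclideanSpace ℝ (Fin n)) (f q) (Z i (f q))) p :=
    ((hZ i).mdifferentiable (by simp) (f p)).comp p hf
  -- Building the frame expansion up one summand at a time uses only the four closure properties;
  -- the empty sum is the zero section composed with `f`.
  suffices ∀ s : Finset (Fin n), P (fun q ↦ ∑ i ∈ s, _root_.frameCoord n (f p) (ξ q) i • Z i (f q)) from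
    this Finset.univ
  intro s
  induction s using Finset.induction_on with
  | empty =>
    simp only [Finset.sum_empty]
    exact comp (fun _ ↦ 0) (contMDiff_zeroSection ℝ V)
  | insert i s hi ih =>
    simp only [Finset.sum_insert hi]
    exact add _ _ ((hξ.frameCoord i).smul_along (md i))
      (MDifferentiableAt.sum_along hf fun j _ ↦ (hξ.frameCoord j).smul_along (md j))
      (smul _ _ (hξ.frameCoord i) (md i) (comp _ (hZ i))) ih

/-- Induction principle for smooth sections along a map. -/
theorem ContMDiffAt.along_induction {P : (Π p, V (f p)) → Prop}
    (hk : k ≤ ∞) (hf : ContMDiffAt I J k f p)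
    (hξ : ContMDiffAt I (J.prod 𝓘(ℝ, EuclideanSpace ℝ (Fin n))) k
      (fun q ↦ TotalSpace.mk' (EuclideanSpace ℝ (Fin n)) (f q) (ξ q)) p)
    (congr : ∀ ξ η : Π p, V (f p), (∀ᶠ q in 𝓝 p, ξ q = η q) → P η → P ξ)
    (add : ∀ ξ η : Π p, V (f p),
      ContMDiffAt I (J.prod 𝓘(ℝ, EuclideanSpace ℝ (Fin n))) k
        (fun q ↦ TotalSpace.mk' (EuclideanSpace ℝ (Fin n)) (f q) (ξ q)) p →
      ContMDiffAt I (J.prod 𝓘(ℝ, EuclideanSpace ℝ (Fin n))) k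
        (fun q ↦ TotalSpace.mk' (EuclideanSpace ℝ (Fin n)) (f q) (η q)) p →
      P ξ → P η → P (fun q ↦ ξ q + η q))
    (smul : ∀ (g : M → ℝ) (ξ : Π p, V (f p)), ContMDiffAt I 𝓘(ℝ, ℝ) k g p →
      ContMDiffAt I (J.prod 𝓘(ℝ, EuclideanSpace ℝ (Fin n))) k
        (fun q ↦ TotalSpace.mk' (EuclideanSpace ℝ (Fin n)) (f q) (ξ q)) p →
      P ξ → P (fun q ↦ g q • ξ q))
    (comp : ∀ Z : Π y, V y, ContMDiff J (J.prod 𝓘(ℝ, EuclideanSpace ℝ (Fin n))) ∞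
      (fun y ↦ TotalSpace.mk' (EuclideanSpace ℝ (Fin n)) y (Z y)) → P (fun q ↦ Z (f q))) :
    P ξ := by
  classical
  obtain ⟨Z, hZ, hZ'⟩ := exists_global_frame (n := n) (V := V) J (f p)
  refine congr _ _ (hf.continuousAt.eventually hZ' |>.mono fun q hq ↦ hq (ξ q)) ?_
  have md (i : Fin n) : ContMDiffAt I (J.prod 𝓘(ℝ, EuclideanSpace ℝ (Fin n))) k
        (fun q ↦ TotalSpace.mk' (EuclideanSpace ℝ (Fin n)) (f q) (Z i (f q))) p :=
    ((hZ i).of_le hk (f p)).comp p hf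
  suffices ∀ s : Finset (Fin n), P (fun q ↦ ∑ i ∈ s, _root_.frameCoord n (f p) (ξ q) i • Z i (f q)) from
    this Finset.univ
  intro s
  induction s using Finset.induction_on with
  | empty =>
    simp only [Finset.sum_empty]
    exact comp (fun _ ↦ 0) (contMDiff_zeroSection ℝ V)
  | insert i s hi ih =>
    simp only [Finset.sum_insert hi]
    exact add _ _ ((hξ.frameCoord i).smul_along (md i))
      (ContMDiffAt.sum_along hf fun j _ ↦ (hξ.frameCoord j).smul_along (md j))
      (smul _ _ (hξ.frameCoord i) (md i) (comp _ (hZ i))) ih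

end FrameAlong

/-! ### The covariant Hessian and the torsion identity along a map -/

section Torsion

open Filter VectorField
open scoped Topology

set_option linter.unusedSectionVars false

variable {E : Type*} [NormedAddCommGroup E] [NormedSpace ℝ E] [FiniteDimensional ℝ E]
  {H : Type*} [TopologicalSpace H] {I : ModelWithCorners ℝ E H}
  {M : Type*} [TopologicalSpace M] [ChartedSpace H M] [IsManifold I ∞ M]
  {E' : Type*} [NormedAddCommGroup E'] [NormedSpace ℝ E'] [FiniteDimensional ℝ E']
  {H' : Type*} [TopologicalSpace H'] {J : ModelWithCorners ℝ E' H'}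
  {N : Type*} [TopologicalSpace N] [ChartedSpace H' N] [IsManifold J ∞ N]
  {f : M → N} {X Y : Π p : M, TangentSpace I p} {p : M}

theorem ContMDiffAt.mfderiv_along (hf : ContMDiffAt I J ∞ f p)
    (hX : ContMDiffAt I I.tangent ∞ (fun q ↦ (⟨q, X q⟩ : TangentBundle I M)) p) :
    ContMDiffAt I J.tangent ∞
      (fun q ↦ (⟨f q, mfderiv I J f q (X q)⟩ : TangentBundle J N)) p := by
  have h1 := hf.mfderiv_const (m := ∞) le_rfl
  exact ContMDiffAt.clm_apply_of_inCoordinates (b₁ := fun q ↦ q) (b₂ := f)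
    (E₁ := (TangentSpace I : M → Type _)) (E₂ := (TangentSpace J : N → Type _)) h1 hX hf

theorem ContMDiffAt.mvfderiv_apply {h : M → ℝ} (hh : ContMDiffAt I 𝓘(ℝ, ℝ) ∞ h p)
    (hX : ContMDiffAt I I.tangent ∞ (fun q ↦ (⟨q, X q⟩ : TangentBundle I M)) p) :
    ContMDiffAt I 𝓘(ℝ, ℝ) ∞ (fun q ↦ mvfderiv I h q (X q)) p :=
  (contMDiff_snd_tangentBundle_modelSpace ℝ 𝓘(ℝ, ℝ)).contMDiffAt.comp p (hh.mfderiv_along hX)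

theorem MDifferentiableAt.mvfderiv_along {h : N → ℝ} (hh : ContMDiffAt J 𝓘(ℝ, ℝ) ∞ h (f p))
    {η : Π p, TangentSpace J (f p)}
    (hη : MDifferentiableAt I J.tangent (fun q ↦ (⟨f q, η q⟩ : TangentBundle J N)) p) :
    MDifferentiableAt I 𝓘(ℝ, ℝ) (fun q ↦ mvfderiv J h (f q) (η q)) p := by
  have hf : MDifferentiableAt I J f p := ((mdifferentiableAt_totalSpace _ _).1 hη).1
  have h1 := ((hh.mfderiv_const (m := ∞) le_rfl).mdifferentiableAt (by simp)).comp p hf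
  have h2 := MDifferentiableAt.clm_apply_of_inCoordinates (b₁ := f) (b₂ := fun q ↦ h (f q))
    (ϕ := fun q ↦ mfderiv J 𝓘(ℝ, ℝ) h (f q))
    (E₁ := (TangentSpace J : N → Type _)) (E₂ := (TangentSpace 𝓘(ℝ, ℝ) : ℝ → Type _)) h1 hη
    ((hh.mdifferentiableAt (by simp)).comp p hf)
  exact ((contMDiff_snd_tangentBundle_modelSpace (n := 1) ℝ 𝓘(ℝ, ℝ)).mdifferentiable
    one_ne_zero _).comp p h2

section Euclidean

variable {n : ℕ} {H₀ : Type*} [TopologicalSpace H₀]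
  {J₀ : ModelWithCorners ℝ (EuclideanSpace ℝ (Fin n)) H₀}
  {P : Type*} [TopologicalSpace P] [T2Space P] [ChartedSpace H₀ P] [IsManifold J₀ ∞ P]
  (cov : CovariantDerivative J₀ (EuclideanSpace ℝ (Fin n)) (TangentSpace J₀ : P → Type _))
  {f : M → P}

theorem ContMDiffAt.eventually_mdifferentiableAt {f : M → N} (hf : ContMDiffAt I J ∞ f p) :
    ∀ᶠ q in 𝓝 p, MDifferentiableAt I J f q := by
  filter_upwards [(contMDiffAt_iff_contMDiffAt_nhds (n := 1) (by simp)).1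
    (hf.of_le (by norm_cast))] with q hq
  exact hq.mdifferentiableAt one_ne_zero

namespace CovariantDerivative

/-- The covariant Hessian of a function is tensorial. -/
theorem tensorialAt_hessian {h : P → ℝ} {y : P} (hh : ContMDiffAt J₀ 𝓘(ℝ, ℝ) ∞ h y) :
    TensorialAt J₀ (EuclideanSpace ℝ (Fin n)) (fun Z : Π y : P, TangentSpace J₀ y ↦
      mvfderiv J₀ (fun x ↦ mvfderiv J₀ h x (Z x)) y - (mvfderiv J₀ h y).comp (cov Z y)) y where
  smul {g σ} hg hσ := by
    have h1 := MDifferentiableAt.mvfderiv_along (f := fun y ↦ y) hh hσ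
    have h2 : (fun x ↦ mvfderiv J₀ h x ((g • σ) x)) = g • fun x ↦ mvfderiv J₀ h x (σ x) := by
      funext x
      simp
    rw [h2, mvfderiv_smul hg h1, cov.isCovariantDerivativeOnUniv.leibniz hσ hg]
    ext v
    simp
    ring
  add {σ τ} hσ hτ := by
    have h1 := MDifferentiableAt.mvfderiv_along (f := fun y ↦ y) hh hσ
    have h2 := MDifferentiableAt.mvfderiv_along (f := fun y ↦ y) hh hτ
    have h3 : (fun x ↦ mvfderiv J₀ h x ((σ + τ) x)) =
        (fun x ↦ mvfderiv J₀ h x (σ x)) + fun x ↦ mvfderiv J₀ h x (τ x) := by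
      funext x
      simp
    rw [h3, mvfderiv_add h1 h2, cov.isCovariantDerivativeOnUniv.add hσ hτ]
    ext v
    simp
    ring

/-- For `η = Z ∘ f` this is the chain rule combined with the definition of the Hessian. Both sides
acquire the same extra term `dg(v) dh(η)` when `η` is multiplied by `g`, so the general case follows
by induction. -/
theorem mvfderiv_mvfderiv_along {h : P → ℝ} (hh : ContMDiffAt J₀ 𝓘(ℝ, ℝ) ∞ h (f p))
    {η : Π p, TangentSpace J₀ (f p)}
    (hη : MDifferentiableAt I J₀.tangent (fun q ↦ (⟨f q, η q⟩ : TangentBundle J₀ P)) p)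
    (v : TangentSpace I p) :
    mvfderiv I (fun q ↦ mvfderiv J₀ h (f q) (η q)) p v =
      mvfderiv J₀ h (f p) (cov.along f η p v) +
        TensorialAt.mkHom _ _ (cov.tensorialAt_hessian hh) (η p) (mfderiv I J₀ f p v) := by
  have hf : MDifferentiableAt I J₀ f p := ((mdifferentiableAt_totalSpace _ _).1 hη).1
  refine MDifferentiableAt.along_induction (V := (TangentSpace J₀ : P → Type _)) (P := fun η ↦
    mvfderiv I (fun q ↦ mvfderiv J₀ h (f q) (η q)) p v =
      mvfderiv J₀ h (f p) (cov.along f η p v) +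
        TensorialAt.mkHom _ _ (cov.tensorialAt_hessian hh) (η p) (mfderiv I J₀ f p v))
    hf hη ?_ ?_ ?_ ?_
  · intro ξ η hξη hη
    rw [cov.along_congr hξη, hξη.self_of_nhds, ← hη]
    congr 1
    apply Filter.EventuallyEq.mvfderiv_eq
    filter_upwards [hξη] with q hq
    rw [hq]
  · intro ξ η hξ hη e1 e2
    have h1 := MDifferentiableAt.mvfderiv_along hh hξ
    have h2 := MDifferentiableAt.mvfderiv_along hh hη
    have h3 : (fun q ↦ mvfderiv J₀ h (f q) (ξ q + η q)) =
        (fun q ↦ mvfderiv J₀ h (f q) (ξ q)) + fun q ↦ mvfderiv J₀ h (f q) (η q) := by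
      funext x
      simp
    rw [h3, mvfderiv_add h1 h2, cov.along_add hξ hη, _root_.add_apply, e1, e2]
    simp only [map_add, _root_.add_apply]
    ring
  · intro g ξ hg hξ e1
    have h1 := MDifferentiableAt.mvfderiv_along hh hξ
    have h3 : (fun q ↦ mvfderiv J₀ h (f q) (g q • ξ q)) =
        g • (fun q ↦ mvfderiv J₀ h (f q) (ξ q)) := by
      funext x
      simp
    rw [h3, mvfderiv_smul hg h1, cov.along_smul hg hξ]
    simp only [map_add, _root_.add_apply, map_smul, _root_.smul_apply, e1,
      ContinuousLinearMap.smulRight_apply, smul_eq_mul]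
    ring
  · intro Z hZ
    have hZ' := hZ.mdifferentiable (by simp) (f p)
    have h1 := MDifferentiableAt.mvfderiv_along (f := fun y ↦ y) hh hZ'
    rw [cov.along_comp hf hZ', TensorialAt.mkHom_apply (cov.tensorialAt_hessian hh) hZ']
    have := mvfderiv_comp_apply p h1 hf v
    simp only [Function.comp_def] at this
    rw [this]
    simp

/-- The antisymmetric part is the commutator of two fields acting on `h` minus `dh` of the
antisymmetrized covariant derivative. Without torsion both equal `dh` of the bracket. -/
theorem hessian_symm (htors : cov.torsion = 0) {h : P → ℝ} {y : P}
    (hh : ContMDiffAt J₀ 𝓘(ℝ, ℝ) ∞ h y) (u w : TangentSpace J₀ y) :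
    TensorialAt.mkHom _ _ (cov.tensorialAt_hessian hh) u w =
      TensorialAt.mkHom _ _ (cov.tensorialAt_hessian hh) w u := by
  have hU := FiberBundle.contMDiffAt_extend (k := ∞) J₀ (EuclideanSpace ℝ (Fin n)) u
  have hW := FiberBundle.contMDiffAt_extend (k := ∞) J₀ (EuclideanSpace ℝ (Fin n)) w
  have h1 := mvfderiv_mlieBracket hh hU hW ((hh.mvfderiv_apply hU).mdifferentiableAt (by simp))
    ((hh.mvfderiv_apply hW).mdifferentiableAt (by simp))
  have h2 := cov.torsion_eq_zero_iff.1 htors (hU.mdifferentiableAt (by simp))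
    (hW.mdifferentiableAt (by simp))
  rw [← h2] at h1
  simp only [TensorialAt.mkHom_apply_eq_extend, _root_.sub_apply, ContinuousLinearMap.comp_apply,
    FiberBundle.extend_apply_self, map_sub] at h1 ⊢
  linear_combination h1

/-- A torsion-free connection, pulled back along `f`, satisfies
`∇_X df(Y) - ∇_Y df(X) = df([X, Y])`. -/
theorem along_mfderiv_sub (htors : cov.torsion = 0) (hf : ContMDiffAt I J₀ ∞ f p)
    (hX : ContMDiffAt I I.tangent ∞ (fun q ↦ (⟨q, X q⟩ : TangentBundle I M)) p)
    (hY : ContMDiffAt I I.tangent ∞ (fun q ↦ (⟨q, Y q⟩ : TangentBundle I M)) p) :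
    cov.along f (fun q ↦ mfderiv I J₀ f q (Y q)) p (X p) -
      cov.along f (fun q ↦ mfderiv I J₀ f q (X q)) p (Y p) =
        mfderiv I J₀ f p (mlieBracket I X Y p) := by
  -- Test the identity against the differential of a function `h` on the target. The commutator
  -- formula for `h ∘ f` produces two Hessian terms, which cancel by symmetry.
  have key {h : P → ℝ} (hh : ContMDiffAt J₀ 𝓘(ℝ, ℝ) ∞ h (f p)) :
      mvfderiv J₀ h (f p) (cov.along f (fun q ↦ mfderiv I J₀ f q (Y q)) p (X p) -
        cov.along f (fun q ↦ mfderiv I J₀ f q (X q)) p (Y p)) =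
        mvfderiv J₀ h (f p) (mfderiv I J₀ f p (mlieBracket I X Y p)) := by
    have hhf := hh.comp p hf
    have e (W : Π p : M, TangentSpace I p) : (fun q ↦ mvfderiv I (h ∘ f) q (W q)) =ᶠ[𝓝 p]
        fun q ↦ mvfderiv J₀ h (f q) (mfderiv I J₀ f q (W q)) := by
      filter_upwards [hf.eventually_mdifferentiableAt,
        hf.continuousAt.eventually hh.eventually_mdifferentiableAt] with q h1 h2
      exact mvfderiv_comp_apply q h2 h1 (W q)
    have h1 := mvfderiv_mlieBracket hhf hX hY
      ((hhf.mvfderiv_apply hX).mdifferentiableAt (by simp))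
      ((hhf.mvfderiv_apply hY).mdifferentiableAt (by simp))
    rw [(e X).mvfderiv_eq, (e Y).mvfderiv_eq,
      cov.mvfderiv_mvfderiv_along hh ((hf.mfderiv_along hX).mdifferentiableAt (by simp)),
      cov.mvfderiv_mvfderiv_along hh ((hf.mfderiv_along hY).mdifferentiableAt (by simp)),
      cov.hessian_symm htors hh, mvfderiv_comp_apply p (hh.mdifferentiableAt (by simp))
        (hf.mdifferentiableAt (by simp))] at h1
    rw [h1, map_sub]
    ring
  -- The differentials of the chart coordinates at `f p` separate tangent vectors, so taking `h` to
  -- be each coordinate function is enough.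
  have inv := isInvertible_mfderiv_extChartAt (I := J₀) (mem_extChartAt_source (I := J₀) (f p))
  have hchart : ContMDiffAt J₀ 𝓘(ℝ, EuclideanSpace ℝ (Fin n)) ∞ (extChartAt J₀ (f p)) (f p) :=
    contMDiffAt_extChartAt
  apply inv.injective
  apply (NormedSpace.fromTangentSpace (extChartAt J₀ (f p) (f p))).injective
  ext i
  have e (w : TangentSpace J₀ (f p)) :
      mvfderiv J₀ (EuclideanSpace.proj (𝕜 := ℝ) i ∘ extChartAt J₀ (f p)) (f p) w =
        NormedSpace.fromTangentSpace _ (mfderiv J₀ 𝓘(ℝ, EuclideanSpace ℝ (Fin n))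
          (extChartAt J₀ (f p)) (f p) w) i := by
    have h1 := mfderiv_comp_apply (f p)
      (EuclideanSpace.proj i : EuclideanSpace ℝ (Fin n) →L[ℝ] ℝ).mdifferentiableAt
      (hchart.mdifferentiableAt (by simp)) w
    rw [ContinuousLinearMap.mfderiv_eq] at h1
    exact h1
  rw [← e, ← e]
  exact key ((EuclideanSpace.proj (𝕜 := ℝ) i).contMDiff.contMDiffAt.comp (f p) hchart)

end CovariantDerivative

end Euclidean

end Torsion

/-! ### The curvature of the pulled-back connection -/

section Curvature

open Filter VectorField
open scoped Topology

set_option linter.unusedSectionVars false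

variable {E : Type*} [NormedAddCommGroup E] [NormedSpace ℝ E] [FiniteDimensional ℝ E]
  {H : Type*} [TopologicalSpace H] {I : ModelWithCorners ℝ E H}
  {M : Type*} [TopologicalSpace M] [ChartedSpace H M] [IsManifold I ∞ M]
  {n : ℕ} {H' : Type*} [TopologicalSpace H']
  {J : ModelWithCorners ℝ (EuclideanSpace ℝ (Fin n)) H'}
  {N : Type*} [TopologicalSpace N] [T2Space N] [ChartedSpace H' N] [IsManifold J ∞ N]
  {f : M → N} {X Y : Π p : M, TangentSpace I p} {p : M}

/-- Passes from pointwise vectors to global smooth fields, over which the curvature hypothesis and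
the bundle equations quantify. -/
theorem exists_contMDiff_vectorField {y : N} (v : TangentSpace J y) :
    ∃ Z : Π y : N, TangentSpace J y,
      ContMDiff J J.tangent ∞ (fun y ↦ (⟨y, Z y⟩ : TangentBundle J N)) ∧ Z y = v := by
  obtain ⟨u, hu, hu'⟩ :=
    FiberBundle.exists_contMDiffOn_extend (k := ∞) J (EuclideanSpace ℝ (Fin n)) v
  obtain ⟨Z, hZ, hZ'⟩ := exists_contMDiff_section_eventuallyEq hu hu'
  exact ⟨Z, hZ, by rw [hZ'.self_of_nhds, FiberBundle.extend_apply_self]⟩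

namespace CovariantDerivative

variable (cov : CovariantDerivative J (EuclideanSpace ℝ (Fin n)) (TangentSpace J : N → Type _))

theorem mdifferentiableAt_apply_along (hcov : cov.ContMDiffCovariantDerivative ∞)
    {Z : Π y : N, TangentSpace J y}
    (hZ : ContMDiff J J.tangent ∞ (fun y ↦ (⟨y, Z y⟩ : TangentBundle J N)))
    {η : Π p, TangentSpace J (f p)}
    (hη : MDifferentiableAt I J.tangent (fun q ↦ (⟨f q, η q⟩ : TangentBundle J N)) p) :
    MDifferentiableAt I J.tangent
      (fun q ↦ (⟨f q, cov Z (f q) (η q)⟩ : TangentBundle J N)) p := by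
  have hf : MDifferentiableAt I J f p := ((mdifferentiableAt_totalSpace _ _).1 hη).1
  have h1 := (hcov.contMDiff.contMDiff (σ := Z) hZ.contMDiffOn).contMDiffAt univ_mem
    (x := f p) |>.mdifferentiableAt (by simp)
  exact MDifferentiableAt.clm_bundle_apply (h1.comp p hf) hη

theorem contMDiffAt_apply_along (hcov : cov.ContMDiffCovariantDerivative ∞)
    {Z : Π y : N, TangentSpace J y}
    (hZ : ContMDiff J J.tangent ∞ (fun y ↦ (⟨y, Z y⟩ : TangentBundle J N)))
    {η : Π p, TangentSpace J (f p)}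
    (hη : ContMDiffAt I J.tangent ∞ (fun q ↦ (⟨f q, η q⟩ : TangentBundle J N)) p) :
    ContMDiffAt I J.tangent ∞
      (fun q ↦ (⟨f q, cov Z (f q) (η q)⟩ : TangentBundle J N)) p := by
  have hf : ContMDiffAt I J ∞ f p := (contMDiffAt_totalSpace.1 hη).1
  have h1 := (hcov.contMDiff.contMDiff (σ := Z) hZ.contMDiffOn).contMDiffAt univ_mem (x := f p)
  exact ContMDiffAt.clm_bundle_apply (h1.comp p hf) hη

/-- The pulled-back covariant derivative of a smooth section along `f` is smooth. -/
theorem contMDiffAt_along (hcov : cov.ContMDiffCovariantDerivative ∞)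
    {ξ : Π p, TangentSpace J (f p)}
    (hξ : ContMDiffAt I J.tangent ∞ (fun q ↦ (⟨f q, ξ q⟩ : TangentBundle J N)) p)
    (hX : ContMDiffAt I I.tangent ∞ (fun q ↦ (⟨q, X q⟩ : TangentBundle I M)) p) :
    ContMDiffAt I J.tangent ∞
      (fun q ↦ (⟨f q, cov.along f ξ q (X q)⟩ : TangentBundle J N)) p := by
  have hf : ContMDiffAt I J ∞ f p := (contMDiffAt_totalSpace.1 hξ).1
  refine ContMDiffAt.along_induction (V := (TangentSpace J : N → Type _)) (P := fun ξ ↦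
    ContMDiffAt I J.tangent ∞
      (fun q ↦ (⟨f q, cov.along f ξ q (X q)⟩ : TangentBundle J N)) p) le_rfl hf hξ ?_ ?_ ?_ ?_
  · intro ξ η hξη h
    refine h.congr_of_eventuallyEq ?_
    filter_upwards [eventually_eventually_nhds.2 hξη] with q hq
    rw [cov.along_congr hq]
  · intro ξ η hξ hη h1 h2
    refine (h1.add_along h2).congr_of_eventuallyEq ?_
    filter_upwards [hξ.eventually_mdifferentiableAt, hη.eventually_mdifferentiableAt] with q e1 e2
    rw [cov.along_add e1 e2]
    rfl
  · intro g ξ hg hξ h1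
    refine ((hg.smul_along h1).add_along ((hg.mvfderiv_apply hX).smul_along
      hξ)).congr_of_eventuallyEq ?_
    filter_upwards [hξ.eventually_mdifferentiableAt, hg.eventually_mdifferentiableAt] with q e1 e2
    rw [cov.along_smul e2 e1]
    rfl
  · intro Z hZ
    refine (cov.contMDiffAt_apply_along hcov hZ (hf.mfderiv_along hX)).congr_of_eventuallyEq ?_
    filter_upwards [hf.eventually_mdifferentiableAt] with q hq
    rw [cov.along_comp hq (hZ.mdifferentiable (by simp) _)]
    rfl

/-- The second covariant derivative of a vector field is tensorial. -/
theorem tensorialAt_second (hcov : cov.ContMDiffCovariantDerivative ∞)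
    {Z : Π y : N, TangentSpace J y}
    (hZ : ContMDiff J J.tangent ∞ (fun y ↦ (⟨y, Z y⟩ : TangentBundle J N))) (y : N) :
    TensorialAt J (EuclideanSpace ℝ (Fin n)) (fun W : Π y : N, TangentSpace J y ↦
      cov (fun x ↦ cov Z x (W x)) y - (cov Z y).comp (cov W y)) y where
  smul {g σ} hg hσ := by
    have h1 := cov.mdifferentiableAt_apply_along (f := fun y ↦ y) hcov hZ hσ
    have h2 : (fun x ↦ cov Z x ((g • σ) x)) = g • fun x ↦ cov Z x (σ x) := by
      funext x
      simp
    rw [h2, cov.isCovariantDerivativeOnUniv.leibniz h1 hg,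
      cov.isCovariantDerivativeOnUniv.leibniz hσ hg]
    ext v
    simp
    module
  add {σ τ} hσ hτ := by
    have h1 := cov.mdifferentiableAt_apply_along (f := fun y ↦ y) hcov hZ hσ
    have h2 := cov.mdifferentiableAt_apply_along (f := fun y ↦ y) hcov hZ hτ
    have h3 : (fun x ↦ cov Z x ((σ + τ) x)) =
        (fun x ↦ cov Z x (σ x)) + fun x ↦ cov Z x (τ x) := by
      funext x
      simp
    rw [h3, cov.isCovariantDerivativeOnUniv.add h1 h2,
      cov.isCovariantDerivativeOnUniv.add hσ hτ]
    ext v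
    simp
    module

/-- The product rule for `∇Z` applied to a field along `f`; the second covariant derivative `∇²Z`
plays the role that the Hessian has for functions. -/
theorem along_apply_along (hcov : cov.ContMDiffCovariantDerivative ∞)
    {Z : Π y : N, TangentSpace J y}
    (hZ : ContMDiff J J.tangent ∞ (fun y ↦ (⟨y, Z y⟩ : TangentBundle J N)))
    {η : Π p, TangentSpace J (f p)}
    (hη : MDifferentiableAt I J.tangent (fun q ↦ (⟨f q, η q⟩ : TangentBundle J N)) p)
    (v : TangentSpace I p) :
    cov.along f (fun q ↦ cov Z (f q) (η q)) p v =
      cov Z (f p) (cov.along f η p v) +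
        TensorialAt.mkHom _ _ (cov.tensorialAt_second hcov hZ (f p)) (η p)
          (mfderiv I J f p v) := by
  have hf : MDifferentiableAt I J f p := ((mdifferentiableAt_totalSpace _ _).1 hη).1
  refine MDifferentiableAt.along_induction (V := (TangentSpace J : N → Type _)) (P := fun η ↦
    cov.along f (fun q ↦ cov Z (f q) (η q)) p v =
      cov Z (f p) (cov.along f η p v) +
        TensorialAt.mkHom _ _ (cov.tensorialAt_second hcov hZ (f p)) (η p) (mfderiv I J f p v))
    hf hη ?_ ?_ ?_ ?_
  · intro ξ η hξη hη
    rw [cov.along_congr hξη, hξη.self_of_nhds, ← hη]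
    congr 1
    apply cov.along_congr
    filter_upwards [hξη] with q hq
    rw [hq]
  · intro ξ η hξ hη e1 e2
    have h1 := cov.mdifferentiableAt_apply_along hcov hZ hξ
    have h2 := cov.mdifferentiableAt_apply_along hcov hZ hη
    simp only [map_add]
    rw [cov.along_add h1 h2, cov.along_add hξ hη]
    simp only [map_add, _root_.add_apply, e1, e2]
    abel
  · intro g ξ hg hξ e1
    have h1 := cov.mdifferentiableAt_apply_along hcov hZ hξ
    simp only [map_smul]
    rw [cov.along_smul hg h1, cov.along_smul hg hξ]
    simp only [map_add, _root_.add_apply, map_smul, _root_.smul_apply, e1,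
      ContinuousLinearMap.smulRight_apply]
    module
  · intro W hW
    have hW' := hW.mdifferentiable (by simp) (f p)
    have h1 := cov.mdifferentiableAt_apply_along (f := fun y ↦ y) hcov hZ hW'
    have h2 := cov.along_comp hf h1
    rw [cov.along_comp hf hW', TensorialAt.mkHom_apply (cov.tensorialAt_second hcov hZ _) hW']
    rw [h2]
    simp

/-- If the curvature of a torsion-free smooth connection is given by the tensor `R`, then the
curvature of its pull-back along `f` is `R(df(X), df(Y))ξ`. -/
theorem curvature_along (hcov : cov.ContMDiffCovariantDerivative ∞) (htors : cov.torsion = 0)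
    {R : Π y : N, TangentSpace J y →ₗ[ℝ] TangentSpace J y →ₗ[ℝ] TangentSpace J y →ₗ[ℝ]
      TangentSpace J y}
    (hR : ∀ U W Z : Π y : N, TangentSpace J y,
      ContMDiff J J.tangent ∞ (fun y ↦ (⟨y, U y⟩ : TangentBundle J N)) →
      ContMDiff J J.tangent ∞ (fun y ↦ (⟨y, W y⟩ : TangentBundle J N)) →
      ContMDiff J J.tangent ∞ (fun y ↦ (⟨y, Z y⟩ : TangentBundle J N)) → ∀ y,
      cov (fun x ↦ cov Z x (W x)) y (U y) - cov (fun x ↦ cov Z x (U x)) y (W y) -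
        cov Z y (mlieBracket J U W y) = R y (U y) (W y) (Z y))
    {ξ : Π p, TangentSpace J (f p)}
    (hξ : ContMDiffAt I J.tangent ∞ (fun q ↦ (⟨f q, ξ q⟩ : TangentBundle J N)) p)
    (hX : ContMDiffAt I I.tangent ∞ (fun q ↦ (⟨q, X q⟩ : TangentBundle I M)) p)
    (hY : ContMDiffAt I I.tangent ∞ (fun q ↦ (⟨q, Y q⟩ : TangentBundle I M)) p) :
    cov.along f (fun q ↦ cov.along f ξ q (Y q)) p (X p) -
      cov.along f (fun q ↦ cov.along f ξ q (X q)) p (Y p) -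
        cov.along f ξ p (mlieBracket I X Y p) =
      R (f p) (mfderiv I J f p (X p)) (mfderiv I J f p (Y p)) (ξ p) := by
  have hf : ContMDiffAt I J ∞ f p := (contMDiffAt_totalSpace.1 hξ).1
  have hf' : MDifferentiableAt I J f p := hf.mdifferentiableAt (by simp)
  refine ContMDiffAt.along_induction (V := (TangentSpace J : N → Type _)) (P := fun ξ ↦
    cov.along f (fun q ↦ cov.along f ξ q (Y q)) p (X p) -
      cov.along f (fun q ↦ cov.along f ξ q (X q)) p (Y p) -
        cov.along f ξ p (mlieBracket I X Y p) =
      R (f p) (mfderiv I J f p (X p)) (mfderiv I J f p (Y p)) (ξ p)) le_rfl hf hξ ?_ ?_ ?_ ?_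
  · intro ξ η hξη h
    have e (W : Π p : M, TangentSpace I p) :
        ∀ᶠ q in 𝓝 p, cov.along f ξ q (W q) = cov.along f η q (W q) := by
      filter_upwards [eventually_eventually_nhds.2 hξη] with q hq
      rw [cov.along_congr hq]
    rw [cov.along_congr (e X), cov.along_congr (e Y), cov.along_congr hξη, hξη.self_of_nhds, h]
  · intro ξ η hξ hη e1 e2
    have e (W : Π p : M, TangentSpace I p) : ∀ᶠ q in 𝓝 p,
        cov.along f (fun q ↦ ξ q + η q) q (W q) =
          cov.along f ξ q (W q) + cov.along f η q (W q) := by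
      filter_upwards [hξ.eventually_mdifferentiableAt, hη.eventually_mdifferentiableAt] with q e1 e2
      rw [cov.along_add e1 e2]
      rfl
    have md {W : Π p : M, TangentSpace I p} {ζ : Π p, TangentSpace J (f p)}
        (hζ : ContMDiffAt I J.tangent ∞ (fun q ↦ (⟨f q, ζ q⟩ : TangentBundle J N)) p)
        (hW : ContMDiffAt I I.tangent ∞ (fun q ↦ (⟨q, W q⟩ : TangentBundle I M)) p) :=
      (cov.contMDiffAt_along hcov hζ hW).mdifferentiableAt (by simp)
    rw [cov.along_congr (e X), cov.along_congr (e Y), cov.along_add (md hξ hX) (md hη hX),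
      cov.along_add (md hξ hY) (md hη hY), cov.along_add (hξ.mdifferentiableAt (by simp))
      (hη.mdifferentiableAt (by simp))]
    simp only [map_add, _root_.add_apply, ← e1, ← e2]
    abel
  · intro g ξ hg hξ e1
    have e (W : Π p : M, TangentSpace I p) : ∀ᶠ q in 𝓝 p,
        cov.along f (fun q ↦ g q • ξ q) q (W q) =
          g q • cov.along f ξ q (W q) + mvfderiv I g q (W q) • ξ q := by
      filter_upwards [hξ.eventually_mdifferentiableAt, hg.eventually_mdifferentiableAt] with q e1 e2
      rw [cov.along_smul e2 e1]
      rfl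
    have md {W : Π p : M, TangentSpace I p} {ζ : Π p, TangentSpace J (f p)}
        (hζ : ContMDiffAt I J.tangent ∞ (fun q ↦ (⟨f q, ζ q⟩ : TangentBundle J N)) p)
        (hW : ContMDiffAt I I.tangent ∞ (fun q ↦ (⟨q, W q⟩ : TangentBundle I M)) p) :=
      (cov.contMDiffAt_along hcov hζ hW).mdifferentiableAt (by simp)
    have hgX := (hg.mvfderiv_apply hX).mdifferentiableAt (by simp)
    have hgY := (hg.mvfderiv_apply hY).mdifferentiableAt (by simp)
    have hg' := hg.mdifferentiableAt (by simp)
    have hξ' := hξ.mdifferentiableAt (by simp)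
    -- The terms with one derivative of `g` cancel in pairs, and those with two cancel because
    -- `X(Yg) - Y(Xg) = [X,Y]g`.
    have hcomm := mvfderiv_mlieBracket hg hX hY hgX hgY
    rw [cov.along_congr (e X), cov.along_congr (e Y),
      cov.along_add (hg'.smul_along (md hξ hX)) (hgX.smul_along hξ'),
      cov.along_add (hg'.smul_along (md hξ hY)) (hgY.smul_along hξ'),
      cov.along_smul hg' hξ', cov.along_smul hg' (md hξ hX), cov.along_smul hg' (md hξ hY),
      cov.along_smul hgX hξ', cov.along_smul hgY hξ']
    simp only [map_smul, _root_.add_apply, _root_.smul_apply, ContinuousLinearMap.smulRight_apply,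
      ← e1, hcomm]
    module
  · intro Z hZ
    have e (W : Π p : M, TangentSpace I p) : ∀ᶠ q in 𝓝 p,
        cov.along f (fun q ↦ Z (f q)) q (W q) = cov Z (f q) (mfderiv I J f q (W q)) := by
      filter_upwards [hf.eventually_mdifferentiableAt] with q hq
      rw [cov.along_comp hq (hZ.mdifferentiable (by simp) _)]
      rfl
    -- For `Z ∘ f` the torsion identity absorbs the bracket term, leaving the antisymmetrization of
    -- `∇²Z` at `df(X)`, `df(Y)`. This is tensorial, so the two vectors may be extended to fields
    -- `U`, `W` on `N` that match them at the single point `f p`, where `hR` applies.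
    have key := cov.along_mfderiv_sub htors hf hX hY
    obtain ⟨U, hU, hU'⟩ := exists_contMDiff_vectorField (mfderiv I J f p (X p))
    obtain ⟨W, hW, hW'⟩ := exists_contMDiff_vectorField (mfderiv I J f p (Y p))
    have hRZ := hR U W Z hU hW hZ (f p)
    have ht := cov.torsion_eq_zero_iff.1 htors (hU.mdifferentiable (by simp) (f p))
      (hW.mdifferentiable (by simp) (f p))
    have T1 := TensorialAt.mkHom_apply (cov.tensorialAt_second hcov hZ (f p))
      (hW.mdifferentiable (by simp) (f p))
    have T2 := TensorialAt.mkHom_apply (cov.tensorialAt_second hcov hZ (f p))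
      (hU.mdifferentiable (by simp) (f p))
    rw [cov.along_congr (e X), cov.along_congr (e Y),
      cov.along_apply_along hcov hZ ((hf.mfderiv_along hX).mdifferentiableAt (by simp)),
      cov.along_apply_along hcov hZ ((hf.mfderiv_along hY).mdifferentiableAt (by simp)),
      cov.along_comp hf' (hZ.mdifferentiable (by simp) _), ContinuousLinearMap.comp_apply, ← key,
      ← hU', ← hW', T1, T2, ← hRZ, ← ht]
    simp only [_root_.sub_apply, ContinuousLinearMap.comp_apply, map_sub]
    abel

end CovariantDerivative

end Curvature

/-! ### Metric compatibility of the pulled-back connection -/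

section MetricAlong

open Filter
open scoped Topology

set_option linter.unusedSectionVars false

variable {E : Type*} [NormedAddCommGroup E] [NormedSpace ℝ E]
  {H : Type*} [TopologicalSpace H] {I : ModelWithCorners ℝ E H}
  {M : Type*} [TopologicalSpace M] [ChartedSpace H M]
  {E' : Type*} [NormedAddCommGroup E'] [NormedSpace ℝ E'] [FiniteDimensional ℝ E']
  {H' : Type*} [TopologicalSpace H'] {J : ModelWithCorners ℝ E' H'}
  {N : Type*} [TopologicalSpace N] [T2Space N] [ChartedSpace H' N] [IsManifold J ∞ N]
  {n : ℕ} {V : N → Type*}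
  [TopologicalSpace (TotalSpace (EuclideanSpace ℝ (Fin n)) V)] [∀ x, NormedAddCommGroup (V x)]
  [∀ x, InnerProductSpace ℝ (V x)]
  [FiberBundle (EuclideanSpace ℝ (Fin n)) V] [VectorBundle ℝ (EuclideanSpace ℝ (Fin n)) V]
  [ContMDiffVectorBundle ∞ (EuclideanSpace ℝ (Fin n)) V J]
  [IsContMDiffRiemannianBundle J ∞ (EuclideanSpace ℝ (Fin n)) V]
  {cov : CovariantDerivative J (EuclideanSpace ℝ (Fin n)) V}
  {f : M → N} {ξ η : Π p, V (f p)} {p : M}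

/-- The pull-back of a metric connection is metric. -/
theorem CovariantDerivative.IsMetricCompatible.mvfderiv_inner_along (hcov : cov.IsMetricCompatible)
    (hξ : MDifferentiableAt I (J.prod 𝓘(ℝ, EuclideanSpace ℝ (Fin n)))
      (fun q ↦ TotalSpace.mk' (EuclideanSpace ℝ (Fin n)) (f q) (ξ q)) p)
    (hη : MDifferentiableAt I (J.prod 𝓘(ℝ, EuclideanSpace ℝ (Fin n)))
      (fun q ↦ TotalSpace.mk' (EuclideanSpace ℝ (Fin n)) (f q) (η q)) p)
    (v : TangentSpace I p) :
    mvfderiv I (fun q ↦ inner ℝ (ξ q) (η q)) p v =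
      inner ℝ (cov.along f ξ p v) (η p) + inner ℝ (ξ p) (cov.along f η p v) := by
  have hf : MDifferentiableAt I J f p := ((mdifferentiableAt_totalSpace _ _).1 hξ).1
  refine MDifferentiableAt.along_induction (P := fun ξ ↦
    mvfderiv I (fun q ↦ inner ℝ (ξ q) (η q)) p v =
      inner ℝ (cov.along f ξ p v) (η p) + inner ℝ (ξ p) (cov.along f η p v)) hf hξ ?_ ?_ ?_ ?_
  · intro ξ ζ h e
    have h' : (fun q ↦ inner ℝ (ξ q) (η q)) =ᶠ[𝓝 p] fun q ↦ inner ℝ (ζ q) (η q) := by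
      filter_upwards [h] with q hq
      rw [hq]
    rw [h'.mvfderiv_eq, cov.along_congr h, h.self_of_nhds, e]
  · intro ξ ζ hξ hζ e1 e2
    have h' : (fun q ↦ inner ℝ (ξ q + ζ q) (η q)) =
        (fun q ↦ inner ℝ (ξ q) (η q)) + fun q ↦ inner ℝ (ζ q) (η q) := by
      funext q
      simp [inner_add_left]
    rw [h', mvfderiv_add (MDifferentiableAt.inner_bundle hξ hη)
      (MDifferentiableAt.inner_bundle hζ hη), cov.along_add hξ hζ]
    simp only [_root_.add_apply, e1, e2, inner_add_left]
    ring
  · intro g ξ hg hξ e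
    have h' : (fun q ↦ inner ℝ (g q • ξ q) (η q)) = g • (fun q ↦ inner ℝ (ξ q) (η q)) := by
      funext q
      simp [inner_smul_left]
    rw [h', mvfderiv_smul hg (MDifferentiableAt.inner_bundle hξ hη), cov.along_smul hg hξ]
    simp only [_root_.add_apply, _root_.smul_apply, ContinuousLinearMap.smulRight_apply, e,
      inner_add_left, inner_smul_left, smul_eq_mul, conj_trivial]
    ring
  -- With the first field reduced to `Z ∘ f`, a second induction reduces the other one to `W ∘ f`;
  -- what is left is metric compatibility on `N` and the chain rule.
  intro Z hZ
  have hZ' := hZ.mdifferentiable (by simp) (f p)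
  have hZf : MDifferentiableAt I (J.prod 𝓘(ℝ, EuclideanSpace ℝ (Fin n)))
      (fun q ↦ TotalSpace.mk' (EuclideanSpace ℝ (Fin n)) (f q) (Z (f q))) p := hZ'.comp p hf
  refine MDifferentiableAt.along_induction (P := fun η ↦
    mvfderiv I (fun q ↦ inner ℝ (Z (f q)) (η q)) p v =
      inner ℝ (cov.along f (fun q ↦ Z (f q)) p v) (η p) +
        inner ℝ (Z (f p)) (cov.along f η p v)) hf hη ?_ ?_ ?_ ?_
  · intro ξ ζ h e
    have h' : (fun q ↦ inner ℝ (Z (f q)) (ξ q)) =ᶠ[𝓝 p] fun q ↦ inner ℝ (Z (f q)) (ζ q) := by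
      filter_upwards [h] with q hq
      rw [hq]
    rw [h'.mvfderiv_eq, cov.along_congr h, h.self_of_nhds, e]
  · intro ξ ζ hξ hζ e1 e2
    have h' : (fun q ↦ inner ℝ (Z (f q)) (ξ q + ζ q)) =
        (fun q ↦ inner ℝ (Z (f q)) (ξ q)) + fun q ↦ inner ℝ (Z (f q)) (ζ q) := by
      funext q
      simp [inner_add_right]
    rw [h', mvfderiv_add (MDifferentiableAt.inner_bundle hZf hξ)
      (MDifferentiableAt.inner_bundle hZf hζ), cov.along_add hξ hζ]
    simp only [_root_.add_apply, e1, e2, inner_add_right]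
    ring
  · intro g ξ hg hξ e
    have h' : (fun q ↦ inner ℝ (Z (f q)) (g q • ξ q)) =
        g • (fun q ↦ inner ℝ (Z (f q)) (ξ q)) := by
      funext q
      simp [inner_smul_right]
    rw [h', mvfderiv_smul hg (MDifferentiableAt.inner_bundle hZf hξ), cov.along_smul hg hξ]
    simp only [_root_.add_apply, _root_.smul_apply, ContinuousLinearMap.smulRight_apply, e,
      inner_add_right, inner_smul_right, smul_eq_mul]
    ring
  · intro W hW
    have hW' := hW.mdifferentiable (by simp) (f p)
    rw [cov.along_comp hf hZ', cov.along_comp hf hW']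
    have key := hcov.mvfderiv_inner_eq
      (FiberBundle.extend E' (mfderiv I J f p v) : Π y : N, TangentSpace J y) hZ' hW'
    have h1 : MDifferentiableAt J 𝓘(ℝ, ℝ) (fun y ↦ inner ℝ (Z y) (W y)) (f p) :=
      MDifferentiableAt.inner_bundle hZ' hW'
    have h2 := mfderiv_comp_apply p h1 hf v
    simp only [FiberBundle.extend_apply_self] at key
    exact h2.trans key

end MetricAlong

/-! ### Curvature symmetries and constant sectional curvature -/

section ConstantCurvature

set_option linter.unusedSectionVars false

open Filter VectorField
open scoped Topology

/-- A quadrilinear form with the symmetries of a curvature tensor vanishes if its sectional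
curvatures do. -/
theorem curvatureForm_eq_zero {V : Type*} [AddCommGroup V] {T : V → V → V → V → ℝ}
    (add₁ : ∀ x x' y z w, T (x + x') y z w = T x y z w + T x' y z w)
    (add₄ : ∀ x y z w w', T x y z (w + w') = T x y z w + T x y z w')
    (anti₁₂ : ∀ x y z w, T x y z w = -T y x z w) (anti₃₄ : ∀ x y z w, T x y z w = -T x y w z)
    (bianchi : ∀ x y z w, T x y z w + T y z x w + T z x y w = 0)
    (sectional : ∀ x y, T x y y x = 0) (x y z w : V) : T x y z w = 0 := by
  -- Pair symmetry results from adding the four cyclic Bianchi identities and using both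
  -- antisymmetries.
  have pair (x y z w : V) : T x y z w = T z w x y := by
    linarith [bianchi x y z w, bianchi y z w x, bianchi z w x y, bianchi w x y z,
      anti₁₂ x y z w, anti₁₂ y z w x, anti₁₂ z w x y, anti₁₂ w x y z, anti₁₂ x z y w,
      anti₁₂ y w x z, anti₁₂ x z w y, anti₁₂ y w z x,
      anti₃₄ x y z w, anti₃₄ y z w x, anti₃₄ z w x y, anti₃₄ w x y z, anti₃₄ x z y w,
      anti₃₄ y w x z, anti₃₄ z x y w, anti₃₄ w y x z, anti₃₄ y x z w, anti₃₄ z y w x,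
      anti₃₄ w z x y, anti₃₄ x w y z, anti₃₄ z x w y, anti₃₄ w y z x]
  -- Polarizing the sectional hypothesis in `x` gives `T x y y w + T w y y x = 0`, and the two terms
  -- agree by pair symmetry.
  have polar (x y w : V) : T x y y w = 0 := by
    have h := sectional (x + w) y
    rw [add₁, add₄, add₄, sectional, sectional] at h
    linarith [pair w y y x, anti₁₂ y x w y, anti₃₄ x y w y]
  have add₂ (x y y' z w : V) : T x (y + y') z w = T x y z w + T x y' z w := by
    linarith [anti₁₂ x (y + y') z w, add₁ y y' x z w, anti₁₂ x y z w, anti₁₂ x y' z w]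
  have add₃ (x y z z' w : V) : T x y (z + z') w = T x y z w + T x y z' w := by
    linarith [anti₃₄ x y (z + z') w, add₄ x y w z z', anti₃₄ x y z w, anti₃₄ x y z' w]
  -- Polarizing again in `y` makes `T` change sign under the middle transposition as well. It is
  -- then invariant under cyclic permutation of its first three arguments, and the Bianchi identity
  -- reads `3T = 0`.
  have anti₂₃ (x y z w : V) : T x y z w = -T x z y w := by
    have h := polar x (y + z) w
    rw [add₂, add₃, add₃, polar, polar] at h
    linarith
  linarith [bianchi x y z w, anti₂₃ y z x w, anti₁₂ y x z w, anti₁₂ z x y w, anti₂₃ x z y w]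

variable {n : ℕ}
  {N : Type*} [TopologicalSpace N] [T2Space N] [ChartedSpace (EuclideanSpace ℝ (Fin n)) N]
  [IsManifold (𝓡 n) ∞ N]
  {nabla : CovariantDerivative (𝓡 n) (EuclideanSpace ℝ (Fin n))
    (fun x : N ↦ TangentSpace (𝓡 n) x)}
  {X Y Z W : Π y : N, TangentSpace (𝓡 n) y}

theorem IsSmoothVectorField.covariantDerivative (hcov : nabla.ContMDiffCovariantDerivative ∞)
    (hZ : IsSmoothVectorField Z) (hX : IsSmoothVectorField X) :
    IsSmoothVectorField (fun y ↦ nabla Z y (X y)) :=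
  fun y ↦ nabla.contMDiffAt_apply_along (f := fun y ↦ y) hcov hZ (hX y)

theorem IsSmoothVectorField.mlieBracket (hX : IsSmoothVectorField X) (hY : IsSmoothVectorField Y) :
    IsSmoothVectorField (mlieBracket (𝓡 n) X Y) := by
  have : IsManifold (𝓡 n) (minSmoothness ℝ 2) N := IsManifold.of_le (n := ∞) (by simp; norm_cast)
  have : IsManifold (𝓡 n) (∞ + 1) N := ‹IsManifold (𝓡 n) ∞ N›
  exact fun y ↦ ContMDiffAt.mlieBracket_vectorField (n := ⊤) (m := ⊤) (hX y) (hY y) (by simp)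

theorem IsSmoothVectorField.mdifferentiableAt (hX : IsSmoothVectorField X) (y : N) :
    MDifferentiableAt (𝓡 n) (𝓡 n).tangent (fun y ↦ (⟨y, X y⟩ : TangentBundle (𝓡 n) N)) y :=
  ContMDiff.mdifferentiable hX (by simp) y

set_option synthInstance.maxHeartbeats 200000

variable [RiemannianBundle (fun x : N ↦ TangentSpace (𝓡 n) x)]
  [IsContMDiffRiemannianBundle (𝓡 n) ∞ (EuclideanSpace ℝ (Fin n))
    (fun x : N ↦ TangentSpace (𝓡 n) x)]

/-- Replacing the bracket by `∇_X Y - ∇_Y X` exhibits the curvature as antisymmetrized `∇²Z`, hence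
as depending on `X` and `Y` only through their values at `y`. -/
theorem connectionCurvature_eq_second (hcov : nabla.ContMDiffCovariantDerivative ∞)
    (htors : nabla.torsion = 0) (hX : IsSmoothVectorField X) (hY : IsSmoothVectorField Y)
    (hZ : IsSmoothVectorField Z) (y : N) :
    connectionCurvature nabla X Y Z y =
      TensorialAt.mkHom _ _ (nabla.tensorialAt_second hcov hZ y) (Y y) (X y) -
        TensorialAt.mkHom _ _ (nabla.tensorialAt_second hcov hZ y) (X y) (Y y) := by
  rw [TensorialAt.mkHom_apply (nabla.tensorialAt_second hcov hZ y) (hX.mdifferentiableAt y),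
    TensorialAt.mkHom_apply (nabla.tensorialAt_second hcov hZ y) (hY.mdifferentiableAt y),
    connectionCurvature, ← nabla.torsion_eq_zero_iff.1 htors (hX.mdifferentiableAt y)
      (hY.mdifferentiableAt y)]
  simp only [_root_.sub_apply, ContinuousLinearMap.comp_apply, map_sub]
  abel

/-- Differentiating `∇_A B = ∇_B A + [A,B]` and using vanishing torsion once more turns the cyclic
sum into the Jacobi identity. -/
theorem connectionCurvature_bianchi (hcov : nabla.ContMDiffCovariantDerivative ∞)
    (htors : nabla.torsion = 0) (hX : IsSmoothVectorField X) (hY : IsSmoothVectorField Y)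
    (hZ : IsSmoothVectorField Z) (y : N) :
    connectionCurvature nabla X Y Z y + connectionCurvature nabla Y Z X y +
      connectionCurvature nabla Z X Y y = 0 := by
  have tors {A B : Π y : N, TangentSpace (𝓡 n) y} (hA : IsSmoothVectorField A)
      (hB : IsSmoothVectorField B) (x : N) :
      nabla B x (A x) - nabla A x (B x) = mlieBracket (𝓡 n) A B x :=
    nabla.torsion_eq_zero_iff.1 htors (hA.mdifferentiableAt x) (hB.mdifferentiableAt x)
  have key {A B : Π y : N, TangentSpace (𝓡 n) y} (hA : IsSmoothVectorField A)
      (hB : IsSmoothVectorField B) : nabla (fun x ↦ nabla B x (A x)) y =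
      nabla (fun x ↦ nabla A x (B x)) y + nabla (mlieBracket (𝓡 n) A B) y := by
    rw [← nabla.isCovariantDerivativeOnUniv.add
      ((hA.covariantDerivative hcov hB).mdifferentiableAt y)
      ((hA.mlieBracket hB).mdifferentiableAt y)]
    congr 1
    funext x
    simp [← tors hA hB x]
  have : IsManifold (𝓡 n) (minSmoothness ℝ 3) N := IsManifold.of_le (n := ∞) (by simp; norm_cast)
  have J := leibniz_identity_mlieBracket_apply (I := 𝓡 n) (x := y) (U := X) (V := Y) (W := Z)
    ((hX y).of_le (by simp; norm_cast)) ((hY y).of_le (by simp; norm_cast))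
    ((hZ y).of_le (by simp; norm_cast))
  have s1 := tors hX (hY.mlieBracket hZ) y
  have s2 := tors hY (hX.mlieBracket hZ) y
  have s3 := tors (hX.mlieBracket hY) hZ y
  have e : mlieBracket (𝓡 n) Z X = fun x ↦ -mlieBracket (𝓡 n) X Z x := by
    funext x
    exact mlieBracket_swap_apply
  have e' : nabla Y y (mlieBracket (𝓡 n) Z X y) = - nabla Y y (mlieBracket (𝓡 n) X Z y) := by
    rw [e, map_neg]
  rw [← s1, ← s2, ← s3] at J
  simp only [connectionCurvature, e']
  rw [key hX hZ, key hX hY, key hY hZ]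
  simp only [_root_.add_apply]
  rw [← sub_eq_zero] at J
  rw [← J]
  abel

/-- Apply `XY - YX - [X,Y]`, which kills functions, to `⟨Z, W⟩` and expand by metric compatibility:
the mixed first-order products cancel, leaving `⟨R Z, W⟩ + ⟨Z, R W⟩ = 0`. -/
theorem inner_connectionCurvature_swap (hnabla : IsLeviCivita nabla)
    (hX : IsSmoothVectorField X) (hY : IsSmoothVectorField Y) (hZ : IsSmoothVectorField Z)
    (hW : IsSmoothVectorField W) (y : N) :
    (inner ℝ (connectionCurvature nabla X Y Z y) (W y) : ℝ) =
      -inner ℝ (connectionCurvature nabla X Y W y) (Z y) := by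
  have smooth {A B : Π y : N, TangentSpace (𝓡 n) y} (hA : IsSmoothVectorField A)
      (hB : IsSmoothVectorField B) :
      ContMDiffAt (𝓡 n) 𝓘(ℝ, ℝ) ∞ (fun x ↦ (inner ℝ (A x) (B x) : ℝ)) y :=
    ContMDiffAt.inner_bundle (hA y) (hB y)
  have D {A B : Π y : N, TangentSpace (𝓡 n) y} (hA : IsSmoothVectorField A)
      (hB : IsSmoothVectorField B) (C : Π y : N, TangentSpace (𝓡 n) y) (x : N) :
      mvfderiv (𝓡 n) (fun x ↦ (inner ℝ (A x) (B x) : ℝ)) x (C x) =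
        inner ℝ (nabla A x (C x)) (B x) + inner ℝ (A x) (nabla B x (C x)) :=
    hnabla.metric.mvfderiv_inner_eq C (hA.mdifferentiableAt x) (hB.mdifferentiableAt x)
  have hcov := hnabla.smooth
  have D2 {A B : Π y : N, TangentSpace (𝓡 n) y} (hA : IsSmoothVectorField A)
      (hB : IsSmoothVectorField B) :
      mvfderiv (𝓡 n) (fun x ↦ mvfderiv (𝓡 n) (fun x ↦ (inner ℝ (Z x) (W x) : ℝ)) x (B x)) y (A y) =
        inner ℝ (nabla (fun x ↦ nabla Z x (B x)) y (A y)) (W y) +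
          inner ℝ (nabla Z y (B y)) (nabla W y (A y)) +
        (inner ℝ (nabla Z y (A y)) (nabla W y (B y)) +
          inner ℝ (Z y) (nabla (fun x ↦ nabla W x (B x)) y (A y))) := by
    have h1 := hZ.covariantDerivative hcov hB
    have h2 := hW.covariantDerivative hcov hB
    have e : (fun x ↦ mvfderiv (𝓡 n) (fun x ↦ (inner ℝ (Z x) (W x) : ℝ)) x (B x)) =
        (fun x ↦ (inner ℝ (nabla Z x (B x)) (W x) : ℝ)) +
          fun x ↦ (inner ℝ (Z x) (nabla W x (B x)) : ℝ) := by
      funext x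
      exact D hZ hW B x
    rw [e, mvfderiv_add ((smooth h1 hW).mdifferentiableAt (by simp))
      ((smooth hZ h2).mdifferentiableAt (by simp)), _root_.add_apply, D h1 hW, D hZ h2]
  have hX' := (smooth hZ hW).mvfderiv_apply (hX y)
  have hY' := (smooth hZ hW).mvfderiv_apply (hY y)
  have key := mvfderiv_mlieBracket (smooth hZ hW) (hX y) (hY y)
    (hX'.mdifferentiableAt (by simp)) (hY'.mdifferentiableAt (by simp))
  rw [D2 hX hY, D2 hY hX, D hZ hW] at key
  simp only [connectionCurvature, inner_sub_left]
  rw [real_inner_comm (Z y) (nabla (fun x ↦ nabla W x (Y x)) y (X y)),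
    real_inner_comm (Z y) (nabla (fun x ↦ nabla W x (X x)) y (Y y)),
    real_inner_comm (Z y) (nabla W y _)]
  linarith

/-- The curvature tensor of a Riemannian manifold of constant sectional curvature. -/
theorem HasConstantCurvature.connectionCurvature_eq (hnabla : IsLeviCivita nabla) {c : ℝ}
    (hc : HasConstantCurvature nabla c)
    (hX : IsSmoothVectorField X) (hY : IsSmoothVectorField Y) (hZ : IsSmoothVectorField Z) (y : N) :
    connectionCurvature nabla X Y Z y =
      c • ((inner ℝ (Y y) (Z y) : ℝ) • X y - (inner ℝ (X y) (Z y) : ℝ) • Y y) := by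
  have hcov := hnabla.smooth
  have htors := hnabla.torsionFree
  choose e he he' using fun v : TangentSpace (𝓡 n) y ↦ exists_contMDiff_vectorField v
  -- `T` is the difference between the curvature and its model. The chosen extensions `e` are not
  -- linear, so additivity is only directly visible in the first slot (by tensoriality) and in the
  -- last; these are the two slots that `curvatureForm_eq_zero` asks for.
  have hT := curvatureForm_eq_zero (T := fun x u z w : TangentSpace (𝓡 n) y ↦
    (inner ℝ (connectionCurvature nabla (e x) (e u) (e z) y) w : ℝ) -
      c * (inner ℝ u z * inner ℝ x w - inner ℝ x z * inner ℝ u w)) ?_ ?_ ?_ ?_ ?_ ?_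
  · refine ext_inner_right ℝ fun w ↦ ?_
    have h := hT (X y) (Y y) w (Z y)
    -- Skew-symmetry moves `Z` into the last slot, where only its value at `y` enters. This replaces
    -- a separate proof of tensoriality in `Z`.
    have h2 := inner_connectionCurvature_swap hnabla hX hY hZ (he w) y
    rw [connectionCurvature_eq_second hcov htors hX hY (he w)] at h2
    simp only [connectionCurvature_eq_second hcov htors (he _) (he _) (he _), he'] at h h2
    simp only [inner_smul_left, inner_sub_left (inner ℝ (Y y) (Z y) • X y), conj_trivial]
    linarith
  · intro x x' u z w
    simp only [connectionCurvature_eq_second hcov htors (he _) (he _) (he _), he', map_add,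
      _root_.add_apply, inner_add_left, inner_sub_left]
    ring
  · intro x u z w w'
    simp only [inner_add_right]
    ring
  · intro x u z w
    simp only [connectionCurvature_eq_second hcov htors (he _) (he _) (he _), he', inner_sub_left]
    ring
  · intro x u z w
    have h := inner_connectionCurvature_swap hnabla (he x) (he u) (he z) (he w) y
    simp only [he'] at h
    simp only [h]
    ring
  · intro x u z w
    have h := connectionCurvature_bianchi hcov htors (he x) (he u) (he z) y
    have h' := congrArg (fun v ↦ (inner ℝ v w : ℝ)) h
    simp only [inner_add_left, inner_zero_left] at h'
    rw [real_inner_comm z x, real_inner_comm u x, real_inner_comm z u] at *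
    linarith
  · intro x u
    have h := hc (e x) (e u) (he x) (he u) y
    simp only [he'] at h
    rw [h, real_inner_comm u x]
    ring

end ConstantCurvature

/-! ### Gram-Schmidt for sections along a map -/

section OrthonormalFrames

open Filter
open scoped Topology

set_option linter.unusedSectionVars false

variable {E : Type*} [NormedAddCommGroup E] [NormedSpace ℝ E]
  {H : Type*} [TopologicalSpace H] {I : ModelWithCorners ℝ E H}
  {M : Type*} [TopologicalSpace M] [ChartedSpace H M]
  {E' : Type*} [NormedAddCommGroup E'] [NormedSpace ℝ E'] [FiniteDimensional ℝ E']
  {H' : Type*} [TopologicalSpace H'] {J : ModelWithCorners ℝ E' H'}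
  {N : Type*} [TopologicalSpace N] [T2Space N] [ChartedSpace H' N] [IsManifold J ∞ N]
  {n : ℕ} {V : N → Type*}
  [TopologicalSpace (TotalSpace (EuclideanSpace ℝ (Fin n)) V)] [∀ x, NormedAddCommGroup (V x)]
  [∀ x, InnerProductSpace ℝ (V x)]
  [FiberBundle (EuclideanSpace ℝ (Fin n)) V] [VectorBundle ℝ (EuclideanSpace ℝ (Fin n)) V]
  [ContMDiffVectorBundle ∞ (EuclideanSpace ℝ (Fin n)) V J]
  [IsContMDiffRiemannianBundle J ∞ (EuclideanSpace ℝ (Fin n)) V]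
  {f : M → N}

/-- Gram-Schmidt orthonormalization of sections along a map. -/
theorem exists_orthonormal_along {k : ℕ} {z : Fin k → Π p, V (f p)}
    (hf : ContMDiff I J ∞ f)
    (hz : ∀ i p, ContMDiffAt I (J.prod 𝓘(ℝ, EuclideanSpace ℝ (Fin n))) ∞
      (fun q ↦ TotalSpace.mk' (EuclideanSpace ℝ (Fin n)) (f q) (z i q)) p)
    {p₀ : M} (h₀ : Orthonormal ℝ (fun i ↦ z i p₀)) :
    ∃ u : Set M, IsOpen u ∧ p₀ ∈ u ∧ ∃ s : Fin k → Π p, V (f p),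
      (∀ i, s i p₀ = z i p₀) ∧
      (∀ i, ∀ p ∈ u, ContMDiffAt I (J.prod 𝓘(ℝ, EuclideanSpace ℝ (Fin n))) ∞
        (fun q ↦ TotalSpace.mk' (EuclideanSpace ℝ (Fin n)) (f q) (s i q)) p) ∧
      (∀ p ∈ u, Orthonormal ℝ (fun i ↦ s i p)) ∧
      ∀ p ∈ u, ∀ w : V (f p), (∀ i, inner ℝ (z i p) w = (0 : ℝ)) →
        ∀ i, inner ℝ (s i p) w = (0 : ℝ) := by
  induction k with
  | zero =>
    exact ⟨Set.univ, isOpen_univ, trivial, z, fun i ↦ i.elim0, fun i ↦ i.elim0,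
      fun p _ ↦ ⟨fun i ↦ i.elim0, fun i ↦ i.elim0⟩, fun _ _ _ _ i ↦ i.elim0⟩
  | succ k ih =>
    obtain ⟨u, hu, hpu, s, hs₀, hs, hon, hw⟩ := ih (z := fun i ↦ z i.castSucc)
      (fun i p ↦ hz i.castSucc p) (h₀.comp Fin.castSucc (Fin.castSucc_injective k))
    let e : Π p, V (f p) := fun p ↦
      z (Fin.last k) p - ∑ i, (inner ℝ (s i p) (z (Fin.last k) p) : ℝ) • s i p
    have he (p : M) (hp : p ∈ u) : ContMDiffAt I (J.prod 𝓘(ℝ, EuclideanSpace ℝ (Fin n))) ∞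
        (fun q ↦ TotalSpace.mk' (EuclideanSpace ℝ (Fin n)) (f q) (e q)) p :=
      ContMDiffAt.sub_along (hz _ p) (ContMDiffAt.sum_along (hf p) fun i _ ↦
        ContMDiffAt.smul_along (ContMDiffAt.inner_bundle (hs i p hp) (hz _ p)) (hs i p hp))
    have hee (p : M) (hp : p ∈ u) :
        ContMDiffAt I 𝓘(ℝ, ℝ) ∞ (fun q ↦ (inner ℝ (e q) (e q) : ℝ)) p :=
      ContMDiffAt.inner_bundle (he p hp) (he p hp)
    have hse (p : M) (hp : p ∈ u) (i : Fin k) : (inner ℝ (s i p) (e p) : ℝ) = 0 := by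
      simp only [e, inner_sub_right, (hon p hp).inner_right_fintype, sub_self]
    have he₀ : e p₀ = z (Fin.last k) p₀ := by
      have h (i : Fin k) : (inner ℝ (z i.castSucc p₀) (z (Fin.last k) p₀) : ℝ) = 0 :=
        h₀.inner_eq_zero (Fin.castSucc_lt_last i).ne
      simp [e, hs₀, h]
    have hc : ContinuousOn (fun q ↦ (inner ℝ (e q) (e q) : ℝ)) u :=
      fun p hp ↦ (hee p hp).continuousAt.continuousWithinAt
    -- The remainder `e` can only be normalized where it does not vanish. This set is open and
    -- contains `p₀`, where `e` is the unit vector `z (Fin.last k) p₀`.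
    refine ⟨u ∩ (fun q ↦ (inner ℝ (e q) (e q) : ℝ)) ⁻¹' {0}ᶜ,
      hc.isOpen_inter_preimage hu isClosed_singleton.isOpen_compl, ⟨hpu, ?_⟩,
      Fin.snoc (α := fun _ ↦ Π p, V (f p)) s
        (fun p ↦ (Real.sqrt (inner ℝ (e p) (e p)))⁻¹ • e p), ?_, ?_, ?_, ?_⟩
    · simp [he₀, h₀.1]
    · intro i
      refine Fin.lastCases ?_ (fun i ↦ ?_) i
      · simp only [Fin.snoc_last, he₀, real_inner_self_eq_norm_sq, h₀.1]
        simp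
      · simp [hs₀]
    · rintro i p ⟨hp, hp'⟩
      refine Fin.lastCases ?_ (fun i ↦ ?_) i
      · simp only [Fin.snoc_last]
        refine ContMDiffAt.smul_along ?_ (he p hp)
        have hp' : (inner ℝ (e p) (e p) : ℝ) ≠ 0 := hp'
        have h1 : ContDiffAt ℝ ∞ (fun t : ℝ ↦ (Real.sqrt t)⁻¹) (inner ℝ (e p) (e p)) := by
          refine (Real.contDiffAt_sqrt hp').inv ?_
          rw [Real.sqrt_ne_zero real_inner_self_nonneg]
          exact hp'
        exact ContMDiffAt.comp (g := fun t : ℝ ↦ (Real.sqrt t)⁻¹) p h1.contMDiffAt (hee p hp)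
      · simpa only [Fin.snoc_castSucc] using hs i p hp
    · rintro p ⟨hp, hp'⟩
      have hp' : (inner ℝ (e p) (e p) : ℝ) ≠ 0 := hp'
      have hep : e p ≠ 0 := by rwa [ne_eq, ← inner_self_eq_zero (𝕜 := ℝ)]
      rw [orthonormal_iff_ite]
      intro i j
      induction i using Fin.lastCases with
      | last =>
        induction j using Fin.lastCases with
        | last =>
          simp only [Fin.snoc_last, if_true, inner_smul_left, inner_smul_right, conj_trivial]
          rw [real_inner_self_eq_norm_sq, Real.sqrt_sq (norm_nonneg _)]
          field_simp [norm_ne_zero_iff.2 hep]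
        | cast j =>
          rw [if_neg (Fin.castSucc_lt_last j).ne']
          simp [inner_smul_right, real_inner_comm (s j p), hse p hp]
      | cast i =>
        induction j using Fin.lastCases with
        | last =>
          rw [if_neg (Fin.castSucc_lt_last i).ne]
          simp [inner_smul_right, hse p hp]
        | cast j =>
          simp only [Fin.snoc_castSucc, Fin.castSucc_inj]
          exact orthonormal_iff_ite.1 (hon p hp) i j
    · rintro p ⟨hp, hp'⟩ w hzw i
      have h := hw p hp w fun i ↦ hzw i.castSucc
      refine Fin.lastCases ?_ (fun i ↦ ?_) i
      · simp [e, inner_smul_left, inner_sub_left, sum_inner, h, hzw]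
      · simpa using h i

theorem finrank_fiber (y : N) : Module.finrank ℝ (V y) = n := by
  rw [((trivializationAt (EuclideanSpace ℝ (Fin n)) V y).continuousLinearEquivAt ℝ y
    (FiberBundle.mem_baseSet_trivializationAt' y)).toLinearEquiv.finrank_eq]
  simp

theorem finiteDimensional_fiber (n : ℕ) {N : Type*} [TopologicalSpace N] {V : N → Type*}
    [TopologicalSpace (TotalSpace (EuclideanSpace ℝ (Fin n)) V)] [∀ x, NormedAddCommGroup (V x)]
    [∀ x, InnerProductSpace ℝ (V x)]
    [FiberBundle (EuclideanSpace ℝ (Fin n)) V] [VectorBundle ℝ (EuclideanSpace ℝ (Fin n)) V]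
    (y : N) : FiniteDimensional ℝ (V y) :=
  ((trivializationAt (EuclideanSpace ℝ (Fin n)) V y).continuousLinearEquivAt ℝ y
    (FiberBundle.mem_baseSet_trivializationAt' y)).toLinearEquiv.symm.finiteDimensional

end OrthonormalFrames

/-! ### The orthogonal complement of a unit section as a smooth Riemannian bundle -/

section PerpBundle

open Filter
open scoped Topology

set_option linter.unusedSectionVars false

variable {E : Type*} [NormedAddCommGroup E] [NormedSpace ℝ E]
  {H : Type*} [TopologicalSpace H] {I : ModelWithCorners ℝ E H}
  {M : Type*} [TopologicalSpace M] [ChartedSpace H M]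
  {E' : Type*} [NormedAddCommGroup E'] [NormedSpace ℝ E'] [FiniteDimensional ℝ E']
  {H' : Type*} [TopologicalSpace H'] {J : ModelWithCorners ℝ E' H'}
  {N : Type*} [TopologicalSpace N] [T2Space N] [ChartedSpace H' N] [IsManifold J ∞ N]
  {m : ℕ} {V : N → Type*}
  [TopologicalSpace (TotalSpace (EuclideanSpace ℝ (Fin (m + 1))) V)]
  [∀ x, NormedAddCommGroup (V x)] [∀ x, InnerProductSpace ℝ (V x)]
  [FiberBundle (EuclideanSpace ℝ (Fin (m + 1))) V]
  [VectorBundle ℝ (EuclideanSpace ℝ (Fin (m + 1))) V]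
  [ContMDiffVectorBundle ∞ (EuclideanSpace ℝ (Fin (m + 1))) V J]
  [IsContMDiffRiemannianBundle J ∞ (EuclideanSpace ℝ (Fin (m + 1))) V]
  {f : M → N} {ν : Π p, V (f p)}

theorem mdifferentiableAt_pi_space {ι : Type*} [Fintype ι] {g : M → ι → ℝ} {p : M} :
    MDifferentiableAt I 𝓘(ℝ, ι → ℝ) g p ↔
      ∀ i, MDifferentiableAt I 𝓘(ℝ, ℝ) (fun q ↦ g q i) p := by
  simp only [mdifferentiableAt_iff, continuousAt_pi, forall_and]
  refine and_congr Iff.rfl ?_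
  rw [differentiableWithinAt_pi]
  rfl

variable (I J m) in
/-- A smooth orthonormal frame, over an open set, of the orthogonal complement of a section `ν`
along `f`. -/
structure PerpFrame (ν : Π p, V (f p)) where
  /-- The domain of the frame. -/
  baseSet : Set M
  isOpen_baseSet : IsOpen baseSet
  /-- The members of the frame. -/
  frame : Fin m → Π p, ↥((Submodule.span ℝ {ν p})ᗮ)
  contMDiffAt_frame : ∀ i, ∀ p ∈ baseSet,
    ContMDiffAt I (J.prod 𝓘(ℝ, EuclideanSpace ℝ (Fin (m + 1)))) ∞
      (fun q ↦ TotalSpace.mk' (EuclideanSpace ℝ (Fin (m + 1))) (f q) (frame i q : V (f q))) p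
  orthonormal : ∀ p ∈ baseSet, Orthonormal ℝ (fun i ↦ frame i p)
  finrank_eq : ∀ p ∈ baseSet, Module.finrank ℝ ↥((Submodule.span ℝ {ν p})ᗮ) = m

/-- An orthonormal basis of the complement at `p₀` is extended to fields on `N`, pulled back along
`f`, made orthogonal to `ν`, and orthonormalized near `p₀`. -/
theorem exists_perpFrame (hf : ContMDiff I J ∞ f)
    (hν : ContMDiff I (J.prod 𝓘(ℝ, EuclideanSpace ℝ (Fin (m + 1)))) ∞
      (fun q ↦ TotalSpace.mk' (EuclideanSpace ℝ (Fin (m + 1))) (f q) (ν q)))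
    (hunit : ∀ p, inner ℝ (ν p) (ν p) = (1 : ℝ)) (p₀ : M) :
    ∃ s : PerpFrame I J m ν, p₀ ∈ s.baseSet := by
  classical
  have hν0 (p : M) : ν p ≠ 0 := fun h ↦ by simpa [h] using hunit p
  have hrank (p : M) : Module.finrank ℝ ↥((Submodule.span ℝ {ν p})ᗮ) = m := by
    have : Fact (Module.finrank ℝ (V (f p)) = m + 1) := ⟨finrank_fiber (f p)⟩
    exact Submodule.finrank_orthogonal_span_singleton (hν0 p)
  have := finiteDimensional_fiber (m + 1) (V := V) (f p₀)
  let b := (stdOrthonormalBasis ℝ ↥((Submodule.span ℝ {ν p₀})ᗮ)).reindex (finCongr (hrank p₀))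
  have hext (i : Fin m) : ∃ Z : Π y, V y,
      ContMDiff J (J.prod 𝓘(ℝ, EuclideanSpace ℝ (Fin (m + 1)))) ∞
        (fun y ↦ TotalSpace.mk' (EuclideanSpace ℝ (Fin (m + 1))) y (Z y)) ∧
      Z (f p₀) = b i := by
    obtain ⟨u, hu, hu'⟩ := FiberBundle.exists_contMDiffOn_extend (k := ∞) J
      (EuclideanSpace ℝ (Fin (m + 1))) (b i : V (f p₀))
    obtain ⟨Z, hZ, hZ'⟩ := exists_contMDiff_section_eventuallyEq hu hu'
    exact ⟨Z, hZ, by rw [hZ'.self_of_nhds, FiberBundle.extend_apply_self]⟩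
  choose Z hZ hZ' using hext
  have hbν (i : Fin m) : (inner ℝ (ν p₀) (b i : V (f p₀)) : ℝ) = 0 :=
    Submodule.mem_orthogonal_singleton_iff_inner_right.1 (b i).2
  obtain ⟨u, hu, hpu, s, hs₀, hs, hon, hw⟩ := exists_orthonormal_along (p₀ := p₀) hf
    (z := fun i p ↦ Z i (f p) - (inner ℝ (ν p) (Z i (f p)) : ℝ) • ν p)
    (fun i p ↦ by
      have h : ContMDiffAt I (J.prod 𝓘(ℝ, EuclideanSpace ℝ (Fin (m + 1)))) ∞
        (fun q ↦ TotalSpace.mk' (EuclideanSpace ℝ (Fin (m + 1))) (f q) (Z i (f q))) p :=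
        (hZ i (f p)).comp p (hf p)
      exact h.sub_along (ContMDiffAt.smul_along (ContMDiffAt.inner_bundle (hν p) h) (hν p)))
    (by
      simp only [hZ', hbν, zero_smul, sub_zero]
      exact b.orthonormal.comp_linearIsometry (Submodule.subtypeₗᵢ _))
  -- Gram-Schmidt preserves orthogonality to any vector orthogonal to all the input fields; here
  -- that vector is `ν p`.
  have hmem (p : M) (hp : p ∈ u) (i : Fin m) : s i p ∈ (Submodule.span ℝ {ν p})ᗮ := by
    rw [Submodule.mem_orthogonal_singleton_iff_inner_left]
    refine hw p hp (ν p) (fun i ↦ ?_) i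
    rw [inner_sub_left, inner_smul_left, hunit, real_inner_comm]
    simp
  -- The value zero is a default outside `u`, where membership in the complement may fail.
  let t : Fin m → Π p, ↥((Submodule.span ℝ {ν p})ᗮ) := fun i p ↦
    if h : s i p ∈ (Submodule.span ℝ {ν p})ᗮ then ⟨s i p, h⟩ else 0
  have ht (p : M) (hp : p ∈ u) (i : Fin m) : (t i p : V (f p)) = s i p := by
    simp [t, hmem p hp i]
  refine ⟨⟨u, hu, t, fun i p hp ↦ (hs i p hp).congr_of_eventuallyEq ?_, fun p hp ↦ ?_,
    fun p _ ↦ hrank p⟩, hpu⟩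
  · filter_upwards [hu.mem_nhds hp] with q hq
    rw [ht q hq i]
  · have h := hon p hp
    rw [orthonormal_iff_ite] at h ⊢
    intro i j
    rw [Submodule.coe_inner, ht p hp, ht p hp, h]

namespace PerpFrame

variable (s t : PerpFrame I J m ν) {p : M}

/-- The orthonormal basis given by a frame at a point of its domain. -/
def basis (hp : p ∈ s.baseSet) : OrthonormalBasis (Fin m) ℝ ↥((Submodule.span ℝ {ν p})ᗮ) :=
  have : FiniteDimensional ℝ (V (f p)) := finiteDimensional_fiber (m + 1) (f p)
  OrthonormalBasis.mk (s.orthonormal p hp) (by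
    rw [(s.orthonormal p hp).linearIndependent.span_eq_top_of_card_eq_finrank'
      (by simp [s.finrank_eq p hp])])

theorem basis_apply (hp : p ∈ s.baseSet) (i : Fin m) : s.basis hp i = s.frame i p := by
  simp [basis]

/-- The coordinates of a vector with respect to a frame. -/
def coord (p : M) (w : ↥((Submodule.span ℝ {ν p})ᗮ)) : EuclideanSpace ℝ (Fin m) :=
  WithLp.toLp 2 fun i ↦ inner ℝ (s.frame i p) w

theorem coord_eq_repr (hp : p ∈ s.baseSet) (w : ↥((Submodule.span ℝ {ν p})ᗮ)) :
    s.coord p w = (s.basis hp).repr w := by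
  ext i
  simp [coord, OrthonormalBasis.repr_apply_apply, basis_apply]

theorem sum_coord (hp : p ∈ s.baseSet) (w : ↥((Submodule.span ℝ {ν p})ᗮ)) :
    ∑ i, s.coord p w i • s.frame i p = w := by
  conv_rhs => rw [← (s.basis hp).sum_repr w]
  simp only [s.coord_eq_repr hp, basis_apply]

theorem coord_sum (hp : p ∈ s.baseSet) (a : EuclideanSpace ℝ (Fin m)) :
    s.coord p (∑ i, a i • s.frame i p) = a := by
  ext i
  simp only [coord]
  rw [(s.orthonormal p hp).inner_right_fintype]

/-- The pretrivialization of the orthogonal complement of `ν` given by a frame. -/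
def pretrivialization : Pretrivialization (EuclideanSpace ℝ (Fin m))
    (π (EuclideanSpace ℝ (Fin m)) fun p ↦ ↥((Submodule.span ℝ {ν p})ᗮ)) where
  toFun z := (z.1, s.coord z.1 z.2)
  invFun z := ⟨z.1, ∑ i, z.2 i • s.frame i z.1⟩
  source := TotalSpace.proj ⁻¹' s.baseSet
  target := s.baseSet ×ˢ Set.univ
  map_source' _ hz := ⟨hz, trivial⟩
  map_target' _ hz := hz.1
  left_inv' z hz := by rw [s.sum_coord hz]
  right_inv' z hz := by rw [s.coord_sum hz.1]
  open_target := s.isOpen_baseSet.prod isOpen_univ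
  baseSet := s.baseSet
  open_baseSet := s.isOpen_baseSet
  source_eq := rfl
  target_eq := rfl
  proj_toFun _ _ := rfl

theorem pretrivialization_symm (hp : p ∈ s.baseSet) (a : EuclideanSpace ℝ (Fin m)) :
    s.pretrivialization.symm p a = ∑ i, a i • s.frame i p := by
  rw [Pretrivialization.symm_apply _ (by exact hp)]
  rfl

/-- The transition matrix between two frames. -/
def transition (p : M) : EuclideanSpace ℝ (Fin m) →L[ℝ] EuclideanSpace ℝ (Fin m) :=
  ∑ i, ∑ j, (inner ℝ (t.frame j p) (s.frame i p) : ℝ) •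
    (EuclideanSpace.proj (𝕜 := ℝ) i).smulRight (EuclideanSpace.single j (1 : ℝ))

theorem transition_apply (hp : p ∈ s.baseSet) (a : EuclideanSpace ℝ (Fin m)) :
    s.transition t p a = t.coord p (s.pretrivialization.symm p a) := by
  rw [s.pretrivialization_symm hp]
  ext k
  simp [transition, coord, inner_sum, inner_smul_right, Finset.sum_apply, Pi.single_apply,
    mul_comm]

theorem contMDiffOn_transition :
    ContMDiffOn I 𝓘(ℝ, EuclideanSpace ℝ (Fin m) →L[ℝ] EuclideanSpace ℝ (Fin m)) ∞
      (s.transition t) (s.baseSet ∩ t.baseSet) := by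
  intro p hp
  refine ContMDiffAt.contMDiffWithinAt ?_
  unfold PerpFrame.transition
  refine ContMDiffAt.sum fun i _ ↦ ContMDiffAt.sum fun j _ ↦ ?_
  have h : ContMDiffAt I 𝓘(ℝ, ℝ) ∞ (fun p ↦ (inner ℝ (t.frame j p) (s.frame i p) : ℝ)) p :=
    ContMDiffAt.inner_bundle (t.contMDiffAt_frame j p hp.2) (s.contMDiffAt_frame i p hp.1)
  exact h.smul contMDiffAt_const

end PerpFrame

/-- The vector prebundle given by all frames of the orthogonal complement of `ν`. -/
def perpPrebundle (s : M → PerpFrame I J m ν) (hs : ∀ p, p ∈ (s p).baseSet) :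
    VectorPrebundle ℝ (EuclideanSpace ℝ (Fin m)) (fun p ↦ ↥((Submodule.span ℝ {ν p})ᗮ)) where
  pretrivializationAtlas := Set.range PerpFrame.pretrivialization
  pretrivialization_linear' := by
    rintro _ ⟨t, rfl⟩
    refine ⟨fun _ _ ↦ ⟨fun v w ↦ ?_, fun a v ↦ ?_⟩⟩
    · ext i
      exact inner_add_right _ _ _
    · ext i
      exact inner_smul_right _ _ _
  pretrivializationAt p := (s p).pretrivialization
  mem_base_pretrivializationAt := hs
  pretrivialization_mem_atlas p := ⟨s p, rfl⟩
  exists_coordChange := by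
    rintro _ ⟨t, rfl⟩ _ ⟨t', rfl⟩
    exact ⟨t.transition t', (t.contMDiffOn_transition t').continuousOn,
      fun _ hp a ↦ t.transition_apply t' hp.1 a⟩
  totalSpaceMk_isInducing p := by
    -- On a fibre the coordinate map is a linear isometry, so the bundle topology induces the norm
    -- topology of the subspace.
    refine Topology.isInducing_const_prod.2 ?_
    have : (fun w ↦ (s p).coord p w) = ((s p).basis (hs p)).repr :=
      funext fun w ↦ (s p).coord_eq_repr (hs p) w
    change Topology.IsInducing (fun w ↦ (s p).coord p w)
    rw [this]
    exact ((s p).basis (hs p)).repr.toHomeomorph.isInducing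

instance perpPrebundle_isContMDiff (s : M → PerpFrame I J m ν) (hs : ∀ p, p ∈ (s p).baseSet) :
    (perpPrebundle s hs).IsContMDiff I ∞ where
  exists_contMDiffCoordChange := by
    rintro _ ⟨t, rfl⟩ _ ⟨t', rfl⟩
    exact ⟨t.transition t', t.contMDiffOn_transition t',
      fun _ hp a ↦ t.transition_apply t' hp.1 a⟩

/-- The orthogonal complement of a smooth unit section `ν` along `f` is a smooth Riemannian vector
bundle, whose sections are differentiable or smooth at a point if and only if they are so as
sections along `f`. -/
theorem exists_perpBundle (hf : ContMDiff I J ∞ f)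
    (hν : ContMDiff I (J.prod 𝓘(ℝ, EuclideanSpace ℝ (Fin (m + 1)))) ∞
      (fun q ↦ TotalSpace.mk' (EuclideanSpace ℝ (Fin (m + 1))) (f q) (ν q)))
    (hunit : ∀ p, inner ℝ (ν p) (ν p) = (1 : ℝ)) :
    ∃ (_ : TopologicalSpace (TotalSpace (EuclideanSpace ℝ (Fin m))
        (fun p ↦ ↥((Submodule.span ℝ {ν p})ᗮ))))
      (_ : FiberBundle (EuclideanSpace ℝ (Fin m)) (fun p ↦ ↥((Submodule.span ℝ {ν p})ᗮ)))
      (_ : VectorBundle ℝ (EuclideanSpace ℝ (Fin m)) (fun p ↦ ↥((Submodule.span ℝ {ν p})ᗮ)))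
      (_ : ContMDiffVectorBundle ∞ (EuclideanSpace ℝ (Fin m))
        (fun p ↦ ↥((Submodule.span ℝ {ν p})ᗮ)) I)
      (_ : IsContMDiffRiemannianBundle I ∞ (EuclideanSpace ℝ (Fin m))
        (fun p ↦ ↥((Submodule.span ℝ {ν p})ᗮ))),
      (∀ (ξ : Π p, ↥((Submodule.span ℝ {ν p})ᗮ)) (p : M),
        ContMDiffAt I (I.prod 𝓘(ℝ, EuclideanSpace ℝ (Fin m))) ∞
          (fun q ↦ TotalSpace.mk' (EuclideanSpace ℝ (Fin m)) q (ξ q)) p ↔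
        ContMDiffAt I (J.prod 𝓘(ℝ, EuclideanSpace ℝ (Fin (m + 1)))) ∞
          (fun q ↦ TotalSpace.mk' (EuclideanSpace ℝ (Fin (m + 1))) (f q) (ξ q : V (f q))) p) ∧
      (∀ (ξ : Π p, ↥((Submodule.span ℝ {ν p})ᗮ)) (p : M),
        MDifferentiableAt I (I.prod 𝓘(ℝ, EuclideanSpace ℝ (Fin m)))
          (fun q ↦ TotalSpace.mk' (EuclideanSpace ℝ (Fin m)) q (ξ q)) p ↔
        MDifferentiableAt I (J.prod 𝓘(ℝ, EuclideanSpace ℝ (Fin (m + 1))))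
          (fun q ↦ TotalSpace.mk' (EuclideanSpace ℝ (Fin (m + 1))) (f q) (ξ q : V (f q))) p) := by
  choose s hs using exists_perpFrame (I := I) hf hν hunit
  let _ := (perpPrebundle s hs).totalSpaceTopology
  let _ := (perpPrebundle s hs).toFiberBundle
  have := (perpPrebundle s hs).toVectorBundle
  have triv (p q : M) (w : ↥((Submodule.span ℝ {ν q})ᗮ)) :
      (trivializationAt (EuclideanSpace ℝ (Fin m)) (fun p ↦ ↥((Submodule.span ℝ {ν p})ᗮ)) p
        ⟨q, w⟩).2 = (s p).coord q w := rfl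
  have coe_eq (ξ : Π p, ↥((Submodule.span ℝ {ν p})ᗮ)) (p : M) :
      ∀ᶠ q in 𝓝 p, (ξ q : V (f q)) =
        ∑ i, (s p).coord q (ξ q) i • ((s p).frame i q : V (f q)) := by
    filter_upwards [(s p).isOpen_baseSet.mem_nhds (hs p)] with q hq
    conv_lhs => rw [← (s p).sum_coord hq (ξ q)]
    simp
  refine ⟨inferInstance, inferInstance, inferInstance,
    (perpPrebundle s hs).contMDiffVectorBundle I, ?_, fun ξ p ↦ ⟨fun h ↦ ?_, fun h ↦ ?_⟩,
    fun ξ p ↦ ⟨fun h ↦ ?_, fun h ↦ ?_⟩⟩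
  · refine ⟨fun p ↦ innerSL ℝ, fun p ↦ ?_, fun p v w ↦ rfl⟩
    rw [contMDiffAt_section]
    -- Read in an orthonormal frame, the fibre metric is the constant standard inner product.
    refine ContMDiffAt.congr_of_eventuallyEq (f := fun _ ↦ (show EuclideanSpace ℝ (Fin m) →L[ℝ]
      EuclideanSpace ℝ (Fin m) →L[ℝ] ℝ from innerSL ℝ)) contMDiffAt_const ?_
    filter_upwards [(s p).isOpen_baseSet.mem_nhds (hs p)] with q hq
    ext v w
    rw [hom_trivializationAt_apply]
    rw [inCoordinates_apply_eq₂ hq hq (Set.mem_univ q)]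
    have hsymm (a : EuclideanSpace ℝ (Fin m)) :
        (trivializationAt (EuclideanSpace ℝ (Fin m)) (fun p ↦ ↥((Submodule.span ℝ {ν p})ᗮ))
          p).symm q a = ((s p).basis hq).repr.symm a := by
      rw [LinearIsometryEquiv.eq_symm_apply, ← (s p).coord_eq_repr hq]
      have h := (s p).pretrivialization_symm hq a
      exact (congrArg _ h).trans ((s p).coord_sum hq a)
    simp only [hsymm, Trivial.fiberBundle_trivializationAt', Trivial.linearMapAt_trivialization,
      LinearMap.id_coe, id_eq]
    exact ((s p).basis hq).repr.symm.inner_map_map v w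
  -- A section is recovered along `f` from its coordinates and the smooth frame; conversely its
  -- coordinates are inner products with the frame. The same two arguments serve for
  -- differentiability below.
  · rw [contMDiffAt_section] at h
    simp only [triv] at h
    refine ContMDiffAt.congr_of_eventuallyEq (ContMDiffAt.sum_along (s := Finset.univ)
      (ζ := fun i q ↦ (s p).coord q (ξ q) i • ((s p).frame i q : V (f q))) (hf p) fun i _ ↦
        ContMDiffAt.smul_along ((EuclideanSpace.proj (𝕜 := ℝ) i).contMDiff.contMDiffAt.comp p h)
          ((s p).contMDiffAt_frame i p (hs p))) ?_
    filter_upwards [coe_eq ξ p] with q hq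
    rw [hq]
  · rw [contMDiffAt_section]
    simp only [triv]
    have h' : ContMDiffAt I 𝓘(ℝ, Fin m → ℝ) ∞
        (fun q i ↦ (inner ℝ ((s p).frame i q : V (f q)) (ξ q : V (f q)) : ℝ)) p :=
      contMDiffAt_pi_space.2 fun i ↦
        ContMDiffAt.inner_bundle ((s p).contMDiffAt_frame i p (hs p)) h
    exact (EuclideanSpace.equiv (Fin m) ℝ).symm.toContinuousLinearMap.contMDiff.contMDiffAt.comp p h'
  · rw [mdifferentiableAt_section] at h
    simp only [triv] at h
    refine MDifferentiableAt.congr_of_eventuallyEq (MDifferentiableAt.sum_along (s := Finset.univ)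
      (ζ := fun i q ↦ (s p).coord q (ξ q) i • ((s p).frame i q : V (f q)))
        ((hf p).mdifferentiableAt (by simp)) fun i _ ↦
        MDifferentiableAt.smul_along ((EuclideanSpace.proj (𝕜 := ℝ) i).mdifferentiableAt.comp p h)
          (((s p).contMDiffAt_frame i p (hs p)).mdifferentiableAt (by simp))) ?_
    filter_upwards [coe_eq ξ p] with q hq
    rw [hq]
  · rw [mdifferentiableAt_section]
    simp only [triv]
    have h' : MDifferentiableAt I 𝓘(ℝ, Fin m → ℝ)
        (fun q i ↦ (inner ℝ ((s p).frame i q : V (f q)) (ξ q : V (f q)) : ℝ)) p :=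
      mdifferentiableAt_pi_space.2 fun i ↦ MDifferentiableAt.inner_bundle
        (((s p).contMDiffAt_frame i p (hs p)).mdifferentiableAt (by simp)) h
    exact (EuclideanSpace.equiv (Fin m) ℝ).symm.toContinuousLinearMap.mdifferentiableAt.comp p h'

end PerpBundle

/-! ### A smoothness criterion for bundle homomorphisms -/

section HomBundle

open Filter
open scoped Topology

set_option linter.unusedSectionVars false

variable {E : Type*} [NormedAddCommGroup E] [NormedSpace ℝ E] [FiniteDimensional ℝ E]
  {H : Type*} [TopologicalSpace H] {I : ModelWithCorners ℝ E H}
  {M : Type*} [TopologicalSpace M] [T2Space M] [ChartedSpace H M] [IsManifold I ∞ M]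
  {n : ℕ} {V : M → Type*}
  [TopologicalSpace (TotalSpace (EuclideanSpace ℝ (Fin n)) V)] [∀ x, AddCommGroup (V x)]
  [∀ x, Module ℝ (V x)] [∀ x, TopologicalSpace (V x)]
  [FiberBundle (EuclideanSpace ℝ (Fin n)) V] [VectorBundle ℝ (EuclideanSpace ℝ (Fin n)) V]
  [ContMDiffVectorBundle ∞ (EuclideanSpace ℝ (Fin n)) V I]
  {F : Type*} [NormedAddCommGroup F] [NormedSpace ℝ F] {W : M → Type*}
  [TopologicalSpace (TotalSpace F W)] [∀ x, AddCommGroup (W x)] [∀ x, Module ℝ (W x)]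
  [∀ x, TopologicalSpace (W x)] [∀ x, IsTopologicalAddGroup (W x)] [∀ x, ContinuousSMul ℝ (W x)]
  [FiberBundle F W] [VectorBundle ℝ F W]

/-- A bundle homomorphism is smooth if it maps global smooth sections to smooth sections. -/
theorem contMDiffAt_hom_of_apply {φ : Π x, V x →L[ℝ] W x} {p : M}
    (hφ : ∀ Z : Π x, V x, ContMDiff I (I.prod 𝓘(ℝ, EuclideanSpace ℝ (Fin n))) ∞
        (fun x ↦ TotalSpace.mk' (EuclideanSpace ℝ (Fin n)) x (Z x)) →
      ContMDiffAt I (I.prod 𝓘(ℝ, F)) ∞ (fun x ↦ TotalSpace.mk' F x (φ x (Z x))) p) :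
    ContMDiffAt I (I.prod 𝓘(ℝ, EuclideanSpace ℝ (Fin n) →L[ℝ] F)) ∞
      (fun x ↦ TotalSpace.mk' (EuclideanSpace ℝ (Fin n) →L[ℝ] F)
        (E := fun x ↦ V x →L[ℝ] W x) x (φ x)) p := by
  rw [contMDiffAt_hom_bundle]
  refine ⟨contMDiffAt_id, ?_⟩
  obtain ⟨Z, hZ, hZ'⟩ := exists_global_frame (n := n) (V := V) I p
  have h (i : Fin n) := (contMDiffAt_section _).1 (hφ (Z i) (hZ i))
  -- In coordinates `φ` is the sum of rank-one maps sending `a` to `aᵢ` times the column `φ(Zᵢ)`,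
  -- and every column is smooth by hypothesis.
  have key : ContMDiffAt I 𝓘(ℝ, EuclideanSpace ℝ (Fin n) →L[ℝ] F) ∞ (fun q ↦ ∑ i : Fin n,
      ContinuousLinearMap.smulRightL ℝ _ _ (EuclideanSpace.proj (𝕜 := ℝ) i)
        ((trivializationAt F W p ⟨q, φ q (Z i q)⟩).2)) p :=
    ContMDiffAt.sum fun i _ ↦
      (ContinuousLinearMap.contMDiff (ContinuousLinearMap.smulRightL ℝ _ F
        (EuclideanSpace.proj (𝕜 := ℝ) i))).contMDiffAt.comp p (h i)
  refine key.congr_of_eventuallyEq ?_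
  filter_upwards [hZ', eventually_mem_baseSet (F := EuclideanSpace ℝ (Fin n)) (V := V)
    (continuousAt_id (x := p)), eventually_mem_baseSet (F := F) (V := W)
    (continuousAt_id (x := p))] with q hq hq1 hq2
  replace hq1 : q ∈ (trivializationAt (EuclideanSpace ℝ (Fin n)) V p).baseSet := hq1
  replace hq2 : q ∈ (trivializationAt F W p).baseSet := hq2
  ext a
  have e : (trivializationAt (EuclideanSpace ℝ (Fin n)) V p).symm q a = ∑ i, a i • Z i q := by
    conv_lhs => rw [hq ((trivializationAt (EuclideanSpace ℝ (Fin n)) V p).symm q a)]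
    simp only [frameCoord]
    rw [Trivialization.apply_mk_symm _ hq1]
  have hL (w : W q) : (trivializationAt F W p).continuousLinearMapAt ℝ q w =
      (trivializationAt F W p ⟨q, w⟩).2 := by
    rw [Trivialization.continuousLinearMapAt_apply, Trivialization.linearMapAt_apply, if_pos hq2]
  simp only [ContinuousLinearMap.inCoordinates, ContinuousLinearMap.comp_apply,
    Trivialization.symmL_apply _ hq1, e, map_sum, map_smul]
  simp [hL]

end HomBundle

/-! ### The induced connection on the normal complement -/

section InducedConnection

open Filter VectorField
open scoped Topology

set_option linter.unusedSectionVars false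
set_option synthInstance.maxHeartbeats 200000

/-- The curvature tensor `(u, w, z) ↦ c (⟨w, z⟩ u - ⟨u, z⟩ w)` of constant curvature `c`. -/
def constantCurvatureTensor {V : Type*} [NormedAddCommGroup V] [InnerProductSpace ℝ V] (c : ℝ) :
    V →ₗ[ℝ] V →ₗ[ℝ] V →ₗ[ℝ] V :=
  LinearMap.mk₂ ℝ (fun u w ↦ c • ((innerₛₗ ℝ w).smulRight u - (innerₛₗ ℝ u).smulRight w))
    (fun u u' w ↦ by ext z; simp; module)
    (fun a u w ↦ by ext z; simp; module)
    (fun u w w' ↦ by ext z; simp; module)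
    (fun a u w ↦ by ext z; simp; module)

theorem constantCurvatureTensor_apply {V : Type*} [NormedAddCommGroup V] [InnerProductSpace ℝ V]
    (c : ℝ) (u w z : V) : constantCurvatureTensor c u w z =
      c • ((inner ℝ w z : ℝ) • u - (inner ℝ u z : ℝ) • w) := by
  simp [constantCurvatureTensor]

variable {m : ℕ}
  {M : Type*} [TopologicalSpace M] [ChartedSpace (EuclideanSpace ℝ (Fin m)) M]
  [IsManifold (𝓡 m) ∞ M]
  {N : Type*} [TopologicalSpace N] [T2Space N]
  [ChartedSpace (EuclideanSpace ℝ (Fin (m + 1))) N] [IsManifold (𝓡 (m + 1)) ∞ N]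
  [RiemannianBundle (fun x : N ↦ TangentSpace (𝓡 (m + 1)) x)]
  [IsContMDiffRiemannianBundle (𝓡 (m + 1)) ∞ (EuclideanSpace ℝ (Fin (m + 1)))
    (fun x : N ↦ TangentSpace (𝓡 (m + 1)) x)]
  {nabla : CovariantDerivative (𝓡 (m + 1)) (EuclideanSpace ℝ (Fin (m + 1)))
    (fun x : N ↦ TangentSpace (𝓡 (m + 1)) x)}
  {f : M → N} {ξ η : Π p : M, TangentSpace (𝓡 (m + 1)) (f p)} {p : M}
  {X Y : Π p : M, TangentSpace (𝓡 m) p}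

/-- `pullbackDerivative` agrees definitionally with `CovariantDerivative.along`, so the general
results transfer as they stand. -/
theorem mvfderiv_inner_pullback (hnabla : IsLeviCivita nabla)
    (hξ : MDifferentiableAt (𝓡 m) (𝓡 (m + 1)).tangent (alongMap f ξ) p)
    (hη : MDifferentiableAt (𝓡 m) (𝓡 (m + 1)).tangent (alongMap f η) p) (v : TangentSpace (𝓡 m) p) :
    mvfderiv (𝓡 m) (fun q ↦ (inner ℝ (ξ q) (η q) : ℝ)) p v =
      inner ℝ (pullbackDerivative nabla f ξ p v) (η p) +
        inner ℝ (ξ p) (pullbackDerivative nabla f η p v) :=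
  hnabla.metric.mvfderiv_inner_along hξ hη v

/-- The covariant derivatives of orthogonal vector fields. -/
theorem inner_pullback_of_inner_eq_zero (hnabla : IsLeviCivita nabla)
    (hξ : MDifferentiableAt (𝓡 m) (𝓡 (m + 1)).tangent (alongMap f ξ) p)
    (hη : MDifferentiableAt (𝓡 m) (𝓡 (m + 1)).tangent (alongMap f η) p)
    {a : ℝ} (h : ∀ q, (inner ℝ (ξ q) (η q) : ℝ) = a) (v : TangentSpace (𝓡 m) p) :
    (inner ℝ (pullbackDerivative nabla f ξ p v) (η p) : ℝ) =
      -inner ℝ (ξ p) (pullbackDerivative nabla f η p v) := by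
  have := mvfderiv_inner_pullback hnabla hξ hη v
  rw [funext h, mvfderiv_const] at this
  simp only [_root_.zero_apply] at this
  linarith

theorem curvature_pullback (hnabla : IsLeviCivita nabla) {c : ℝ} (hc : HasConstantCurvature nabla c)
    (hξ : ContMDiffAt (𝓡 m) (𝓡 (m + 1)).tangent ∞ (alongMap f ξ) p)
    (hX : IsSmoothVectorField X) (hY : IsSmoothVectorField Y) :
    pullbackDerivative nabla f (fun q ↦ pullbackDerivative nabla f ξ q (Y q)) p (X p) -
      pullbackDerivative nabla f (fun q ↦ pullbackDerivative nabla f ξ q (X q)) p (Y p) -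
        pullbackDerivative nabla f ξ p (mlieBracket (𝓡 m) X Y p) =
      c • ((inner ℝ (mfderiv (𝓡 m) (𝓡 (m + 1)) f p (Y p) : TangentSpace (𝓡 (m + 1)) (f p))
          (ξ p) : ℝ) • (mfderiv (𝓡 m) (𝓡 (m + 1)) f p (X p) : TangentSpace (𝓡 (m + 1)) (f p)) -
        (inner ℝ (mfderiv (𝓡 m) (𝓡 (m + 1)) f p (X p) : TangentSpace (𝓡 (m + 1)) (f p))
          (ξ p) : ℝ) • (mfderiv (𝓡 m) (𝓡 (m + 1)) f p (Y p) :
            TangentSpace (𝓡 (m + 1)) (f p))) := by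
  rw [← constantCurvatureTensor_apply]
  exact nabla.curvature_along hnabla.smooth hnabla.torsionFree
    (R := fun y ↦ constantCurvatureTensor c)
    (fun U W Z hU hW hZ y ↦ by
      rw [constantCurvatureTensor_apply]
      exact hc.connectionCurvature_eq hnabla hU hW hZ y) hξ (hX p) (hY p)

theorem contMDiffAt_pullbackDerivative (hnabla : IsLeviCivita nabla)
    (hξ : ContMDiffAt (𝓡 m) (𝓡 (m + 1)).tangent ∞ (alongMap f ξ) p)
    (hX : IsSmoothVectorField X) :
    ContMDiffAt (𝓡 m) (𝓡 (m + 1)).tangent ∞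
      (alongMap f fun q ↦ pullbackDerivative nabla f ξ q (X q)) p :=
  nabla.contMDiffAt_along hnabla.smooth hξ (hX p)

variable {ν : Π p : M, TangentSpace (𝓡 (m + 1)) (f p)}

theorem coe_tangentialPart (hν : IsUnitNormalOn f ν Set.univ) (w : TangentSpace (𝓡 (m + 1)) (f p)) :
    (tangentialPart f ν p w : TangentSpace (𝓡 (m + 1)) (f p)) =
      w - (inner ℝ (ν p) w : ℝ) • ν p := by
  have h1 : ‖ν p‖ = 1 := by
    rw [norm_eq_sqrt_real_inner, hν.unit p trivial, Real.sqrt_one]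
  rw [tangentialPart, Submodule.orthogonalProjectionOnto_orthogonal]
  change w - (Submodule.span ℝ {ν p}).starProjection w = _
  rw [Submodule.starProjection_unit_singleton ℝ h1]

theorem tangentialPart_coe (w : NormalPerp f ν p) :
    tangentialPart f ν p (w : TangentSpace (𝓡 (m + 1)) (f p)) = w :=
  Submodule.orthogonalProjectionOnto_mem_subspace_eq_self w

theorem inner_tangentialPart (w : TangentSpace (𝓡 (m + 1)) (f p)) (z : NormalPerp f ν p) :
    (inner ℝ (tangentialPart f ν p w) z : ℝ) =
      inner ℝ w (z : TangentSpace (𝓡 (m + 1)) (f p)) :=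
  Submodule.inner_orthogonalProjectionOnto_eq_of_mem_right z w

theorem inner_tangentialPart_right (z : NormalPerp f ν p) (w : TangentSpace (𝓡 (m + 1)) (f p)) :
    (inner ℝ z (tangentialPart f ν p w) : ℝ) =
      inner ℝ (z : TangentSpace (𝓡 (m + 1)) (f p)) w :=
  Submodule.inner_orthogonalProjectionOnto_eq_of_mem_left z w

theorem inner_unitNormal (z : NormalPerp f ν p) :
    (inner ℝ (ν p) (z : TangentSpace (𝓡 (m + 1)) (f p)) : ℝ) = 0 :=
  Submodule.mem_orthogonal_singleton_iff_inner_right.1 z.2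

theorem IsUnitNormalOn.contMDiffAt (hν : IsUnitNormalOn f ν Set.univ) (p : M) :
    ContMDiffAt (𝓡 m) (𝓡 (m + 1)).tangent ∞ (alongMap f ν) p :=
  hν.smooth.contMDiffAt univ_mem

theorem IsUnitNormalOn.mdifferentiableAt (hν : IsUnitNormalOn f ν Set.univ) (p : M) :
    MDifferentiableAt (𝓡 m) (𝓡 (m + 1)).tangent (alongMap f ν) p :=
  (hν.contMDiffAt p).mdifferentiableAt (by simp)

/-- Differentiate `⟨ν, ν⟩ = 1`. This is what allows `ψ` to take values in `E_f`. -/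
theorem IsUnitNormalOn.inner_pullbackDerivative (hν : IsUnitNormalOn f ν Set.univ)
    (hnabla : IsLeviCivita nabla) (v : TangentSpace (𝓡 m) p) :
    (inner ℝ (ν p) (pullbackDerivative nabla f ν p v) : ℝ) = 0 := by
  have := inner_pullback_of_inner_eq_zero hnabla (hν.mdifferentiableAt p) (hν.mdifferentiableAt p)
    (fun q ↦ hν.unit q trivial) v
  rw [real_inner_comm] at this
  linarith

theorem contMDiffAt_tangentialPart (hν : IsUnitNormalOn f ν Set.univ)
    (hξ : ContMDiffAt (𝓡 m) (𝓡 (m + 1)).tangent ∞ (alongMap f ξ) p) :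
    ContMDiffAt (𝓡 m) (𝓡 (m + 1)).tangent ∞
      (alongMap f fun q ↦ (tangentialPart f ν q (ξ q) : TangentSpace (𝓡 (m + 1)) (f q))) p := by
  simp only [coe_tangentialPart hν]
  exact ContMDiffAt.sub_along hξ (ContMDiffAt.smul_along
    (ContMDiffAt.inner_bundle (hν.contMDiffAt p) hξ) (hν.contMDiffAt p))

variable [TopologicalSpace (TotalSpace (EuclideanSpace ℝ (Fin m)) (NormalPerp f ν))]
  [FiberBundle (EuclideanSpace ℝ (Fin m)) (NormalPerp f ν)]
  [VectorBundle ℝ (EuclideanSpace ℝ (Fin m)) (NormalPerp f ν)]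
  [ContMDiffVectorBundle ∞ (EuclideanSpace ℝ (Fin m)) (NormalPerp f ν) (𝓡 m)]
  [IsContMDiffRiemannianBundle (𝓡 m) ∞ (EuclideanSpace ℝ (Fin m)) (NormalPerp f ν)]

/-- The sections of `E_f` which are smooth or differentiable at a point are those which are so as
vector fields along `f`. -/
structure HasAlongRegularity (f : M → N) (ν : Π p : M, TangentSpace (𝓡 (m + 1)) (f p))
    [TopologicalSpace (TotalSpace (EuclideanSpace ℝ (Fin m)) (NormalPerp f ν))]
    [FiberBundle (EuclideanSpace ℝ (Fin m)) (NormalPerp f ν)] : Prop where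
  contMDiffAt_iff : ∀ (ξ : Π p : M, NormalPerp f ν p) (p : M),
    ContMDiffAt (𝓡 m) ((𝓡 m).prod 𝓘(ℝ, EuclideanSpace ℝ (Fin m))) ∞
      (fun q ↦ TotalSpace.mk' (EuclideanSpace ℝ (Fin m)) q (ξ q)) p ↔
    ContMDiffAt (𝓡 m) (𝓡 (m + 1)).tangent ∞
      (alongMap f fun q ↦ (ξ q : TangentSpace (𝓡 (m + 1)) (f q))) p
  mdifferentiableAt_iff : ∀ (ξ : Π p : M, NormalPerp f ν p) (p : M),
    MDifferentiableAt (𝓡 m) ((𝓡 m).prod 𝓘(ℝ, EuclideanSpace ℝ (Fin m)))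
      (fun q ↦ TotalSpace.mk' (EuclideanSpace ℝ (Fin m)) q (ξ q)) p ↔
    MDifferentiableAt (𝓡 m) (𝓡 (m + 1)).tangent
      (alongMap f fun q ↦ (ξ q : TangentSpace (𝓡 (m + 1)) (f q))) p

namespace HasAlongRegularity

theorem isSubbundleStructure (hE : HasAlongRegularity f ν) : IsSubbundleStructure f ν := by
  intro U ξ hU
  constructor
  · intro h p hp
    exact ((hE.contMDiffAt_iff ξ p).1 (h.contMDiffAt (hU.mem_nhds hp))).contMDiffWithinAt
  · intro h p hp
    exact ((hE.contMDiffAt_iff ξ p).2 (h.contMDiffAt (hU.mem_nhds hp))).contMDiffWithinAt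

/-- The connection on `E_f` induced by `∇`. -/
def inducedConnection (hE : HasAlongRegularity f ν)
    (nabla : CovariantDerivative (𝓡 (m + 1)) (EuclideanSpace ℝ (Fin (m + 1)))
      (fun x : N ↦ TangentSpace (𝓡 (m + 1)) x)) :
    CovariantDerivative (𝓡 m) (EuclideanSpace ℝ (Fin m)) (NormalPerp f ν) where
  toFun ξ p := inducedDerivative nabla f ν ξ p
  isCovariantDerivativeOnUniv :=
    { add := fun {σ τ x} hσ hτ _ ↦ by
        have h := nabla.along_add ((hE.mdifferentiableAt_iff σ x).1 hσ)
          ((hE.mdifferentiableAt_iff τ x).1 hτ)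
        change (tangentialPart f ν x).comp (nabla.along f (fun q ↦
          (σ q : TangentSpace (𝓡 (m + 1)) (f q)) + (τ q : TangentSpace (𝓡 (m + 1)) (f q))) x) = _
        rw [h, ContinuousLinearMap.comp_add]
        rfl
      leibniz := fun {σ g x} hσ hg _ ↦ by
        have h := nabla.along_smul hg ((hE.mdifferentiableAt_iff σ x).1 hσ)
        change (tangentialPart f ν x).comp (nabla.along f (fun q ↦
          g q • (σ q : TangentSpace (𝓡 (m + 1)) (f q))) x) = _
        rw [h, ContinuousLinearMap.comp_add, ContinuousLinearMap.comp_smul]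
        congr 1
        ext1 v
        simp only [ContinuousLinearMap.comp_apply, ContinuousLinearMap.smulRight_apply, map_smul]
        rw [tangentialPart_coe] }

variable (hE : HasAlongRegularity f ν)
include hE

theorem inducedConnection_apply (ξ : Π p : M, NormalPerp f ν p) (p : M) (v : TangentSpace (𝓡 m) p) :
    hE.inducedConnection nabla ξ p v = tangentialPart f ν p
      (pullbackDerivative nabla f (fun q ↦ (ξ q : TangentSpace (𝓡 (m + 1)) (f q))) p v) := rfl

/-- The projection is invisible in inner products with sections of `E_f`, so metric compatibility is
inherited from the pull-back. -/
theorem isMetricCompatible (hnabla : IsLeviCivita nabla) :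
    (hE.inducedConnection nabla).IsMetricCompatible := by
  rw [CovariantDerivative.isMetricCompatible_iff]
  intro x X σ τ _ hσ hτ
  have h := mvfderiv_inner_pullback hnabla ((hE.mdifferentiableAt_iff σ x).1 hσ)
    ((hE.mdifferentiableAt_iff τ x).1 hτ) (X x)
  exact h.trans (congrArg₂ (· + ·) (inner_tangentialPart _ _).symm
    (inner_tangentialPart_right _ _).symm)

end HasAlongRegularity

end InducedConnection

/-! ### The Codazzi equations, the symmetry condition and the Gauss equation -/

section FrontalBundle

open Filter VectorField
open scoped Topology

set_option linter.unusedSectionVars false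
set_option synthInstance.maxHeartbeats 200000

variable {m : ℕ}
  {M : Type*} [TopologicalSpace M] [T2Space M] [ChartedSpace (EuclideanSpace ℝ (Fin m)) M]
  [IsManifold (𝓡 m) ∞ M]
  {N : Type*} [TopologicalSpace N] [T2Space N]
  [ChartedSpace (EuclideanSpace ℝ (Fin (m + 1))) N] [IsManifold (𝓡 (m + 1)) ∞ N]
  [RiemannianBundle (fun x : N ↦ TangentSpace (𝓡 (m + 1)) x)]
  [IsContMDiffRiemannianBundle (𝓡 (m + 1)) ∞ (EuclideanSpace ℝ (Fin (m + 1)))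
    (fun x : N ↦ TangentSpace (𝓡 (m + 1)) x)]
  {nabla : CovariantDerivative (𝓡 (m + 1)) (EuclideanSpace ℝ (Fin (m + 1)))
    (fun x : N ↦ TangentSpace (𝓡 (m + 1)) x)}
  {f : M → N} {ν : Π p : M, TangentSpace (𝓡 (m + 1)) (f p)}

theorem pullbackDerivative_add_smul {ξ η : Π p : M, TangentSpace (𝓡 (m + 1)) (f p)} {g : M → ℝ}
    {p : M} (hξ : MDifferentiableAt (𝓡 m) (𝓡 (m + 1)).tangent (alongMap f ξ) p)
    (hg : MDifferentiableAt (𝓡 m) 𝓘(ℝ, ℝ) g p)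
    (hη : MDifferentiableAt (𝓡 m) (𝓡 (m + 1)).tangent (alongMap f η) p)
    (v : TangentSpace (𝓡 m) p) :
    pullbackDerivative nabla f (fun q ↦ ξ q + g q • η q) p v =
      pullbackDerivative nabla f ξ p v +
        (g p • pullbackDerivative nabla f η p v + mvfderiv (𝓡 m) g p v • η p) := by
  change nabla.along f (fun q ↦ ξ q + g q • η q) p v = _
  rw [nabla.along_add hξ (MDifferentiableAt.smul_along hg hη), nabla.along_smul hg hη]
  rfl

/-- Differentiating `⟨df(X), ν⟩ = 0` gives `⟨∇_Y df(X), ν⟩ = -⟨df(X), ∇_Y ν⟩`; the left side is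
symmetric in `X` and `Y` because `df([X,Y])` is orthogonal to `ν`. -/
theorem inner_mfderiv_pullbackDerivative_symm (hnabla : IsLeviCivita nabla)
    (hf : ContMDiff (𝓡 m) (𝓡 (m + 1)) ∞ f) (hν : IsUnitNormalOn f ν Set.univ) (p : M)
    (v w : TangentSpace (𝓡 m) p) :
    (inner ℝ (mfderiv (𝓡 m) (𝓡 (m + 1)) f p v : TangentSpace (𝓡 (m + 1)) (f p))
      (pullbackDerivative nabla f ν p w) : ℝ) =
    inner ℝ (mfderiv (𝓡 m) (𝓡 (m + 1)) f p w : TangentSpace (𝓡 (m + 1)) (f p))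
      (pullbackDerivative nabla f ν p v) := by
  obtain ⟨X, hX, rfl⟩ := exists_contMDiff_vectorField v
  obtain ⟨Y, hY, rfl⟩ := exists_contMDiff_vectorField w
  have key {A : Π p : M, TangentSpace (𝓡 m) p} (hA : IsSmoothVectorField A)
      (v : TangentSpace (𝓡 m) p) :=
    inner_pullback_of_inner_eq_zero (p := p) hnabla
      (ξ := fun q ↦ mfderiv (𝓡 m) (𝓡 (m + 1)) f q (A q)) (η := ν)
      (((hf p).mfderiv_along (hA p)).mdifferentiableAt (by simp)) (hν.mdifferentiableAt p)
      (fun q ↦ hν.normal q trivial (A q)) v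
  have h1 := key hX (Y p)
  have h2 := key hY (X p)
  have h3 := nabla.along_mfderiv_sub hnabla.torsionFree (hf p) (hX p) (hY p)
  have h4 := hν.normal p trivial (mlieBracket (𝓡 m) X Y p)
  have h5 := (congrArg (fun z : TangentSpace (𝓡 (m + 1)) (f p) ↦ (inner ℝ z (ν p) : ℝ)) h3).trans h4
  have h6 : (inner ℝ (pullbackDerivative nabla f
        (fun q ↦ mfderiv (𝓡 m) (𝓡 (m + 1)) f q (Y q)) p (X p)) (ν p) : ℝ) -
      inner ℝ (pullbackDerivative nabla f
        (fun q ↦ mfderiv (𝓡 m) (𝓡 (m + 1)) f q (X q)) p (Y p)) (ν p) = 0 := by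
    rw [← inner_sub_left]
    exact h5
  linarith

variable [TopologicalSpace (TotalSpace (EuclideanSpace ℝ (Fin m)) (NormalPerp f ν))]
  [FiberBundle (EuclideanSpace ℝ (Fin m)) (NormalPerp f ν)]
  [VectorBundle ℝ (EuclideanSpace ℝ (Fin m)) (NormalPerp f ν)]
  [ContMDiffVectorBundle ∞ (EuclideanSpace ℝ (Fin m)) (NormalPerp f ν) (𝓡 m)]
  [IsContMDiffRiemannianBundle (𝓡 m) ∞ (EuclideanSpace ℝ (Fin m)) (NormalPerp f ν)]

namespace HasAlongRegularity

variable (hE : HasAlongRegularity f ν)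
include hE

theorem contMDiffCovariantDerivative (hnabla : IsLeviCivita nabla)
    (hν : IsUnitNormalOn f ν Set.univ) :
    (hE.inducedConnection nabla).ContMDiffCovariantDerivative ∞ := by
  refine ⟨⟨fun {σ} hσ p _ ↦ ContMDiffAt.contMDiffWithinAt ?_⟩⟩
  refine contMDiffAt_hom_of_apply (V := fun p : M ↦ TangentSpace (𝓡 m) p) fun Z hZ ↦ ?_
  rw [hE.contMDiffAt_iff]
  have h1 := (hE.contMDiffAt_iff σ p).1 (hσ.contMDiffAt univ_mem)
  exact contMDiffAt_tangentialPart hν (contMDiffAt_pullbackDerivative hnabla h1 hZ)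

theorem isSmoothBundleHom {θ : Π p : M, TangentSpace (𝓡 m) p →L[ℝ] NormalPerp f ν p}
    (hθ : ∀ Z : Π p : M, TangentSpace (𝓡 m) p, IsSmoothVectorField Z → ∀ p,
      ContMDiffAt (𝓡 m) (𝓡 (m + 1)).tangent ∞
        (alongMap f fun q ↦ (θ q (Z q) : TangentSpace (𝓡 (m + 1)) (f q))) p) :
    IsSmoothBundleHom m m θ := fun p ↦
  contMDiffAt_hom_of_apply (V := fun p : M ↦ TangentSpace (𝓡 m) p) fun Z hZ ↦
    (hE.contMDiffAt_iff (fun q ↦ θ q (Z q)) p).2 (hθ Z hZ p)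

variable {φ ψ : Π p : M, TangentSpace (𝓡 m) p →L[ℝ] NormalPerp f ν p}

/-- The Codazzi equation is the tangential part of the torsion identity along `f`. -/
theorem isCoherentTangentBundle_fst (hnabla : IsLeviCivita nabla)
    (hf : ContMDiff (𝓡 m) (𝓡 (m + 1)) ∞ f) (hν : IsUnitNormalOn f ν Set.univ)
    (hφ : ∀ p v, (φ p v : TangentSpace (𝓡 (m + 1)) (f p)) = mfderiv (𝓡 m) (𝓡 (m + 1)) f p v) :
    IsCoherentTangentBundle (hE.inducedConnection nabla) φ where
  smooth_connection := hE.contMDiffCovariantDerivative hnabla hν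
  metric := hE.isMetricCompatible hnabla
  smooth_hom := hE.isSmoothBundleHom fun Z hZ p ↦ by
    simp only [hφ]
    exact (hf p).mfderiv_along (hZ p)
  codazzi X Y hX hY p := by
    have h := nabla.along_mfderiv_sub hnabla.torsionFree (hf p) (hX p) (hY p)
    rw [← tangentialPart_coe (φ p _), hE.inducedConnection_apply, hE.inducedConnection_apply]
    simp only [hφ]
    rw [← map_sub, ← map_sub, ← h]
    exact (congrArg _ (sub_self _)).trans (map_zero _)

/-- Here constant curvature is essential: the curvature applied to `ν` is a combination of `df(X)`
and `df(Y)` with coefficients `⟨df(Y), ν⟩` and `⟨df(X), ν⟩`, which vanish. -/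
theorem isCoherentTangentBundle_snd (hnabla : IsLeviCivita nabla) {c : ℝ}
    (hc : HasConstantCurvature nabla c) (hν : IsUnitNormalOn f ν Set.univ)
    (hψ : ∀ p v, (ψ p v : TangentSpace (𝓡 (m + 1)) (f p)) = pullbackDerivative nabla f ν p v) :
    IsCoherentTangentBundle (hE.inducedConnection nabla) ψ where
  smooth_connection := hE.contMDiffCovariantDerivative hnabla hν
  metric := hE.isMetricCompatible hnabla
  smooth_hom := hE.isSmoothBundleHom fun Z hZ p ↦ by
    simp only [hψ]
    exact contMDiffAt_pullbackDerivative hnabla (hν.contMDiffAt p) hZ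
  codazzi X Y hX hY p := by
    have h := curvature_pullback hnabla hc (hν.contMDiffAt p) hX hY
    rw [hν.normal p trivial, hν.normal p trivial, zero_smul, zero_smul, sub_zero, smul_zero] at h
    rw [← tangentialPart_coe (ψ p _), hE.inducedConnection_apply, hE.inducedConnection_apply]
    simp only [hψ]
    rw [← map_sub, ← map_sub, h, map_zero]

set_option maxHeartbeats 800000 in
theorem gaussEquation (hnabla : IsLeviCivita nabla) {c : ℝ}
    (hc : HasConstantCurvature nabla c) (hν : IsUnitNormalOn f ν Set.univ)
    (hφ : ∀ p v, (φ p v : TangentSpace (𝓡 (m + 1)) (f p)) = mfderiv (𝓡 m) (𝓡 (m + 1)) f p v)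
    (hψ : ∀ p v, (ψ p v : TangentSpace (𝓡 (m + 1)) (f p)) = pullbackDerivative nabla f ν p v) :
    GaussEquation c (hE.inducedConnection nabla) φ ψ := by
  intro X Y ξ ζ hX hY hξ _ p
  have hξ' (q : M) := (hE.contMDiffAt_iff ξ q).1 (hξ.contMDiffAt univ_mem)
  -- The Gauss formula: the normal component of `∇_Z ξ` is `-⟨ψ(Z), ξ⟩`, by differentiating `⟨ν, ξ⟩
  -- = 0`.
  have hD (Z : Π p : M, TangentSpace (𝓡 m) p) (q : M) :
      (hE.inducedConnection nabla ξ q (Z q) : TangentSpace (𝓡 (m + 1)) (f q)) =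
        pullbackDerivative nabla f (fun q ↦ (ξ q : TangentSpace (𝓡 (m + 1)) (f q))) q (Z q) +
          (inner ℝ (ψ q (Z q)) (ξ q) : ℝ) • ν q := by
    have h := inner_pullback_of_inner_eq_zero hnabla (hν.mdifferentiableAt q)
      ((hξ' q).mdifferentiableAt (by simp)) (fun q ↦ inner_unitNormal (ξ q)) (Z q)
    rw [hE.inducedConnection_apply, coe_tangentialPart hν, Submodule.coe_inner, hψ, h]
    module
  -- Differentiating the Gauss formula once more, the derivative of the coefficient multiplies `ν`
  -- and drops out against `ζ`; the derivative of `ν` contributes the product of `ψ` terms.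
  have hDD {A B : Π p : M, TangentSpace (𝓡 m) p} (hA : IsSmoothVectorField A)
      (hB : IsSmoothVectorField B) :
      (inner ℝ (hE.inducedConnection nabla (fun q ↦ hE.inducedConnection nabla ξ q (B q)) p
        (A p)) (ζ p) : ℝ) =
      inner ℝ (pullbackDerivative nabla f (fun q ↦ pullbackDerivative nabla f
        (fun q ↦ (ξ q : TangentSpace (𝓡 (m + 1)) (f q))) q (B q)) p (A p))
          (ζ p : TangentSpace (𝓡 (m + 1)) (f p)) +
        inner ℝ (ψ p (B p)) (ξ p) * inner ℝ (ψ p (A p)) (ζ p) := by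
    have h1 := (contMDiffAt_pullbackDerivative hnabla (hξ' p) hB).mdifferentiableAt
      (by simp)
    have h2 : MDifferentiableAt (𝓡 m) 𝓘(ℝ, ℝ) (fun q ↦ (inner ℝ (ψ q (B q)) (ξ q) : ℝ)) p := by
      have : ContMDiffAt (𝓡 m) 𝓘(ℝ, ℝ) ∞ (fun q ↦ (inner ℝ (pullbackDerivative nabla f ν q (B q))
          (ξ q : TangentSpace (𝓡 (m + 1)) (f q)) : ℝ)) p :=
        ContMDiffAt.inner_bundle (contMDiffAt_pullbackDerivative hnabla (hν.contMDiffAt p) hB)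
          (hξ' p)
      simp only [← hψ] at this
      exact this.mdifferentiableAt (by simp)
    have h6 : pullbackDerivative nabla f (fun q ↦ pullbackDerivative nabla f
        (fun q ↦ (ξ q : TangentSpace (𝓡 (m + 1)) (f q))) q (B q) +
          (inner ℝ (ψ q (B q)) (ξ q) : ℝ) • ν q) p (A p) =
        pullbackDerivative nabla f (fun q ↦ pullbackDerivative nabla f
          (fun q ↦ (ξ q : TangentSpace (𝓡 (m + 1)) (f q))) q (B q)) p (A p) +
        ((inner ℝ (ψ p (B p)) (ξ p) : ℝ) • pullbackDerivative nabla f ν p (A p) +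
          mvfderiv (𝓡 m) (fun q ↦ (inner ℝ (ψ q (B q)) (ξ q) : ℝ)) p (A p) • ν p) :=
      pullbackDerivative_add_smul h1 h2 (hν.mdifferentiableAt p) (A p)
    rw [hE.inducedConnection_apply, inner_tangentialPart]
    simp only [hD]
    rw [h6, inner_add_left, inner_add_left, inner_smul_left, inner_smul_left, inner_unitNormal,
      ← hψ, ← Submodule.coe_inner]
    simp
  -- Antisymmetrizing `hDD` yields the `ψ` determinant, and the ambient curvature paired with `ζ`
  -- yields `c` times the `φ` determinant.
  have hR := curvature_pullback hnabla hc (hξ' p) hX hY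
  have hR' := congrArg (fun w ↦ (inner ℝ w (ζ p : TangentSpace (𝓡 (m + 1)) (f p)) : ℝ)) hR
  simp only [inner_sub_left, inner_smul_left, conj_trivial, ← hφ, ← Submodule.coe_inner] at hR'
  rw [connectionCurvature, inner_sub_left, inner_sub_left, hDD hX hY, hDD hY hX,
    hE.inducedConnection_apply ξ, inner_tangentialPart, Matrix.det_fin_two_of,
    Matrix.det_fin_two_of]
  linarith

/-- The data induced by a frontal form a frontal bundle. -/
theorem isFrontalBundle (hnabla : IsLeviCivita nabla) {c : ℝ}
    (hc : HasConstantCurvature nabla c) (hf : ContMDiff (𝓡 m) (𝓡 (m + 1)) ∞ f)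
    (hν : IsUnitNormalOn f ν Set.univ)
    (hφ : ∀ p v, (φ p v : TangentSpace (𝓡 (m + 1)) (f p)) = mfderiv (𝓡 m) (𝓡 (m + 1)) f p v)
    (hψ : ∀ p v, (ψ p v : TangentSpace (𝓡 (m + 1)) (f p)) = pullbackDerivative nabla f ν p v) :
    IsFrontalBundle (hE.inducedConnection nabla) φ ψ where
  coherent_fst := hE.isCoherentTangentBundle_fst hnabla hf hν hφ
  coherent_snd := hE.isCoherentTangentBundle_snd hnabla hc hν hψ
  compatible p v w := by
    rw [Submodule.coe_inner, Submodule.coe_inner, hφ, hφ, hψ, hψ]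
    exact inner_mfderiv_pullbackDerivative_symm hnabla hf hν p v w

end HasAlongRegularity

end FrontalBundle

/-! ### Orientability of the normal complement -/

section Orientation

open Filter
open scoped Topology

set_option linter.unusedSectionVars false
set_option synthInstance.maxHeartbeats 200000

/-- A field of multilinear forms which is smooth on global smooth sections is smooth on smooth
sections along a map. -/
theorem ContMDiffAt.multilinear_along
    {E : Type*} [NormedAddCommGroup E] [NormedSpace ℝ E]
    {H : Type*} [TopologicalSpace H] {I : ModelWithCorners ℝ E H}
    {M : Type*} [TopologicalSpace M] [ChartedSpace H M]
    {E' : Type*} [NormedAddCommGroup E'] [NormedSpace ℝ E'] [FiniteDimensional ℝ E']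
    {H' : Type*} [TopologicalSpace H'] {J : ModelWithCorners ℝ E' H'}
    {N : Type*} [TopologicalSpace N] [T2Space N] [ChartedSpace H' N] [IsManifold J ∞ N]
    {n : ℕ} {V : N → Type*}
    [TopologicalSpace (TotalSpace (EuclideanSpace ℝ (Fin n)) V)] [∀ x, AddCommGroup (V x)]
    [∀ x, Module ℝ (V x)] [∀ x, TopologicalSpace (V x)]
    [FiberBundle (EuclideanSpace ℝ (Fin n)) V] [VectorBundle ℝ (EuclideanSpace ℝ (Fin n)) V]
    [ContMDiffVectorBundle ∞ (EuclideanSpace ℝ (Fin n)) V J]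
    {k : ℕ} {μ : Π y : N, MultilinearMap ℝ (fun _ : Fin k ↦ V y) ℝ}
    (hμ : ∀ Z : Fin k → Π y, V y,
      (∀ i, ContMDiff J (J.prod 𝓘(ℝ, EuclideanSpace ℝ (Fin n))) ∞
        (fun y ↦ TotalSpace.mk' (EuclideanSpace ℝ (Fin n)) y (Z i y))) →
      ContMDiff J 𝓘(ℝ, ℝ) ∞ fun y ↦ μ y fun i ↦ Z i y)
    {f : M → N} {p : M} (hf : ContMDiffAt I J ∞ f p) {w : Fin k → Π p, V (f p)}
    (hw : ∀ i, ContMDiffAt I (J.prod 𝓘(ℝ, EuclideanSpace ℝ (Fin n))) ∞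
      (fun q ↦ TotalSpace.mk' (EuclideanSpace ℝ (Fin n)) (f q) (w i q)) p) :
    ContMDiffAt I 𝓘(ℝ, ℝ) ∞ (fun q ↦ μ (f q) fun i ↦ w i q) p := by
  obtain ⟨Z, hZ, hZ'⟩ := exists_global_frame (n := n) (V := V) J (f p)
  -- Full multilinear expansion in the frame: `r` chooses one frame member for each argument.
  have key : ContMDiffAt I 𝓘(ℝ, ℝ) ∞ (fun q ↦ ∑ r : Fin k → Fin n,
      (∏ i, _root_.frameCoord n (f p) (w i q) (r i)) * μ (f q) fun i ↦ Z (r i) (f q)) p := by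
    refine ContMDiffAt.sum fun r _ ↦ ContMDiffAt.mul ?_ ?_
    · exact contMDiffAt_finsetProd fun i _ ↦ (hw i).frameCoord (r i)
    · exact (hμ (fun i ↦ Z (r i)) (fun i ↦ hZ (r i)) (f p)).comp p hf
  refine key.congr_of_eventuallyEq ?_
  filter_upwards [hf.continuousAt.eventually hZ'] with q hq
  have h : (fun i ↦ w i q) = fun i ↦ ∑ j, _root_.frameCoord n (f p) (w i q) j • Z j (f q) :=
    funext fun i ↦ hq (w i q)
  rw [h, MultilinearMap.map_sum]
  refine Finset.sum_congr rfl fun r _ ↦ ?_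
  rw [MultilinearMap.map_smul_univ, smul_eq_mul]

variable {m : ℕ}
  {M : Type*} [TopologicalSpace M] [ChartedSpace (EuclideanSpace ℝ (Fin m)) M]
  [IsManifold (𝓡 m) ∞ M]
  {N : Type*} [TopologicalSpace N] [T2Space N]
  [ChartedSpace (EuclideanSpace ℝ (Fin (m + 1))) N] [IsManifold (𝓡 (m + 1)) ∞ N]
  [RiemannianBundle (fun x : N ↦ TangentSpace (𝓡 (m + 1)) x)]
  [IsContMDiffRiemannianBundle (𝓡 (m + 1)) ∞ (EuclideanSpace ℝ (Fin (m + 1)))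
    (fun x : N ↦ TangentSpace (𝓡 (m + 1)) x)]
  {f : M → N} {ν : Π p : M, TangentSpace (𝓡 (m + 1)) (f p)}
  [TopologicalSpace (TotalSpace (EuclideanSpace ℝ (Fin m)) (NormalPerp f ν))]
  [FiberBundle (EuclideanSpace ℝ (Fin m)) (NormalPerp f ν)]

/-- Contract the volume form of `N` with `ν`. Putting `ν` in front of an orthonormal frame of `E_f`
gives an orthonormal frame of `T_{f(p)}N`, so the values are still `±1`. -/
theorem HasAlongRegularity.isOrientableBundle (hE : HasAlongRegularity f ν)
    (hf : ContMDiff (𝓡 m) (𝓡 (m + 1)) ∞ f) (hν : IsUnitNormalOn f ν Set.univ)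
    (hN : IsOrientableBundle (m + 1) (m + 1) (fun x : N ↦ TangentSpace (𝓡 (m + 1)) x)) :
    IsOrientableBundle m m (NormalPerp f ν) := by
  obtain ⟨μ, hμ, hμ'⟩ := hN
  refine ⟨fun p ↦ ((μ (f p)).curryLeft (ν p)).compLinearMap (Submodule.subtype _), ?_, ?_⟩
  · intro U s hU hs p hp
    have h : ContMDiffAt (𝓡 m) 𝓘(ℝ, ℝ) ∞ (fun q ↦ (μ (f q)).toMultilinearMap fun i ↦
        (Fin.cons ν (fun i q ↦ (s i q : TangentSpace (𝓡 (m + 1)) (f q))) :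
          Fin (m + 1) → Π p : M, TangentSpace (𝓡 (m + 1)) (f p)) i q) p := by
      refine ContMDiffAt.multilinear_along (n := m + 1) (V := fun x : N ↦ TangentSpace (𝓡 (m + 1)) x)
        (μ := fun y ↦ (μ y).toMultilinearMap) (fun Z hZ ↦ ?_) (hf p) fun i ↦ ?_
      · exact contMDiffOn_univ.1 (hμ Set.univ Z isOpen_univ fun i ↦ (hZ i).contMDiffOn)
      · refine Fin.cases ?_ (fun i ↦ ?_) i
        · exact hν.contMDiffAt p
        · exact (hE.contMDiffAt_iff (s i) p).1 ((hs i).contMDiffAt (hU.mem_nhds hp))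
    refine ContMDiffAt.contMDiffWithinAt (h.congr_of_eventuallyEq (Eventually.of_forall fun q ↦ ?_))
    refine congrArg (μ (f q)) (funext fun i ↦ ?_)
    refine Fin.cases ?_ (fun i ↦ ?_) i <;> rfl
  · intro p e he
    refine hμ' (f p) _ ?_
    rw [orthonormal_iff_ite] at he ⊢
    intro i j
    induction i using Fin.cases with
    | zero =>
      induction j using Fin.cases with
      | zero => simpa using hν.unit p trivial
      | succ j => simpa [Fin.succ_ne_zero, eq_comm] using inner_unitNormal (e j)
    | succ i =>
      induction j using Fin.cases with
      | zero =>
        have := inner_unitNormal (e i)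
        rw [real_inner_comm] at this
        simpa [Fin.succ_ne_zero] using this
      | succ j => simpa using he i j

end Orientation

/-! ### The differential of a field along a map; comparison of unit normals -/

section Fronts

open Filter
open scoped Topology

set_option linter.unusedSectionVars false
set_option synthInstance.maxHeartbeats 200000

/-- The kernel of the derivative of a map into the total space of a vector bundle. -/
theorem mfderiv_totalSpace_eq_zero_iff
    {E : Type*} [NormedAddCommGroup E] [NormedSpace ℝ E]
    {H : Type*} [TopologicalSpace H] {I : ModelWithCorners ℝ E H}
    {M : Type*} [TopologicalSpace M] [ChartedSpace H M]
    {E' : Type*} [NormedAddCommGroup E'] [NormedSpace ℝ E']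
    {H' : Type*} [TopologicalSpace H'] {J : ModelWithCorners ℝ E' H'}
    {N : Type*} [TopologicalSpace N] [ChartedSpace H' N]
    {F : Type*} [NormedAddCommGroup F] [NormedSpace ℝ F] {V : N → Type*}
    [TopologicalSpace (TotalSpace F V)] [∀ x, AddCommGroup (V x)] [∀ x, Module ℝ (V x)]
    [∀ x, TopologicalSpace (V x)] [FiberBundle F V] [VectorBundle ℝ F V]
    [ContMDiffVectorBundle 1 F V J]
    {A : M → TotalSpace F V} {p : M} (hA : MDifferentiableAt I (J.prod 𝓘(ℝ, F)) A p)
    (v : TangentSpace I p) :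
    mfderiv I (J.prod 𝓘(ℝ, F)) A p v = 0 ↔
      mfderiv I J (fun q ↦ (A q).proj) p v = 0 ∧
        mfderiv I 𝓘(ℝ, F) (fun q ↦ (trivializationAt F V (A p).proj (A q)).2) p v = 0 := by
  set t := trivializationAt F V (A p).proj with ht
  have hA' := (mdifferentiableAt_totalSpace _ _).1 hA
  have hsrc : A p ∈ t.source := FiberBundle.mem_trivializationAt_proj_source
  have hev : ∀ᶠ q in 𝓝 p, A q ∈ t.source :=
    hA.continuousAt.eventually (t.open_source.mem_nhds hsrc)
  -- `G` is `A` read in the trivialization. As the trivialization and its inverse are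
  -- differentiable, `dA` and `dG` have the same kernel, and that of `dG` splits into components.
  let G : M → N × F := fun q ↦ ((A q).proj, (t (A q)).2)
  have hG : MDifferentiableAt I (J.prod 𝓘(ℝ, F)) G p := hA'.1.prodMk hA'.2
  have hGv : mfderiv I (J.prod 𝓘(ℝ, F)) G p v =
      (mfderiv I J (fun q ↦ (A q).proj) p v, mfderiv I 𝓘(ℝ, F) (fun q ↦ (t (A q)).2) p v) := by
    rw [mfderiv_prodMk hA'.1 hA'.2]
    rfl
  have htG : (t ∘ A) =ᶠ[𝓝 p] G := by
    filter_upwards [hev] with q hq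
    exact (t.mk_proj_snd hq).symm
  have hAG : A =ᶠ[𝓝 p] t.toOpenPartialHomeomorph.symm ∘ G := by
    filter_upwards [hev] with q hq
    exact (t.symm_apply_mk_proj hq).symm
  have htA : MDifferentiableAt (J.prod 𝓘(ℝ, F)) (J.prod 𝓘(ℝ, F)) t (A p) :=
    ((t.contMDiffOn (n := 1) (IB := J)).contMDiffAt (t.open_source.mem_nhds hsrc)).mdifferentiableAt
      one_ne_zero
  have hGt : G p ∈ t.target := by
    rw [← htG.self_of_nhds]
    exact t.map_source hsrc
  have htG' : MDifferentiableAt (J.prod 𝓘(ℝ, F)) (J.prod 𝓘(ℝ, F))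
      t.toOpenPartialHomeomorph.symm (G p) :=
    ((t.contMDiffOn_symm (n := 1) (IB := J)).contMDiffAt
      (t.open_target.mem_nhds hGt)).mdifferentiableAt one_ne_zero
  have key : mfderiv I (J.prod 𝓘(ℝ, F)) A p v = 0 ↔ mfderiv I (J.prod 𝓘(ℝ, F)) G p v = 0 := by
    constructor
    · intro h
      have h1 : HasMFDerivAt I (J.prod 𝓘(ℝ, F)) G p _ :=
        (htA.hasMFDerivAt.comp p hA.hasMFDerivAt).congr_of_eventuallyEq htG.symm
      rw [h1.mfderiv]
      exact (congrArg (mfderiv (J.prod 𝓘(ℝ, F)) (J.prod 𝓘(ℝ, F)) t (A p)) h).trans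
        (ContinuousLinearMap.map_zero _)
    · intro h
      have h1 : HasMFDerivAt I (J.prod 𝓘(ℝ, F)) A p _ :=
        (htG'.hasMFDerivAt.comp p hG.hasMFDerivAt).congr_of_eventuallyEq hAG
      rw [h1.mfderiv]
      exact (congrArg (mfderiv (J.prod 𝓘(ℝ, F)) (J.prod 𝓘(ℝ, F)) t.toOpenPartialHomeomorph.symm (G p))
        h).trans (ContinuousLinearMap.map_zero _)
  rw [key, hGv]
  exact Prod.mk_eq_zero

variable {m : ℕ}
  {M : Type*} [TopologicalSpace M] [ChartedSpace (EuclideanSpace ℝ (Fin m)) M]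
  [IsManifold (𝓡 m) ∞ M]
  {N : Type*} [TopologicalSpace N] [T2Space N]
  [ChartedSpace (EuclideanSpace ℝ (Fin (m + 1))) N] [IsManifold (𝓡 (m + 1)) ∞ N]
  [RiemannianBundle (fun x : N ↦ TangentSpace (𝓡 (m + 1)) x)]
  [IsContMDiffRiemannianBundle (𝓡 (m + 1)) ∞ (EuclideanSpace ℝ (Fin (m + 1)))
    (fun x : N ↦ TangentSpace (𝓡 (m + 1)) x)]
  {nabla : CovariantDerivative (𝓡 (m + 1)) (EuclideanSpace ℝ (Fin (m + 1)))
    (fun x : N ↦ TangentSpace (𝓡 (m + 1)) x)}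
  {f : M → N} {ν ξ : Π p : M, TangentSpace (𝓡 (m + 1)) (f p)} {p : M}

/-- On the kernel of `df` the connection term of `pullbackDerivative` vanishes, leaving the
derivative of the fibre coordinates transported by a linear isomorphism. -/
theorem mfderiv_alongMap_eq_zero_iff
    (hξ : MDifferentiableAt (𝓡 m) (𝓡 (m + 1)).tangent (alongMap f ξ) p)
    (v : TangentSpace (𝓡 m) p) :
    mfderiv (𝓡 m) (𝓡 (m + 1)).tangent (alongMap f ξ) p v = 0 ↔
      mfderiv (𝓡 m) (𝓡 (m + 1)) f p v = 0 ∧ pullbackDerivative nabla f ξ p v = 0 := by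
  refine (mfderiv_totalSpace_eq_zero_iff
    (V := fun x : N ↦ TangentSpace (𝓡 (m + 1)) x) hξ v).trans (and_congr_right fun hv ↦ ?_)
  replace hv : mfderiv (𝓡 m) (𝓡 (m + 1)) f p v = 0 := hv
  have hp : f p ∈ (trivializationAt (EuclideanSpace ℝ (Fin (m + 1)))
      (fun x : N ↦ TangentSpace (𝓡 (m + 1)) x) (f p)).baseSet :=
    FiberBundle.mem_baseSet_trivializationAt' (f p)
  have h : pullbackDerivative nabla f ξ p v =
      (trivializationAt (EuclideanSpace ℝ (Fin (m + 1)))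
        (fun x : N ↦ TangentSpace (𝓡 (m + 1)) x) (f p)).symmL ℝ (f p)
        (mfderiv (𝓡 m) 𝓘(ℝ, EuclideanSpace ℝ (Fin (m + 1)))
          (fun q ↦ (trivializationAt (EuclideanSpace ℝ (Fin (m + 1)))
            (fun x : N ↦ TangentSpace (𝓡 (m + 1)) x) (f p) (alongMap f ξ q)).2) p v) := by
    rw [pullbackDerivative]
    simp only [_root_.add_apply, ContinuousLinearMap.comp_apply, hv, map_zero, add_zero]
    rfl
  rw [h]
  constructor
  · intro h0
    exact (congrArg ((trivializationAt (EuclideanSpace ℝ (Fin (m + 1)))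
      (fun x : N ↦ TangentSpace (𝓡 (m + 1)) x) (f p)).symmL ℝ (f p)) h0).trans (map_zero _)
  · intro h0
    have h1 := congrArg ((trivializationAt (EuclideanSpace ℝ (Fin (m + 1)))
        (fun x : N ↦ TangentSpace (𝓡 (m + 1)) x) (f p)).continuousLinearMapAt ℝ (f p)) h0
    exact (Trivialization.continuousLinearMapAt_symmL _ hp _).symm.trans (h1.trans (map_zero _))

theorem injective_mfderiv_alongMap_iff
    (hξ : MDifferentiableAt (𝓡 m) (𝓡 (m + 1)).tangent (alongMap f ξ) p) :
    Function.Injective (mfderiv (𝓡 m) (𝓡 (m + 1)).tangent (alongMap f ξ) p) ↔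
      ∀ v : TangentSpace (𝓡 m) p, mfderiv (𝓡 m) (𝓡 (m + 1)) f p v = 0 →
        pullbackDerivative nabla f ξ p v = 0 → v = 0 := by
  rw [injective_iff_map_eq_zero]
  refine forall_congr' fun v ↦ ?_
  rw [mfderiv_alongMap_eq_zero_iff (nabla := nabla) hξ v, and_imp]

/-- Where `f` is an immersion, two unit normal vectors agree up to sign. -/
theorem IsUnitNormalOn.inner_sq_eq_one {U : Set M} (hν : IsUnitNormalOn f ν U)
    (hξ : IsUnitNormalOn f ξ U) (hp : p ∈ U)
    (hinj : Function.Injective (mfderiv (𝓡 m) (𝓡 (m + 1)) f p)) :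
    (inner ℝ (ξ p) (ν p) : ℝ) ^ 2 = 1 := by
  have hfin : FiniteDimensional ℝ (TangentSpace (𝓡 (m + 1)) (f p)) :=
    inferInstanceAs (FiniteDimensional ℝ (EuclideanSpace ℝ (Fin (m + 1))))
  have hrank : Module.finrank ℝ (TangentSpace (𝓡 (m + 1)) (f p)) = m + 1 :=
    finrank_euclideanSpace_fin (𝕜 := ℝ) (n := m + 1)
  let L : TangentSpace (𝓡 m) p →ₗ[ℝ] TangentSpace (𝓡 (m + 1)) (f p) :=
    (mfderiv (𝓡 m) (𝓡 (m + 1)) f p).toLinearMap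
  have hL : Module.finrank ℝ (LinearMap.range L) = m := by
    rw [LinearMap.finrank_range_of_inj hinj]
    exact finrank_euclideanSpace_fin (𝕜 := ℝ) (n := m)
  -- Injectivity of `df` makes its image a hyperplane, so both normals lie on a single line.
  have h1 : Module.finrank ℝ ↥((LinearMap.range L)ᗮ) = 1 := by
    have := Submodule.finrank_add_finrank_orthogonal (LinearMap.range L)
    omega
  have mem {η : Π p : M, TangentSpace (𝓡 (m + 1)) (f p)} (hη : IsUnitNormalOn f η U) :
      η p ∈ (LinearMap.range L)ᗮ := by
    rw [Submodule.mem_orthogonal]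
    rintro _ ⟨v, rfl⟩
    exact hη.normal p hp v
  have hν0 : (⟨ν p, mem hν⟩ : ↥((LinearMap.range L)ᗮ)) ≠ 0 := by
    intro h
    have h0 : ν p = 0 := congrArg Subtype.val h
    have := hν.unit p hp
    simp [h0] at this
  obtain ⟨a, ha⟩ := (finrank_eq_one_iff_of_nonzero' _ hν0).1 h1 ⟨ξ p, mem hξ⟩
  have ha' : a • ν p = ξ p := congrArg Subtype.val ha
  have h2 := hξ.unit p hp
  rw [← ha', inner_smul_left, inner_smul_right, hν.unit p hp] at h2
  rw [← ha', inner_smul_left, hν.unit p hp]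
  simp only [conj_trivial] at h2 ⊢
  linarith

/-- If `f` is an immersion on a dense set, two unit normal vector fields on an open set agree up to
sign. -/
theorem IsUnitNormalOn.inner_sq_eq_one_of_dense {U : Set M} (hU : IsOpen U)
    (hν : IsUnitNormalOn f ν U) (hξ : IsUnitNormalOn f ξ U)
    (hdense : Dense {p : M | Function.Injective (mfderiv (𝓡 m) (𝓡 (m + 1)) f p)}) (hp : p ∈ U) :
    (inner ℝ (ξ p) (ν p) : ℝ) ^ 2 = 1 := by
  by_contra h
  have hc : ContinuousOn (fun q ↦ (inner ℝ (ξ q) (ν q) : ℝ) ^ 2) U := by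
    have : ContMDiffOn (𝓡 m) 𝓘(ℝ, ℝ) ∞ (fun q ↦ (inner ℝ (ξ q) (ν q) : ℝ)) U :=
      ContMDiffOn.inner_bundle hξ.smooth hν.smooth
    exact this.continuousOn.pow 2
  -- If the squared inner product differed from `1` at `p`, it would do so on an open set, which
  -- must meet the dense set of immersion points.
  obtain ⟨q, ⟨hqU, hq⟩, hq'⟩ := hdense.inter_open_nonempty _
    (hc.isOpen_inter_preimage hU (isClosed_singleton (x := (1 : ℝ))).isOpen_compl) ⟨p, hp, h⟩
  exact hq (hν.inner_sq_eq_one hξ hqU hq')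

/-- If `f` is an immersion on a dense set, two unit normal vector fields on an open set have
proportional covariant derivatives. -/
theorem IsUnitNormalOn.pullbackDerivative_eq_of_dense {U : Set M} (hU : IsOpen U)
    (hν : IsUnitNormalOn f ν U) (hξ : IsUnitNormalOn f ξ U)
    (hdense : Dense {p : M | Function.Injective (mfderiv (𝓡 m) (𝓡 (m + 1)) f p)}) (hp : p ∈ U)
    (v : TangentSpace (𝓡 m) p) :
    pullbackDerivative nabla f ξ p v =
      (inner ℝ (ξ p) (ν p) : ℝ) • pullbackDerivative nabla f ν p v := by
  have hνp := (hν.smooth.contMDiffAt (hU.mem_nhds hp)).mdifferentiableAt (by simp)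
  have hξp := (hξ.smooth.contMDiffAt (hU.mem_nhds hp)).mdifferentiableAt (by simp)
  have hsq (q : M) (hq : q ∈ U) := hν.inner_sq_eq_one_of_dense hU hξ hdense hq
  -- Equality case of Cauchy-Schwarz: the difference has squared norm `1 - ⟨ξ, ν⟩² = 0`.
  have hev : ∀ᶠ q in 𝓝 p, ξ q = (inner ℝ (ξ q) (ν q) : ℝ) • ν q := by
    filter_upwards [hU.mem_nhds hp] with q hq
    rw [← sub_eq_zero, ← inner_self_eq_zero (𝕜 := ℝ)]
    simp only [inner_sub_left, inner_sub_right, inner_smul_left, inner_smul_right, hν.unit q hq,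
      hξ.unit q hq, conj_trivial, real_inner_comm (ξ q) (ν q)]
    linarith [hsq q hq]
  set a : M → ℝ := fun q ↦ (inner ℝ (ξ q) (ν q) : ℝ) with ha
  have had : MDifferentiableAt (𝓡 m) 𝓘(ℝ, ℝ) a p := MDifferentiableAt.inner_bundle hξp hνp
  -- Differentiating `a² = 1` gives `a da = 0` with `a ≠ 0`; no connectedness argument for the sign
  -- is needed.
  have hda : mvfderiv (𝓡 m) a p v = 0 := by
    have h1 : a • a =ᶠ[𝓝 p] fun _ ↦ (1 : ℝ) := by
      filter_upwards [hU.mem_nhds hp] with q hq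
      simpa [sq] using hsq q hq
    have h2 := mvfderiv_smul had had
    rw [h1.mvfderiv_eq, mvfderiv_const] at h2
    have h3 := congrArg (fun L ↦ L v) h2
    simp only [_root_.zero_apply, _root_.add_apply, _root_.smul_apply,
      ContinuousLinearMap.smulRight_apply, smul_eq_mul] at h3
    have h4 : a p ≠ 0 := fun h ↦ by
      have h5 : a p ^ 2 = 1 := hsq p hp
      norm_num [h] at h5
    have h5 : a p * mvfderiv (𝓡 m) a p v = 0 := by linarith
    exact (mul_eq_zero.1 h5).resolve_left h4
  have h1 : nabla.along (I := 𝓡 m) f ξ p = nabla.along f (fun q ↦ a q • ν q) p :=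
    nabla.along_congr hev
  change nabla.along (I := 𝓡 m) f ξ p v = _
  rw [h1, nabla.along_smul had hνp]
  simp only [_root_.add_apply, _root_.smul_apply, ContinuousLinearMap.smulRight_apply, hda,
    zero_smul, add_zero]
  rfl

end Fronts

/-! ### Front bundles and fronts -/

section FrontCriteria

set_option linter.unusedSectionVars false
set_option synthInstance.maxHeartbeats 200000

variable {m : ℕ}
  {M : Type*} [TopologicalSpace M] [ChartedSpace (EuclideanSpace ℝ (Fin m)) M]
  [IsManifold (𝓡 m) ∞ M]
  {N : Type*} [TopologicalSpace N] [T2Space N]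
  [ChartedSpace (EuclideanSpace ℝ (Fin (m + 1))) N] [IsManifold (𝓡 (m + 1)) ∞ N]
  [RiemannianBundle (fun x : N ↦ TangentSpace (𝓡 (m + 1)) x)]
  [IsContMDiffRiemannianBundle (𝓡 (m + 1)) ∞ (EuclideanSpace ℝ (Fin (m + 1)))
    (fun x : N ↦ TangentSpace (𝓡 (m + 1)) x)]
  {nabla : CovariantDerivative (𝓡 (m + 1)) (EuclideanSpace ℝ (Fin (m + 1)))
    (fun x : N ↦ TangentSpace (𝓡 (m + 1)) x)}
  {f : M → N} {ν ξ : Π p : M, TangentSpace (𝓡 (m + 1)) (f p)} {p : M}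

/-- If `f` is an immersion on a dense set, it is a front if and only if a given globally defined
unit normal vector field is an immersion. -/
theorem IsUnitNormalOn.isImmersiveOn_iff_isFront (hν : IsUnitNormalOn f ν Set.univ)
    (nabla : CovariantDerivative (𝓡 (m + 1)) (EuclideanSpace ℝ (Fin (m + 1)))
      (fun x : N ↦ TangentSpace (𝓡 (m + 1)) x))
    (hf : ContMDiff (𝓡 m) (𝓡 (m + 1)) ∞ f)
    (hdense : Dense {p : M | Function.Injective (mfderiv (𝓡 m) (𝓡 (m + 1)) f p)}) :
    IsImmersiveOn f ν Set.univ ↔ IsFront m f := by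
  constructor
  · intro h
    exact ⟨hf, fun p ↦ ⟨Set.univ, isOpen_univ, trivial, ν, hν, h⟩⟩
  · rintro ⟨-, h⟩ p -
    obtain ⟨U, hU, hp, ξ, hξ, himm⟩ := h p
    have hνU : IsUnitNormalOn f ν U :=
      ⟨hν.smooth.mono (Set.subset_univ U), fun q _ ↦ hν.unit q trivial,
        fun q _ ↦ hν.normal q trivial⟩
    have hξp := (hξ.smooth.contMDiffAt (hU.mem_nhds hp)).mdifferentiableAt (by simp)
    have hνp := (hνU.smooth.contMDiffAt (hU.mem_nhds hp)).mdifferentiableAt (by simp)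
    rw [injective_mfderiv_alongMap_iff (nabla := nabla) hνp]
    intro v hv hv'
    -- A vector killed by `df` and `∇ν` is also killed by `∇ξ`, which is a multiple of `∇ν`;
    -- immersivity of the local normal `ξ` then forces it to vanish.
    refine (injective_mfderiv_alongMap_iff (nabla := nabla) hξp).1 (himm p hp) v hv ?_
    rw [hνU.pullbackDerivative_eq_of_dense hU hξ hdense hp v, hv', smul_zero]

variable [TopologicalSpace (TotalSpace (EuclideanSpace ℝ (Fin m)) (NormalPerp f ν))]
  [FiberBundle (EuclideanSpace ℝ (Fin m)) (NormalPerp f ν)]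
  [VectorBundle ℝ (EuclideanSpace ℝ (Fin m)) (NormalPerp f ν)]
  [ContMDiffVectorBundle ∞ (EuclideanSpace ℝ (Fin m)) (NormalPerp f ν) (𝓡 m)]
  [IsContMDiffRiemannianBundle (𝓡 m) ∞ (EuclideanSpace ℝ (Fin m)) (NormalPerp f ν)]
  {φ ψ : Π p : M, TangentSpace (𝓡 m) p →L[ℝ] NormalPerp f ν p}

theorem HasAlongRegularity.isFrontBundle_iff (hE : HasAlongRegularity f ν)
    (hν : IsUnitNormalOn f ν Set.univ)
    (hφ : ∀ p v, (φ p v : TangentSpace (𝓡 (m + 1)) (f p)) = mfderiv (𝓡 m) (𝓡 (m + 1)) f p v)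
    (hψ : ∀ p v, (ψ p v : TangentSpace (𝓡 (m + 1)) (f p)) = pullbackDerivative nabla f ν p v)
    (h : IsFrontalBundle (hE.inducedConnection nabla) φ ψ) :
    IsFrontBundle (hE.inducedConnection nabla) φ ψ ↔ IsImmersiveOn f ν Set.univ := by
  have key (p : M) : LinearMap.ker (φ p).toLinearMap ⊓ LinearMap.ker (ψ p).toLinearMap = ⊥ ↔
      Function.Injective (mfderiv (𝓡 m) (𝓡 (m + 1)).tangent (alongMap f ν) p) := by
    rw [injective_mfderiv_alongMap_iff (nabla := nabla) (hν.mdifferentiableAt p),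
      Submodule.eq_bot_iff]
    refine forall_congr' fun v ↦ ?_
    rw [Submodule.mem_inf, LinearMap.mem_ker, LinearMap.mem_ker, and_imp, ← hφ, ← hψ]
    exact imp_congr Subtype.ext_iff (imp_congr Subtype.ext_iff Iff.rfl)
  exact ⟨fun h' p _ ↦ (key p).1 (h'.ker_inter p), fun h' ↦ ⟨h, fun p ↦ (key p).2 (h' p trivial)⟩⟩

end FrontCriteria
end

/-! ### The frontal bundle induced by a co-orientable frontal -/

theorem proposition2 {m : ℕ}
    {M : Type*} [TopologicalSpace M] [T2Space M] [ChartedSpace (EuclideanSpace ℝ (Fin m)) M]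
    [IsManifold (𝓡 m) ∞ M]
    {N : Type*} [TopologicalSpace N] [T2Space N]
    [ChartedSpace (EuclideanSpace ℝ (Fin (m + 1))) N] [IsManifold (𝓡 (m + 1)) ∞ N]
    [RiemannianBundle (fun x : N ↦ TangentSpace (𝓡 (m + 1)) x)]
    [IsContMDiffRiemannianBundle (𝓡 (m + 1)) ∞ (EuclideanSpace ℝ (Fin (m + 1)))
      (fun x : N ↦ TangentSpace (𝓡 (m + 1)) x)]
    (nabla : CovariantDerivative (𝓡 (m + 1)) (EuclideanSpace ℝ (Fin (m + 1)))
      (fun x : N ↦ TangentSpace (𝓡 (m + 1)) x))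
    (hnabla : IsLeviCivita nabla) (c : ℝ) (hc : HasConstantCurvature nabla c)
    (f : M → N) (hf : ContMDiff (𝓡 m) (𝓡 (m + 1)) ∞ f)
    (ν : Π p : M, TangentSpace (𝓡 (m + 1)) (f p)) (hν : IsUnitNormalOn f ν Set.univ) :
    ∃ (_ : TopologicalSpace (TotalSpace (EuclideanSpace ℝ (Fin m)) (NormalPerp f ν)))
      (_ : FiberBundle (EuclideanSpace ℝ (Fin m)) (NormalPerp f ν))
      (_ : VectorBundle ℝ (EuclideanSpace ℝ (Fin m)) (NormalPerp f ν))
      (_ : ContMDiffVectorBundle ∞ (EuclideanSpace ℝ (Fin m)) (NormalPerp f ν) (𝓡 m))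
      (_ : IsContMDiffRiemannianBundle (𝓡 m) ∞ (EuclideanSpace ℝ (Fin m)) (NormalPerp f ν))
      (D : CovariantDerivative (𝓡 m) (EuclideanSpace ℝ (Fin m)) (NormalPerp f ν))
      (φ ψ : Π p : M, TangentSpace (𝓡 m) p →L[ℝ] NormalPerp f ν p),
      IsSubbundleStructure f ν ∧
      (∀ ξ p, D ξ p = inducedDerivative nabla f ν ξ p) ∧
      (∀ p v, (φ p v : TangentSpace (𝓡 (m + 1)) (f p)) = mfderiv (𝓡 m) (𝓡 (m + 1)) f p v) ∧
      (∀ p v, (ψ p v : TangentSpace (𝓡 (m + 1)) (f p)) = pullbackDerivative nabla f ν p v) ∧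
      IsFrontalBundle D φ ψ ∧
      (IsOrientableBundle (m + 1) (m + 1) (fun x : N ↦ TangentSpace (𝓡 (m + 1)) x) →
        IsOrientableBundle m m (NormalPerp f ν)) ∧
      GaussEquation c D φ ψ ∧
      (IsFrontBundle D φ ψ ↔ IsImmersiveOn f ν Set.univ) ∧
      (Dense {p : M | Function.Injective (mfderiv (𝓡 m) (𝓡 (m + 1)) f p)} →
        (IsFrontBundle D φ ψ ↔ IsFront m f)) := by
  obtain ⟨h1, h2, h3, h4, h5, h6, h7⟩ := exists_perpBundle (m := m) hf
    (contMDiffOn_univ.1 hν.smooth) (fun p ↦ hν.unit p trivial)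
  have hE : HasAlongRegularity f ν := ⟨h6, h7⟩
  let φ : Π p : M, TangentSpace (𝓡 m) p →L[ℝ] NormalPerp f ν p := fun p ↦
    (mfderiv (𝓡 m) (𝓡 (m + 1)) f p).codRestrict ((Submodule.span ℝ {ν p})ᗮ) fun v ↦
      (Submodule.mem_orthogonal_singleton_iff_inner_left).2 (hν.normal p trivial v)
  let ψ : Π p : M, TangentSpace (𝓡 m) p →L[ℝ] NormalPerp f ν p := fun p ↦
    (pullbackDerivative nabla f ν p).codRestrict ((Submodule.span ℝ {ν p})ᗮ) fun v ↦
      (Submodule.mem_orthogonal_singleton_iff_inner_right).2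
        (hν.inner_pullbackDerivative hnabla v)
  have hφ : ∀ p v, (φ p v : TangentSpace (𝓡 (m + 1)) (f p)) =
      mfderiv (𝓡 m) (𝓡 (m + 1)) f p v := fun _ _ ↦ rfl
  have hψ : ∀ p v, (ψ p v : TangentSpace (𝓡 (m + 1)) (f p)) =
      pullbackDerivative nabla f ν p v := fun _ _ ↦ rfl
  have hfrontal := hE.isFrontalBundle hnabla hc hf hν hφ hψ
  have hfront : IsFrontBundle (hE.inducedConnection nabla) φ ψ ↔ IsImmersiveOn f ν Set.univ :=
    hE.isFrontBundle_iff hν hφ hψ hfrontal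
  exact ⟨h1, h2, h3, h4, h5, hE.inducedConnection nabla, φ, ψ, hE.isSubbundleStructure,
    fun _ _ ↦ rfl, hφ, hψ, hfrontal, hE.isOrientableBundle hf hν,
    hE.gaussEquation hnabla hc hν hφ hψ, hfront,
    fun hdense ↦ hfront.trans (hν.isImmersiveOn_iff_isFront nabla hf hdense)⟩
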